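/- Let $(\Sigma,h)$ be a smooth finite-dimensional Riemannian manifold (not necessarily connected or complete), and consider the ultrastatic spacetime $(M,g)=(\mathbb{R}\times\Sigma,\,dt^2-h)$, time-oriented by $\partial/\partial t$. Write $\Sigma_t=\{t\}\times\Sigma$. Let $d$ be the Riemannian distance of $h$, i.e. $d(p,q)$ is the infimum of the lengths of curves from $p$ to $q$ (so $d(p,q)=\infty$ if $p,q$ lie in different components). For $K\subseteq\Sigma$ and $t\ge 0$ put $$C(K,t)=\{q\in\Sigma : d(q,K)\le t\},\qquad d(q,K)=\inf_{p\in K}d(q,p).$$ Let $\varepsilon_p\subseteq T_p\Sigma$ be the domain of the exponential map $\exp_p$ of $h$, i.e. the set of $v\in T_p\Sigma$ for which the maximal geodesic with initial velocity $v$ at $p$ is defined at time $1$, and let $\overline{B_t(0)}=\{v\in T_p\Sigma: h_p(v,v)^{1/2}\le t\}$. For $A\subseteq M$ let $J(A)=J^+(A)\cup J^-(A)$, where $J^{+}(A)$ (resp. $J^-(A)$) consists of $A$ together with all end points (resp. starting points) of smooth future-pointing causal curves $\gamma:[a,b]\to M$, $a<b$, that start (resp. end) in $A$. Let $K\subseteq\Sigma$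 be compact, identified with $\{0\}\times K\subseteq\Sigma_0$, and let $t\ge 0$. Then the following statements are equivalent: 1. $C(K,t)$ is compact; 2. $\overline{B_t(0)}\subseteq\varepsilon_p$ for all $p\in K$; 3. $J(K)\cap\Sigma_t$ is compact. If these statements hold, then, identifying $\Sigma_t$ with $\Sigma$ through $(t,x)\mapsto x$, $$C(K,t)=\bigcup_{p\in K}\exp_p\big[\overline{B_t(0)}\big]=J(K)\cap\Sigma_t .$$ -/

import Mathlib

open Bundle
open scoped Manifold ContDiff Topology

noncomputable section

namespace Ultrastatic

section Riemannian

variable {E : Type*} [NormedAddCommGroup E] [NormedSpace ℝ E]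
  {S : Type*} [TopologicalSpace S] [ChartedSpace E S]
  [RiemannianBundle (fun x : S => TangentSpace 𝓘(ℝ, E) x)]

/-- The closed `t`-neighbourhood `C(K,t) = {q | d(q,K) ≤ t}` of `K`, where
`d(q,K) = inf_{p ∈ K} d(q,p)` and `d` is the Riemannian distance. The distance takes values in
`[0,∞]`: it is `∞` between different connected components, and `d(q,∅) = ∞`. -/
def closedNeighborhood (K : Set S) (t : ℝ) : Set S :=
  {q | (⨅ p ∈ K, Manifold.riemannianEDist 𝓘(ℝ, E) q p) ≤ ENNReal.ofReal t}

/-- The Riemannian metric in the chart `φ` around `x₀`: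
`G_y(u,v) = h_{φ⁻¹(y)}(Dφ⁻¹(y) u, Dφ⁻¹(y) v)` for `y` in the target of `φ`. -/
def chartMetric (x₀ : S) (y u v : E) : ℝ :=
  inner ℝ
    (mfderiv 𝓘(ℝ, E) 𝓘(ℝ, E) (extChartAt 𝓘(ℝ, E) x₀).symm y u :
      TangentSpace 𝓘(ℝ, E) ((extChartAt 𝓘(ℝ, E) x₀).symm y))
    (mfderiv 𝓘(ℝ, E) 𝓘(ℝ, E) (extChartAt 𝓘(ℝ, E) x₀).symm y v :
      TangentSpace 𝓘(ℝ, E) ((extChartAt 𝓘(ℝ, E) x₀).symm y))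

/-- The Christoffel symbols of the first kind of the Levi-Civita connection in the chart around
`x₀`: `Γ_y(u,v,w) = (∂_u G(v,w) + ∂_v G(u,w) - ∂_w G(u,v)) / 2 = G(∇_u v, w)` for constant vector
fields `u, v, w` in the chart. -/
def christoffel (x₀ : S) (y u v w : E) : ℝ :=
  (fderiv ℝ (fun z : E => chartMetric x₀ z v w) y u
    + fderiv ℝ (fun z : E => chartMetric x₀ z u w) y v
    - fderiv ℝ (fun z : E => chartMetric x₀ z u v) y w) / 2

/-- `γ` is a geodesic on the open set `J ⊆ ℝ`: it is smooth there, and in every chart, `c = φ ∘ γ`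
satisfies the geodesic equation `∇_{c'} c' = 0`. As the metric is nondegenerate, the equation
is stated after pairing with an arbitrary vector `w`: `G_c(c'', w) + Γ_c(c', c', w) = 0`. -/
def IsGeodesicOn (γ : ℝ → S) (J : Set ℝ) : Prop :=
  ContMDiffOn 𝓘(ℝ, ℝ) 𝓘(ℝ, E) ∞ γ J ∧
    ∀ x₀ : S, ∀ s ∈ J, γ s ∈ (extChartAt 𝓘(ℝ, E) x₀).source →
      ∀ w : E,
        chartMetric x₀ (extChartAt 𝓘(ℝ, E) x₀ (γ s))
            (deriv (deriv fun r => extChartAt 𝓘(ℝ, E) x₀ (γ r)) s) w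
          + christoffel x₀ (extChartAt 𝓘(ℝ, E) x₀ (γ s))
            (deriv (fun r => extChartAt 𝓘(ℝ, E) x₀ (γ r)) s)
            (deriv (fun r => extChartAt 𝓘(ℝ, E) x₀ (γ r)) s) w = 0

/-- `γ` is a geodesic with `γ(0) = p` and `γ'(0) = v`, defined on an open interval that contains
both `0` and `1`. -/
def IsGeodesicFrom (p : S) (v : TangentSpace 𝓘(ℝ, E) p) (γ : ℝ → S) : Prop :=
  ∃ J : Set ℝ, IsOpen J ∧ J.OrdConnected ∧ 0 ∈ J ∧ 1 ∈ J ∧ IsGeodesicOn (E := E) γ J ∧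
    (⟨γ 0, mfderiv 𝓘(ℝ, ℝ) 𝓘(ℝ, E) γ 0 (1 : ℝ)⟩ : TangentBundle 𝓘(ℝ, E) S) = ⟨p, v⟩

/-- The domain `ε_p ⊆ T_p S` of the exponential map: the `v` for which the maximal geodesic with
initial velocity `v` at `p` is defined at time `1`. -/
def expDomain (p : S) : Set (TangentSpace 𝓘(ℝ, E) p) :=
  {v | ∃ γ : ℝ → S, IsGeodesicFrom p v γ}

open Classical in
/-- The exponential map: `exp_p v = γ(1)` for the geodesic `γ` with initial velocity `v ∈ ε_p`
(independent of the choice of `γ`, as geodesics are determined by their initial data). Outside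
`ε_p` the value is the placeholder `p`. -/
def expMap (p : S) (v : TangentSpace 𝓘(ℝ, E) p) : S :=
  if h : ∃ γ : ℝ → S, IsGeodesicFrom p v γ then h.choose 1 else p

end Riemannian

section Spacetime

variable {E : Type*} [NormedAddCommGroup E] [NormedSpace ℝ E]
  {S : Type*} [TopologicalSpace S] [ChartedSpace E S]
  [RiemannianBundle (fun x : S => TangentSpace 𝓘(ℝ, E) x)]

/-- The component `Dπ₁(u) ∈ ℝ` of a tangent vector `u` of `ℝ × S`. -/
def timePart (m : ℝ × S) (u : TangentSpace (𝓘(ℝ, ℝ).prod 𝓘(ℝ, E)) m) : ℝ :=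
  mfderiv (𝓘(ℝ, ℝ).prod 𝓘(ℝ, E)) 𝓘(ℝ, ℝ) (Prod.fst : ℝ × S → ℝ) m u

/-- The component `Dπ₂(u) ∈ T_x S` of a tangent vector `u` of `ℝ × S` at `m = (t,x)`. -/
def spacePart (m : ℝ × S) (u : TangentSpace (𝓘(ℝ, ℝ).prod 𝓘(ℝ, E)) m) :
    TangentSpace 𝓘(ℝ, E) m.2 :=
  mfderiv (𝓘(ℝ, ℝ).prod 𝓘(ℝ, E)) 𝓘(ℝ, E) (Prod.snd : ℝ × S → S) m u

/-- The Lorentzian metric `g = π₁^*(dt ⊗ dt) - π₂^* h` on `ℝ × S`. -/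
def lorentz (m : ℝ × S) (u v : TangentSpace (𝓘(ℝ, ℝ).prod 𝓘(ℝ, E)) m) : ℝ :=
  timePart m u * timePart m v - inner ℝ (spacePart m u) (spacePart m v)

variable (E) in
/-- The vector field `∂/∂t` on `ℝ × S`, i.e. the velocity of `τ ↦ (τ, x)`; it fixes the time
orientation. -/
def timeField (m : ℝ × S) : TangentSpace (𝓘(ℝ, ℝ).prod 𝓘(ℝ, E)) m :=
  mfderiv 𝓘(ℝ, ℝ) (𝓘(ℝ, ℝ).prod 𝓘(ℝ, E)) (fun τ : ℝ => (τ, m.2)) m.1 (1 : ℝ)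

variable (E) in
/-- `γ : [a,b] → ℝ × S` is a smooth future-pointing causal curve: `g(γ', γ') ≥ 0` and
`g(γ', ∂/∂t) > 0` (in particular `γ' ≠ 0`) at every time in `[a,b]`. -/
def IsFutureCausalCurve (γ : ℝ → ℝ × S) (a b : ℝ) : Prop :=
  a < b ∧ ContMDiffOn 𝓘(ℝ, ℝ) (𝓘(ℝ, ℝ).prod 𝓘(ℝ, E)) ∞ γ (Set.Icc a b) ∧
    ∀ s ∈ Set.Icc a b,
      0 ≤ lorentz (E := E) (γ s)
        (mfderivWithin 𝓘(ℝ, ℝ) (𝓘(ℝ, ℝ).prod 𝓘(ℝ, E)) γ (Set.Icc a b) s (1 : ℝ))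
        (mfderivWithin 𝓘(ℝ, ℝ) (𝓘(ℝ, ℝ).prod 𝓘(ℝ, E)) γ (Set.Icc a b) s (1 : ℝ)) ∧
      0 < lorentz (E := E) (γ s)
        (mfderivWithin 𝓘(ℝ, ℝ) (𝓘(ℝ, ℝ).prod 𝓘(ℝ, E)) γ (Set.Icc a b) s (1 : ℝ))
        (timeField E (γ s))

variable (E) in
/-- The causal future `J⁺(A)`, which contains `A` by convention. -/
def causalFuture (A : Set (ℝ × S)) : Set (ℝ × S) :=
  A ∪ {q | ∃ p ∈ A, ∃ (γ : ℝ → ℝ × S) (a b : ℝ),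
    IsFutureCausalCurve E γ a b ∧ γ a = p ∧ γ b = q}

variable (E) in
/-- The causal past `J⁻(A)`, which contains `A` by convention. -/
def causalPast (A : Set (ℝ × S)) : Set (ℝ × S) :=
  A ∪ {q | ∃ p ∈ A, ∃ (γ : ℝ → ℝ × S) (a b : ℝ),
    IsFutureCausalCurve E γ a b ∧ γ a = q ∧ γ b = p}

variable (E) in
/-- `J(A) = J⁺(A) ∪ J⁻(A)`. -/
def causalInfluence (A : Set (ℝ × S)) : Set (ℝ × S) :=
  causalFuture E A ∪ causalPast E A

/-- The slice `Σ_t = {t} × S` of the spacetime. -/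
def timeSlice (S : Type*) (t : ℝ) : Set (ℝ × S) := {t} ×ˢ (Set.univ : Set S)

end Spacetime

end Ultrastatic

end

noncomputable section

namespace Ultrastatic

set_option maxSynthPendingDepth 3

/-! Condition 2 is the hub. A geodesic `γ` from `p ∈ K` with `‖v‖ ≤ t` has constant speed, so up to
time 1 it stays in C(K,t). For t > 0 and each s in [0,1] where `γ` is defined, the curve σ ↦ (tσ,
γ(sσ)) is causal and ends at (t, γ(s)), so `γ` also stays in the projection of J(K) ∩ Σ_t. If either
set is compact, the velocities of `γ` lie in a compact part of the tangent bundle, the geodesic flow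
runs there for a uniform time, and `γ` reaches time 1 (`mem_expDomain_of_forall_mem`). This gives 1
⇒ 2 and 3 ⇒ 2.

Conversely, assume 2. A Hopf–Rinow argument based at a single point (`exists_expMap_eq`) reaches
every point of C(K,t) by a geodesic of length at most t from K. Hence C(K,t) is the image, under the
continuous exponential map, of the compact bundle of closed t-balls over K. The lifts above put
C(K,t) into J(K) ∩ Σ_t; the reverse inclusion holds because the spatial length of a causal curve is
at most the elapsed time.

The local input is that short geodesics minimize length and contain every point lying metrically
between their ends (`exists_local_minimizing`). It is obtained from convexity of the energy instead
of the Gauss lemma. In a chart, the energy of a competitor exceeds that of the geodesic by a first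
variation, which integrates to zero by the geodesic equation, plus a positive quadratic term that
absorbs the second-order error once the geodesic is slow. Parametrizing the competitor almost by arc
length turns energy into squared length, and the leftover quadratic gain keeps almost minimizing
curves close to the geodesic. The betweenness statement also takes the place of the usual "a
minimizer has no corner" step in Hopf–Rinow. -/

/-- A smooth Riemannian metric on an open subset of a vector space. -/
structure LocalMetric (E : Type*) [NormedAddCommGroup E] [NormedSpace ℝ E] where
  dom : Set E
  form : E → E →L[ℝ] E →L[ℝ] ℝ
  isOpen_dom : IsOpen dom
  contDiffOn_form : ContDiffOn ℝ ∞ form dom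
  symm : ∀ y ∈ dom, ∀ u v, form y u v = form y v u
  pos : ∀ y ∈ dom, ∀ u, u ≠ 0 → 0 < form y u u

namespace LocalMetric

variable {E : Type*} [NormedAddCommGroup E] [NormedSpace ℝ E]

/-! ### Christoffel symbols and the geodesic spray of a metric on an open set of a vector space -/

section Spray

variable (G : LocalMetric E)

/-- `w ↦ Γ_y(u,u,w)`, the Christoffel symbols of the first kind. -/
def lowerChristoffel (y u : E) : E →L[ℝ] ℝ :=
  fderiv ℝ G.form y u u - (1 / 2 : ℝ) •
    (ContinuousLinearMap.apply ℝ ℝ u ∘L ContinuousLinearMap.apply ℝ (E →L[ℝ] ℝ) u ∘L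
      fderiv ℝ G.form y)

lemma lowerChristoffel_apply (y u w : E) :
    G.lowerChristoffel y u w
      = fderiv ℝ G.form y u u w - (1 / 2 : ℝ) * fderiv ℝ G.form y w u u := by
  simp [lowerChristoffel]

/-- The geodesic spray: geodesics satisfy `c'' = spray c c'`. -/
def spray (y u : E) : E := -(G.form y).inverse (G.lowerChristoffel y u)

variable {G}

lemma contDiffAt_form {y : E} (hy : y ∈ G.dom) : ContDiffAt ℝ ∞ G.form y :=
  G.contDiffOn_form.contDiffAt (G.isOpen_dom.mem_nhds hy)

lemma hasFDerivAt_form {y : E} (hy : y ∈ G.dom) :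
    HasFDerivAt G.form (fderiv ℝ G.form y) y :=
  ((contDiffAt_form hy).differentiableAt (by simp)).hasFDerivAt

lemma contDiffOn_fderiv_form : ContDiffOn ℝ ∞ (fderiv ℝ G.form) G.dom :=
  G.contDiffOn_form.fderiv_of_isOpen G.isOpen_dom (by simp)

lemma nonneg {y : E} (hy : y ∈ G.dom) (u : E) : 0 ≤ G.form y u u := by
  rcases eq_or_ne u 0 with rfl | hu
  · simp
  · exact (G.pos y hy u hu).le

lemma lowerChristoffel_smul (y u : E) (r : ℝ) :
    G.lowerChristoffel y (r • u) = r ^ 2 • G.lowerChristoffel y u := by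
  ext w
  simp only [lowerChristoffel_apply, map_smul, smul_apply, smul_eq_mul]
  ring

/-- Quadratic homogeneity in the velocity is what makes geodesics stable under affine changes of
time, and what makes the spray weakly Lipschitz at small velocities. -/
lemma spray_smul (y u : E) (r : ℝ) : G.spray y (r • u) = r ^ 2 • G.spray y u := by
  simp [spray, lowerChristoffel_smul]

lemma spray_zero (y : E) : G.spray y 0 = 0 := by
  simpa using G.spray_smul y 0 0

variable [FiniteDimensional ℝ E]

lemma exists_equiv {y : E} (hy : y ∈ G.dom) :
    ∃ e : E ≃L[ℝ] (E →L[ℝ] ℝ), (e : E →L[ℝ] (E →L[ℝ] ℝ)) = G.form y := by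
  have inj : Function.Injective (G.form y : E →ₗ[ℝ] (E →L[ℝ] ℝ)) := by
    rw [← LinearMap.ker_eq_bot, LinearMap.ker_eq_bot']
    intro u hu
    by_contra hne
    have := G.pos y hy u hne
    have h2 : G.form y u = 0 := hu
    simp [h2] at this
  have dim : Module.finrank ℝ E = Module.finrank ℝ (E →L[ℝ] ℝ) := by
    rw [← (LinearMap.toContinuousLinearMap : (E →ₗ[ℝ] ℝ) ≃ₗ[ℝ] (E →L[ℝ] ℝ)).finrank_eq]
    exact (Subspace.dual_finrank_eq (K := ℝ) (V := E)).symm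
  refine ⟨(LinearEquiv.ofInjectiveOfFinrankEq _ inj dim).toContinuousLinearEquiv, ?_⟩
  ext u v
  rfl

lemma form_spray {y : E} (hy : y ∈ G.dom) (u w : E) :
    G.form y (G.spray y u) w = -G.lowerChristoffel y u w := by
  obtain ⟨e, he⟩ := exists_equiv hy
  rw [spray, ← he, ContinuousLinearMap.inverse_equiv]
  simp

/-- Nondegeneracy turns the geodesic equation paired with arbitrary vectors into an explicit
second-order ODE. -/
lemma eq_spray {y : E} (hy : y ∈ G.dom) {u a : E}
    (h : ∀ w, G.form y a w + G.lowerChristoffel y u w = 0) : a = G.spray y u := by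
  have key : ∀ w, G.form y (a - G.spray y u) w = 0 := fun w => by
    rw [map_sub, sub_apply, form_spray hy]
    linarith [h w]
  by_contra hne
  exact (G.pos y hy _ (sub_ne_zero.2 hne)).ne' (key _)

lemma contDiffOn_lowerChristoffel :
    ContDiffOn ℝ ∞ (fun z : E × E => G.lowerChristoffel z.1 z.2) (G.dom ×ˢ Set.univ) := by
  rw [contDiffOn_clm_apply]
  intro w
  simp only [lowerChristoffel_apply]
  have h : ContDiffOn ℝ ∞ (fun z : E × E => fderiv ℝ G.form z.1) (G.dom ×ˢ Set.univ) :=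
    contDiffOn_fderiv_form.comp contDiff_fst.contDiffOn (fun z hz => hz.1)
  have h2 : ContDiffOn ℝ ∞ (fun z : E × E => z.2) (G.dom ×ˢ Set.univ) := contDiff_snd.contDiffOn
  exact (((h.clm_apply h2).clm_apply h2).clm_apply contDiffOn_const).sub
    (contDiffOn_const.mul (((h.clm_apply contDiffOn_const).clm_apply h2).clm_apply h2))

lemma contDiffOn_spray :
    ContDiffOn ℝ ∞ (fun z : E × E => G.spray z.1 z.2) (G.dom ×ˢ Set.univ) := by
  have h : ContDiffOn ℝ ∞ (fun z : E × E => (G.form z.1).inverse) (G.dom ×ˢ Set.univ) := by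
    intro z hz
    obtain ⟨e, he⟩ := exists_equiv hz.1
    have h1 : ContDiffAt ℝ ∞ ContinuousLinearMap.inverse (G.form z.1) := by
      rw [← he]
      exact contDiffAt_map_inverse e
    exact (h1.comp z ((contDiffAt_form hz.1).comp z contDiffAt_fst)).contDiffWithinAt
  exact (h.clm_apply contDiffOn_lowerChristoffel).neg

lemma contDiffAt_spray {y : E} (hy : y ∈ G.dom) (u : E) :
    ContDiffAt ℝ ∞ (fun z : E × E => G.spray z.1 z.2) (y, u) :=
  contDiffOn_spray.contDiffAt ((G.isOpen_dom.prod isOpen_univ).mem_nhds ⟨hy, trivial⟩)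

end Spray

/-! ### Geodesics as solutions of a first-order system, and their local flow -/

section Solution

/-- `c` is a geodesic of `G` with velocity `v` on `J`. -/
structure IsSolutionOn (G : LocalMetric E) (c v : ℝ → E) (J : Set ℝ) : Prop where
  mem : ∀ s ∈ J, c s ∈ G.dom
  deriv_pos : ∀ s ∈ J, HasDerivAt c (v s) s
  deriv_vel : ∀ s ∈ J, HasDerivAt v (G.spray (c s) (v s)) s

variable {G : LocalMetric E} {c v : ℝ → E} {J : Set ℝ}

lemma IsSolutionOn.mono {J' : Set ℝ} (h : G.IsSolutionOn c v J) (hJ : J' ⊆ J) :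
    G.IsSolutionOn c v J' :=
  ⟨fun s hs => h.1 s (hJ hs), fun s hs => h.2 s (hJ hs), fun s hs => h.3 s (hJ hs)⟩

lemma IsSolutionOn.hasDerivAt (h : G.IsSolutionOn c v J) {s : ℝ} (hs : s ∈ J) :
    HasDerivAt (fun r => (c r, v r)) (v s, G.spray (c s) (v s)) s :=
  (h.deriv_pos s hs).prodMk (h.deriv_vel s hs)

lemma isSolutionOn_const {y : E} (hy : y ∈ G.dom) (J : Set ℝ) :
    G.IsSolutionOn (fun _ => y) (fun _ => 0) J :=
  ⟨fun _ _ => hy, fun s _ => hasDerivAt_const s y, fun s _ => by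
    rw [spray_zero]; exact hasDerivAt_const s 0⟩

lemma IsSolutionOn.comp_mul (h : G.IsSolutionOn c v J) (a : ℝ) :
    G.IsSolutionOn (fun s => c (a * s)) (fun s => a • v (a * s)) ((a * ·) ⁻¹' J) := by
  have ha (s : ℝ) : HasDerivAt (fun s => a * s) a s := by
    simpa using (hasDerivAt_id s).const_mul a
  refine ⟨fun s hs => h.mem _ hs, fun s hs => ?_, fun s hs => ?_⟩
  · exact (h.deriv_pos _ hs).scomp s (ha s)
  · rw [spray_smul, pow_two, mul_smul]
    exact ((h.deriv_vel _ hs).scomp s (ha s)).const_smul a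

lemma hasDerivAt_form_apply {c v w : ℝ → E} {c' v' w' : E} {s : ℝ} (hs : c s ∈ G.dom)
    (hc : HasDerivAt c c' s) (hv : HasDerivAt v v' s) (hw : HasDerivAt w w' s) :
    HasDerivAt (fun r => G.form (c r) (v r) (w r))
      (fderiv ℝ G.form (c s) c' (v s) (w s) + G.form (c s) v' (w s) + G.form (c s) (v s) w') s := by
  have h := ((((hasFDerivAt_form hs).comp_hasDerivAt s hc).clm_apply hv).clm_apply hw)
  simpa using h

variable [FiniteDimensional ℝ E]

/-- The two acceleration terms contribute -2Γ(v,v,v), which equals minus the derivative of the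
metric along v applied to (v,v), so the product rule gives zero. -/
lemma IsSolutionOn.hasDerivAt_energy (h : G.IsSolutionOn c v J) {s : ℝ} (hs : s ∈ J) :
    HasDerivAt (fun r => G.form (c r) (v r) (v r)) 0 s := by
  have h1 := hasDerivAt_form_apply (h.mem s hs) (h.deriv_pos s hs) (h.deriv_vel s hs)
    (h.deriv_vel s hs)
  convert h1 using 1
  rw [G.symm _ (h.mem s hs) (v s), form_spray (h.mem s hs), lowerChristoffel_apply]
  ring

/-- Bootstrapping: the derivative of (c,v) is a smooth function of (c,v), so each order of
regularity yields the next. -/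
lemma IsSolutionOn.contDiffOn (h : G.IsSolutionOn c v J) (hJ : IsOpen J) :
    ContDiffOn ℝ ∞ (fun s => (c s, v s)) J := by
  rw [contDiffOn_infty]
  intro n
  induction n with
  | zero =>
    have hc : ContinuousOn (fun s => (c s, v s)) J :=
      fun s hs => (h.hasDerivAt hs).continuousAt.continuousWithinAt
    exact contDiffOn_zero.2 hc
  | succ n ih =>
    rw [Nat.cast_add, Nat.cast_one, contDiffOn_succ_iff_deriv_of_isOpen hJ]
    refine ⟨fun s hs => (h.hasDerivAt hs).differentiableAt.differentiableWithinAt,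
      by simp, ?_⟩
    have h1 : ContDiffOn ℝ n (fun s => (v s, G.spray (c s) (v s))) J := by
      refine (contDiff_snd.comp_contDiffOn ih).prodMk ?_
      exact (contDiffOn_spray.of_le (by exact_mod_cast le_top)).comp ih
        (fun s hs => ⟨h.mem s hs, trivial⟩)
    exact h1.congr fun s hs => (h.hasDerivAt hs).deriv

lemma contDiffAt_vectorField {z : E × E} (hz : z.1 ∈ G.dom) :
    ContDiffAt ℝ ∞ (fun z : E × E => (z.2, G.spray z.1 z.2)) z :=
  contDiffAt_snd.prodMk (contDiffAt_spray hz z.2)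

/-- Two geodesics with the same position and velocity at one time agree near that time. -/
lemma IsSolutionOn.eventuallyEq {c₁ v₁ c₂ v₂ : ℝ → E} {s : ℝ} (hJ : J ∈ 𝓝 s)
    (h₁ : G.IsSolutionOn c₁ v₁ J) (h₂ : G.IsSolutionOn c₂ v₂ J)
    (hc : c₁ s = c₂ s) (hv : v₁ s = v₂ s) :
    (fun r => (c₁ r, v₁ r)) =ᶠ[𝓝 s] fun r => (c₂ r, v₂ r) := by
  have hs := mem_of_mem_nhds hJ
  obtain ⟨K, t, ht, hK⟩ := ((contDiffAt_vectorField (G := G) (z := (c₁ s, v₁ s))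
    (h₁.mem s hs)).of_le (m := 1) (by exact_mod_cast le_top)).exists_lipschitzOnWith
  refine ODE_solution_unique_of_eventually (v := fun _ z => (z.2, G.spray z.1 z.2))
    (s := fun _ => t) (K := K) (.of_forall fun _ => hK) ?_ ?_ (by simp [hc, hv])
  · filter_upwards [hJ, (h₁.hasDerivAt hs).continuousAt ht] with r hr hr'
    exact ⟨h₁.hasDerivAt hr, hr'⟩
  · have ht' : t ∈ 𝓝 (c₂ s, v₂ s) := by rwa [← hc, ← hv]
    filter_upwards [hJ, (h₂.hasDerivAt hs).continuousAt ht'] with r hr hr'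
    exact ⟨h₂.hasDerivAt hr, hr'⟩

/-- The local geodesic flow. -/
lemma exists_flow {z₀ : E × E} (hz₀ : z₀.1 ∈ G.dom) {U : Set (E × E)} (hU : U ∈ 𝓝 z₀) :
    ∃ r > (0 : ℝ), ∃ ε > (0 : ℝ), ∃ α : (E × E) × ℝ → E × E,
      (∀ z ∈ Metric.closedBall z₀ r, α (z, 0) = z ∧ (∀ s ∈ Set.Ioo (-ε) ε, α (z, s) ∈ U) ∧
        G.IsSolutionOn (fun s => (α (z, s)).1) (fun s => (α (z, s)).2) (Set.Ioo (-ε) ε)) ∧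
      ContinuousOn α (Metric.closedBall z₀ r ×ˢ Set.Ioo (-ε) ε) := by
  obtain ⟨ε, hε, a, r, L, K, hr, hP⟩ := IsPicardLindelof.of_contDiffAt_one
    ((contDiffAt_vectorField (G := G) hz₀).of_le (m := 1) (by exact_mod_cast le_top))
  obtain ⟨α, hα, hcont⟩ :=
    (hP 0).exists_forall_mem_closedBall_eq_hasDerivWithinAt_continuousOn
  simp only [zero_sub, zero_add] at hα hcont
  have hr' : (0 : ℝ) < r := hr
  have hat : ContinuousAt α (z₀, 0) := hcont.continuousAt
    (prod_mem_nhds (Metric.closedBall_mem_nhds _ hr') (Icc_mem_nhds (by linarith) hε))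
  -- Picard–Lindelöf does not by itself say that the trajectories remain in `U` and over `G.dom`;
  -- joint continuity at `(z₀, 0)` allows shrinking the ball and the time interval until they do.
  have hV : U ∩ Prod.fst ⁻¹' G.dom ∈ 𝓝 (α (z₀, 0)) := by
    rw [(hα z₀ (Metric.mem_closedBall_self hr'.le)).1]
    exact Filter.inter_mem hU (continuousAt_fst (G.isOpen_dom.mem_nhds hz₀))
  obtain ⟨δ, hδ, hball⟩ := Metric.mem_nhds_iff.1 (hat hV)
  have hmem : ∀ z ∈ Metric.closedBall z₀ (min r (δ / 2)), ∀ s ∈ Set.Ioo (-(min ε δ)) (min ε δ),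
      α (z, s) ∈ U ∩ Prod.fst ⁻¹' G.dom := by
    intro z hz s hs
    refine hball (a := (z, s)) ?_
    rw [Metric.mem_ball, Prod.dist_eq]
    have h1 := Metric.mem_closedBall.1 hz
    refine max_lt ?_ ?_
    · have := h1.trans (min_le_right _ _)
      simp only
      linarith
    · rw [Real.dist_eq, sub_zero, abs_lt]
      exact ⟨by linarith [hs.1, min_le_right ε δ], by linarith [hs.2, min_le_right ε δ]⟩
  have hsub : Metric.closedBall z₀ (min (r : ℝ) (δ / 2)) ⊆ Metric.closedBall z₀ r :=
    Metric.closedBall_subset_closedBall (min_le_left _ _)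
  have hsub' : Set.Ioo (-(min ε δ)) (min ε δ) ⊆ Set.Ioo (-ε) ε :=
    Set.Ioo_subset_Ioo (by linarith [min_le_left ε δ]) (min_le_left _ _)
  refine ⟨min r (δ / 2), lt_min hr' (by linarith), min ε δ, lt_min hε hδ, α, fun z hz => ?_,
    hcont.mono (Set.prod_mono hsub (hsub'.trans Set.Ioo_subset_Icc_self))⟩
  have hd : ∀ s ∈ Set.Ioo (-(min ε δ)) (min ε δ),
      HasDerivAt (fun s => α (z, s)) ((α (z, s)).2, G.spray (α (z, s)).1 (α (z, s)).2) s :=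
    fun s hs => ((hα z (hsub hz)).2 s (Set.Ioo_subset_Icc_self (hsub' hs))).hasDerivAt
      (Icc_mem_nhds (hsub' hs).1 (hsub' hs).2)
  exact ⟨(hα z (hsub hz)).1, fun s hs => (hmem z hz s hs).1,
    fun s hs => (hmem z hz s hs).2, fun s hs => (hd s hs).fst, fun s hs => (hd s hs).snd⟩

end Solution

end LocalMetric

/-! ### Uniform local bounds and short geodesics joining nearby points -/

namespace LocalMetric

variable {E : Type*} [NormedAddCommGroup E] [NormedSpace ℝ E] [FiniteDimensional ℝ E]
  {G : LocalMetric E}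

lemma exists_coercive {y : E} (hy : y ∈ G.dom) :
    ∃ l > (0 : ℝ), ∀ u, l * ‖u‖ ^ 2 ≤ G.form y u u := by
  rcases subsingleton_or_nontrivial E with hE | hE
  · exact ⟨1, one_pos, fun u => by simp [Subsingleton.elim u 0]⟩
  have hcont : Continuous fun u => G.form y u u :=
    ((G.form y).continuous).clm_apply continuous_id
  obtain ⟨u₀, hu₀, hmin⟩ := (isCompact_sphere (0 : E) 1).exists_isMinOn
    (NormedSpace.sphere_nonempty.2 zero_le_one) hcont.continuousOn
  have hu₀' : u₀ ≠ 0 := by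
    rintro rfl
    simp at hu₀
  refine ⟨_, G.pos y hy u₀ hu₀', fun u => ?_⟩
  rcases eq_or_ne u 0 with rfl | hu
  · simp
  have hn : ‖u‖ ≠ 0 := norm_ne_zero_iff.2 hu
  have h := hmin (a := ‖u‖⁻¹ • u) (by simp [norm_smul, hn])
  simp only [Set.mem_ofPred_eq, map_smul, smul_apply, smul_eq_mul] at h
  calc G.form y u₀ u₀ * ‖u‖ ^ 2 ≤ (‖u‖⁻¹ * (‖u‖⁻¹ * G.form y u u)) * ‖u‖ ^ 2 := by gcongr
    _ = G.form y u u := by field_simp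

omit [FiniteDimensional ℝ E] in
lemma abs_form_apply_le (B : E →L[ℝ] E →L[ℝ] ℝ) (u v : E) : |B u v| ≤ ‖B‖ * ‖u‖ * ‖v‖ := by
  simpa using B.le_opNorm₂ u v

/-- Near any point, the metric is uniformly convex along straight segments and the spray is
Lipschitz. -/
lemma exists_bounds {y₀ : E} (hy₀ : y₀ ∈ G.dom) :
    ∃ a > (0 : ℝ), ∃ l > (0 : ℝ), ∃ C : ℝ, ∃ K : ℝ, 0 < K ∧ Metric.closedBall y₀ a ⊆ G.dom ∧
      (∀ y ∈ Metric.closedBall y₀ a, ∀ y' ∈ Metric.closedBall y₀ a, ∀ u ν : E,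
        G.form y u u + fderiv ℝ G.form y (y' - y) u u + 2 * G.form y u ν + l * ‖ν‖ ^ 2
          - C * ‖y' - y‖ ^ 2 * ‖u‖ ^ 2 ≤ G.form y' (u + ν) (u + ν)) ∧
      (∀ y ∈ Metric.closedBall y₀ a, ∀ y' ∈ Metric.closedBall y₀ a,
        ∀ u ∈ Metric.closedBall (0 : E) a, ∀ u' ∈ Metric.closedBall (0 : E) a,
        ‖G.spray y u - G.spray y' u'‖ ≤ K * max ‖y - y'‖ ‖u - u'‖) := by
  obtain ⟨l, hl, hco⟩ := exists_coercive hy₀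
  obtain ⟨A, sA, hsA, hA⟩ := ((contDiffAt_form hy₀).of_le (m := 1)
    (by exact_mod_cast le_top)).exists_lipschitzOnWith
  obtain ⟨D, sD, hsD, hD⟩ := (((contDiffOn_fderiv_form (G := G)).contDiffAt
    (G.isOpen_dom.mem_nhds hy₀)).of_le (m := 1) (by exact_mod_cast le_top)).exists_lipschitzOnWith
  obtain ⟨K, sK, hsK, hK⟩ := ((contDiffAt_spray (G := G) hy₀ 0).of_le (m := 1)
    (by exact_mod_cast le_top)).exists_lipschitzOnWith
  obtain ⟨δ, hδ, hball⟩ := Metric.nhds_basis_closedBall.mem_iff.1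
    (Filter.inter_mem (Filter.inter_mem hsA hsD) (G.isOpen_dom.mem_nhds hy₀))
  obtain ⟨δ', hδ', hball'⟩ := Metric.nhds_basis_closedBall.mem_iff.1 hsK
  -- The bound `l / (2 * (A + 1))` keeps the form within `l / 2` of its value at `y₀`, so half of
  -- the coercivity constant survives on the whole ball.
  set a := min (min δ δ') (l / (2 * (A + 1))) with ha
  have hA0 : (0 : ℝ) ≤ A := A.2
  have ha0 : 0 < a := by positivity
  have haδ : Metric.closedBall y₀ a ⊆ Metric.closedBall y₀ δ :=
    Metric.closedBall_subset_closedBall ((min_le_left _ _).trans (min_le_left _ _))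
  have hdom : Metric.closedBall y₀ a ⊆ G.dom := fun y hy => (hball (haδ hy)).2
  have hAle : ∀ y ∈ Metric.closedBall y₀ a, ∀ y' ∈ Metric.closedBall y₀ a,
      ‖G.form y' - G.form y‖ ≤ A * ‖y' - y‖ := fun y hy y' hy' => by
    simpa [dist_eq_norm] using hA.dist_le_mul y' (hball (haδ hy')).1.1 y (hball (haδ hy)).1.1
  have hDle : ∀ y ∈ Metric.closedBall y₀ a, ∀ y' ∈ Metric.closedBall y₀ a,
      ‖G.form y' - G.form y - fderiv ℝ G.form y (y' - y)‖ ≤ (D * ‖y' - y‖) * ‖y' - y‖ := by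
    intro y hy y' hy'
    have hc : Convex ℝ (Metric.closedBall y₀ a ∩ Metric.closedBall y ‖y' - y‖) :=
      (convex_closedBall _ _).inter (convex_closedBall _ _)
    refine hc.norm_image_sub_le_of_norm_hasFDerivWithin_le' (f' := fderiv ℝ G.form)
      (fun z hz => (hasFDerivAt_form (hdom hz.1)).hasFDerivWithinAt) (fun z hz => ?_)
      ⟨hy, Metric.mem_closedBall_self (norm_nonneg _)⟩ ⟨hy', by simp [dist_eq_norm]⟩
    have h1 := hD.dist_le_mul z (hball (haδ hz.1)).1.2 y (hball (haδ hy)).1.2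
    rw [dist_eq_norm, dist_eq_norm] at h1
    refine h1.trans ?_
    gcongr
    simpa [dist_eq_norm] using hz.2
  have hco' : ∀ y ∈ Metric.closedBall y₀ a, ∀ ν, l / 2 * ‖ν‖ ^ 2 ≤ G.form y ν ν := by
    intro y hy ν
    have h1 := hAle y₀ (Metric.mem_closedBall_self ha0.le) y hy
    have h2 := (abs_le.1 (abs_form_apply_le (G.form y - G.form y₀) ν ν)).1
    simp only [sub_apply] at h2
    have h3 : ‖y - y₀‖ ≤ l / (2 * (A + 1)) := by
      have := Metric.mem_closedBall.1 hy
      rw [dist_eq_norm] at this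
      exact this.trans (min_le_right _ _)
    have h4 : ‖G.form y - G.form y₀‖ ≤ l / 2 := by
      refine h1.trans ((mul_le_mul_of_nonneg_left h3 hA0).trans ?_)
      rw [mul_div_assoc', div_le_div_iff₀ (by positivity) two_pos]
      nlinarith
    have h5 : ‖G.form y - G.form y₀‖ * ‖ν‖ * ‖ν‖ ≤ l / 2 * ‖ν‖ * ‖ν‖ := by gcongr
    nlinarith [hco ν]
  -- Here `D` bounds the Taylor remainder of the form. The cross term 2A‖y'-y‖‖u‖‖ν‖ is split by
  -- Young's inequality: it costs `l / 4` of the available `l / 2` and adds `4 * A ^ 2 / l` to the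
  -- error constant.
  refine ⟨a, ha0, l / 4, by positivity, D + 4 * A ^ 2 / l, K + 1, by positivity, hdom, ?_, ?_⟩
  · intro y hy y' hy' u ν
    have e1 : G.form y' (u + ν) (u + ν)
        = G.form y' u u + 2 * G.form y' u ν + G.form y' ν ν := by
      simp only [map_add, add_apply, G.symm y' (hdom hy') ν u]
      ring
    have b1 := (abs_le.1 (abs_form_apply_le
      (G.form y' - G.form y - fderiv ℝ G.form y (y' - y)) u u)).1
    have b2 := (abs_le.1 (abs_form_apply_le (G.form y' - G.form y) u ν)).1
    have b3 := hco' y' hy' ν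
    simp only [sub_apply] at b1 b2
    have c1 : ‖G.form y' - G.form y - fderiv ℝ G.form y (y' - y)‖ * ‖u‖ * ‖u‖
        ≤ ((D * ‖y' - y‖) * ‖y' - y‖) * ‖u‖ * ‖u‖ := by
      gcongr
      exact hDle y hy y' hy'
    have c2 : ‖G.form y' - G.form y‖ * ‖u‖ * ‖ν‖ ≤ (A * ‖y' - y‖) * ‖u‖ * ‖ν‖ := by
      gcongr
      exact hAle y hy y' hy'
    have c3 : 2 * ((A * ‖y' - y‖) * ‖u‖ * ‖ν‖)
        ≤ l / 4 * ‖ν‖ ^ 2 + 4 * A ^ 2 / l * ‖y' - y‖ ^ 2 * ‖u‖ ^ 2 := by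
      have hsq := sq_nonneg (l / 4 * ‖ν‖ - (A * ‖y' - y‖) * ‖u‖)
      have : 0 ≤ (4 / l) * (l / 4 * ‖ν‖ - (A * ‖y' - y‖) * ‖u‖) ^ 2 := by positivity
      have e : (4 / l) * (l / 4 * ‖ν‖ - (A * ‖y' - y‖) * ‖u‖) ^ 2
          = l / 4 * ‖ν‖ ^ 2 + 4 * A ^ 2 / l * ‖y' - y‖ ^ 2 * ‖u‖ ^ 2
            - 2 * ((A * ‖y' - y‖) * ‖u‖ * ‖ν‖) := by
        field_simp
        ring
      linarith
    rw [e1]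
    nlinarith
  · intro y hy y' hy' u hu u' hu'
    have haδ' : a ≤ δ' := (min_le_left _ _).trans (min_le_right _ _)
    have hm : ∀ {y u : E}, y ∈ Metric.closedBall y₀ a → u ∈ Metric.closedBall (0 : E) a →
        (y, u) ∈ sK := fun {y u} hy hu => by
      apply hball'
      rw [← closedBall_prod_same]
      exact ⟨Metric.closedBall_subset_closedBall haδ' hy,
        Metric.closedBall_subset_closedBall haδ' hu⟩
    have h := hK.dist_le_mul _ (hm hy hu) _ (hm hy' hu')
    simp only [dist_eq_norm, Prod.norm_def, Prod.mk_sub_mk] at h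
    refine h.trans ?_
    gcongr
    linarith

omit [FiniteDimensional ℝ E] in
/-- Two curves with close accelerations and the same starting point: the difference of the end
points is close to the difference of the initial velocities. -/
lemma norm_endpoint_sub_le {c₁ v₁ a₁ c₂ v₂ a₂ : ℝ → E} {κ : ℝ} (hκ0 : 0 ≤ κ) (hκ : κ ≤ 1 / 8)
    (hc₁ : ∀ s ∈ Set.Icc (0 : ℝ) 1, HasDerivAt c₁ (v₁ s) s)
    (hv₁ : ∀ s ∈ Set.Icc (0 : ℝ) 1, HasDerivAt v₁ (a₁ s) s)
    (hc₂ : ∀ s ∈ Set.Icc (0 : ℝ) 1, HasDerivAt c₂ (v₂ s) s)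
    (hv₂ : ∀ s ∈ Set.Icc (0 : ℝ) 1, HasDerivAt v₂ (a₂ s) s)
    (h0 : c₁ 0 = c₂ 0)
    (ha : ∀ s ∈ Set.Icc (0 : ℝ) 1, ‖a₁ s - a₂ s‖ ≤ κ * max ‖c₁ s - c₂ s‖ ‖v₁ s - v₂ s‖) :
    ‖c₁ 1 - c₂ 1 - (v₁ 0 - v₂ 0)‖ ≤ 1 / 4 * ‖v₁ 0 - v₂ 0‖ := by
  have hcont : ContinuousOn (fun s => ‖v₁ s - v₂ s‖) (Set.Icc 0 1) := fun s hs =>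
    ((hv₁ s hs).sub (hv₂ s hs)).continuousAt.norm.continuousWithinAt
  obtain ⟨m, hm, hmax⟩ := isCompact_Icc.exists_isMaxOn (Set.nonempty_Icc.2 zero_le_one) hcont
  set M := ‖v₁ m - v₂ m‖
  have hM : ∀ s ∈ Set.Icc (0 : ℝ) 1, ‖v₁ s - v₂ s‖ ≤ M := fun s hs => hmax hs
  have hM0 : 0 ≤ M := norm_nonneg _
  have hC : ∀ s ∈ Set.Icc (0 : ℝ) 1, ‖c₁ s - c₂ s‖ ≤ M := by
    intro s hs
    have := (convex_Icc (0 : ℝ) 1).norm_image_sub_le_of_norm_hasDerivWithin_le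
      (f := fun s => c₁ s - c₂ s) (f' := fun s => v₁ s - v₂ s) (C := M)
      (fun x hx => ((hc₁ x hx).sub (hc₂ x hx)).hasDerivWithinAt) hM
      (Set.left_mem_Icc.2 zero_le_one) hs
    simp only [h0, sub_self, sub_zero, Real.norm_eq_abs] at this
    refine this.trans (mul_le_of_le_one_right hM0 ?_)
    rw [abs_of_nonneg hs.1]
    exact hs.2
  have hV : ∀ s ∈ Set.Icc (0 : ℝ) 1, ‖v₁ s - v₂ s - (v₁ 0 - v₂ 0)‖ ≤ κ * M := by
    intro s hs
    have := (convex_Icc (0 : ℝ) 1).norm_image_sub_le_of_norm_hasDerivWithin_le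
      (f := fun s => v₁ s - v₂ s) (f' := fun s => a₁ s - a₂ s) (C := κ * M)
      (fun x hx => ((hv₁ x hx).sub (hv₂ x hx)).hasDerivWithinAt)
      (fun x hx => (ha x hx).trans (mul_le_mul_of_nonneg_left (max_le (hC x hx) (hM x hx)) hκ0))
      (Set.left_mem_Icc.2 zero_le_one) hs
    rw [sub_zero, Real.norm_eq_abs] at this
    refine this.trans (mul_le_of_le_one_right (by positivity) ?_)
    rw [abs_of_nonneg hs.1]
    exact hs.2
  have hE : ‖c₁ 1 - c₂ 1 - (v₁ 0 - v₂ 0)‖ ≤ κ * M := by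
    have hlin (x : ℝ) : HasDerivAt (fun s : ℝ => s • (v₁ 0 - v₂ 0)) (v₁ 0 - v₂ 0) x := by
      simpa using (hasDerivAt_id x).smul_const (v₁ 0 - v₂ 0)
    have := (convex_Icc (0 : ℝ) 1).norm_image_sub_le_of_norm_hasDerivWithin_le
      (f := fun s => c₁ s - c₂ s - s • (v₁ 0 - v₂ 0)) (C := κ * M)
      (f' := fun s => v₁ s - v₂ s - (v₁ 0 - v₂ 0))
      (fun x hx => (((hc₁ x hx).sub (hc₂ x hx)).sub (hlin x)).hasDerivWithinAt) hV
      (Set.left_mem_Icc.2 zero_le_one) (Set.right_mem_Icc.2 zero_le_one)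
    simpa [h0] using this
  have h1 := hV m hm
  have h2 : M ≤ ‖v₁ 0 - v₂ 0‖ + κ * M := by
    have := norm_le_norm_add_norm_sub' (v₁ m - v₂ m) (v₁ 0 - v₂ 0)
    exact this.trans (by gcongr)
  -- With κ ≤ 1/8, `h2` gives M ≤ (8/7)‖v₁ 0 - v₂ 0‖, hence κM ≤ (1/7)‖v₁ 0 - v₂ 0‖.
  nlinarith [norm_nonneg (v₁ 0 - v₂ 0)]

/-- Nearby points are joined by short geodesics. -/
lemma exists_solution_joining {y₀ : E} {a K : ℝ} (ha : 0 < a) (hK : 0 < K)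
    (hdom : Metric.closedBall y₀ a ⊆ G.dom)
    (hlip : ∀ y ∈ Metric.closedBall y₀ a, ∀ y' ∈ Metric.closedBall y₀ a,
      ∀ u ∈ Metric.closedBall (0 : E) a, ∀ u' ∈ Metric.closedBall (0 : E) a,
      ‖G.spray y u - G.spray y' u'‖ ≤ K * max ‖y - y'‖ ‖u - u'‖) {β : ℝ} (hβ : 0 < β) :
    ∃ r > (0 : ℝ), ∀ x ∈ Metric.closedBall y₀ r, ∀ y ∈ Metric.closedBall x r,
      ∃ c v : ℝ → E, G.IsSolutionOn c v (Set.Ioo (-1) 2) ∧ c 0 = x ∧ c 1 = y ∧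
        ∀ s ∈ Set.Ioo (-1 : ℝ) 2, c s ∈ Metric.closedBall y₀ a ∧ ‖v s‖ ≤ β := by
  have hy₀ : y₀ ∈ G.dom := hdom (Metric.mem_closedBall_self ha.le)
  obtain ⟨r, hr, ε, hε, α, hα, -⟩ := G.exists_flow (z₀ := (y₀, 0)) hy₀
    (U := Metric.closedBall (y₀, 0) a) (Metric.closedBall_mem_nhds _ ha)
  -- Slowing time down by τ: `ε / 2` makes the rescaled flow exist on (-1,2), `1 / (8 * K)` gives
  -- the constant needed in `norm_endpoint_sub_le`, `β / a` bounds the velocities by β, and `1`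
  -- allows comparing the rescaled maxima.
  set τ := min (min (ε / 2) 1) (min (1 / (8 * K)) (β / a)) with hτ
  have hτ0 : 0 < τ := by positivity
  have hτε : 2 * τ ≤ ε := by
    have : τ ≤ ε / 2 := (min_le_left _ _).trans (min_le_left _ _)
    linarith
  have hτ1 : τ ≤ 1 := (min_le_left _ _).trans (min_le_right _ _)
  have hτK : τ * K ≤ 1 / 8 := by
    have : τ ≤ 1 / (8 * K) := (min_le_right _ _).trans (min_le_left _ _)
    calc τ * K ≤ 1 / (8 * K) * K := by gcongr
      _ = 1 / 8 := by field_simp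
  have hτβ : τ * a ≤ β := by
    have : τ ≤ β / a := (min_le_right _ _).trans (min_le_right _ _)
    calc τ * a ≤ β / a * a := by gcongr
      _ = β := by field_simp
  -- the rescaled flow
  have sol : ∀ x ∈ Metric.closedBall y₀ r, ∀ u ∈ Metric.closedBall (0 : E) (τ * r),
      ∃ c v : ℝ → E, G.IsSolutionOn c v (Set.Ioo (-1) 2) ∧ c 0 = x ∧ v 0 = u ∧
        ∀ s ∈ Set.Ioo (-1 : ℝ) 2, c s ∈ Metric.closedBall y₀ a ∧ ‖v s‖ ≤ τ * a := by
    intro x hx u hu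
    have hz : (x, τ⁻¹ • u) ∈ Metric.closedBall (y₀, (0 : E)) r := by
      rw [← closedBall_prod_same]
      refine ⟨hx, ?_⟩
      rw [mem_closedBall_zero_iff] at hu ⊢
      rw [norm_smul, norm_inv, Real.norm_of_nonneg hτ0.le, inv_mul_le_iff₀ hτ0]
      exact hu
    obtain ⟨h0, hmem, hsol⟩ := hα _ hz
    have hsub : Set.Ioo (-1 : ℝ) 2 ⊆ (τ * ·) ⁻¹' Set.Ioo (-ε) ε := fun s hs =>
      ⟨by nlinarith [hs.1], by nlinarith [hs.2]⟩
    refine ⟨_, _, (hsol.comp_mul τ).mono hsub, by simp [h0], by simp [h0, smul_smul, hτ0.ne'],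
      fun s hs => ?_⟩
    have := hmem _ (hsub hs)
    rw [← closedBall_prod_same] at this
    refine ⟨this.1, ?_⟩
    rw [norm_smul, Real.norm_of_nonneg hτ0.le]
    gcongr
    simpa using this.2
  choose! c v hsol hc0 hv0 hmem using sol
  have hI : Set.Icc (0 : ℝ) 1 ⊆ Set.Ioo (-1) 2 := fun s hs =>
    ⟨by linarith [hs.1], by linarith [hs.2]⟩
  -- the spray is very Lipschitz at small velocities
  have hlip' : ∀ y ∈ Metric.closedBall y₀ a, ∀ y' ∈ Metric.closedBall y₀ a, ∀ u u' : E,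
      ‖u‖ ≤ τ * a → ‖u'‖ ≤ τ * a →
      ‖G.spray y u - G.spray y' u'‖ ≤ τ * K * max ‖y - y'‖ ‖u - u'‖ := by
    intro y hy y' hy' u u' hu hu'
    have hs : ∀ w : E, ‖w‖ ≤ τ * a → τ⁻¹ • w ∈ Metric.closedBall (0 : E) a := fun w hw => by
      rw [mem_closedBall_zero_iff, norm_smul, norm_inv, Real.norm_of_nonneg hτ0.le,
        inv_mul_le_iff₀ hτ0]
      exact hw
    have e : ∀ z w : E, G.spray z w = τ ^ 2 • G.spray z (τ⁻¹ • w) := fun z w => by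
      rw [← spray_smul, smul_smul, mul_inv_cancel₀ hτ0.ne', one_smul]
    have h := hlip y hy y' hy' _ (hs u hu) _ (hs u' hu')
    rw [e y u, e y' u', ← smul_sub, norm_smul, norm_pow, Real.norm_of_nonneg hτ0.le]
    rw [← smul_sub, norm_smul, norm_inv, Real.norm_of_nonneg hτ0.le] at h
    calc τ ^ 2 * ‖G.spray y (τ⁻¹ • u) - G.spray y' (τ⁻¹ • u')‖
        ≤ τ ^ 2 * (K * max ‖y - y'‖ (τ⁻¹ * ‖u - u'‖)) := by gcongr
      _ = τ * K * (τ * max ‖y - y'‖ (τ⁻¹ * ‖u - u'‖)) := by ring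
      _ ≤ τ * K * max ‖y - y'‖ ‖u - u'‖ := by
          gcongr
          rw [mul_max_of_nonneg _ _ hτ0.le, mul_inv_cancel_left₀ hτ0.ne']
          exact max_le_max (mul_le_of_le_one_left (norm_nonneg _) hτ1) le_rfl
  refine ⟨min r (3 / 4 * (τ * r)), by positivity, fun x hx y hy => ?_⟩
  have hxr : x ∈ Metric.closedBall y₀ r := Metric.closedBall_subset_closedBall (min_le_left _ _) hx
  have hzero : (0 : E) ∈ Metric.closedBall (0 : E) (τ * r) :=
    Metric.mem_closedBall_self (by positivity)
  -- The end point, as a function of the initial velocity, is 1/4-close to the identity. The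
  -- quantitative surjectivity theorem then covers the ball of radius (1 - 1/4)τr about the image of
  -- 0, whence the factor 3/4 above.
  have happ : ApproximatesLinearOn (fun u => c x u 1)
      ((ContinuousLinearEquiv.refl ℝ E : E ≃L[ℝ] E) : E →L[ℝ] E)
      (Metric.closedBall 0 (τ * r)) (1 / 4) := by
    intro u hu w hw
    have h := norm_endpoint_sub_le (κ := τ * K) (by positivity) hτK
      (fun s hs => (hsol x hxr u hu).deriv_pos s (hI hs))
      (fun s hs => (hsol x hxr u hu).deriv_vel s (hI hs))
      (fun s hs => (hsol x hxr w hw).deriv_pos s (hI hs))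
      (fun s hs => (hsol x hxr w hw).deriv_vel s (hI hs))
      ((hc0 x hxr u hu).trans (hc0 x hxr w hw).symm)
      (fun s hs => hlip' _ (hmem x hxr u hu s (hI hs)).1 _ (hmem x hxr w hw s (hI hs)).1 _ _
        (hmem x hxr u hu s (hI hs)).2 (hmem x hxr w hw s (hI hs)).2)
    rw [hv0 x hxr u hu, hv0 x hxr w hw] at h
    simpa using h
  -- The chosen solution with zero velocity is compared with the constant geodesic: equal initial
  -- data force equal end points.
  have h0 : c x 0 1 = x := by
    have hxa : x ∈ Metric.closedBall y₀ a := by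
      have := (hmem x hxr 0 hzero 0 (by norm_num)).1
      rwa [hc0 x hxr 0 hzero] at this
    have hconst := G.isSolutionOn_const (hdom hxa) (Set.Ioo (-1 : ℝ) 2)
    have h := norm_endpoint_sub_le (κ := τ * K) (by positivity) hτK
      (fun s hs => (hsol x hxr 0 hzero).deriv_pos s (hI hs))
      (fun s hs => (hsol x hxr 0 hzero).deriv_vel s (hI hs))
      (fun s hs => hconst.deriv_pos s (hI hs))
      (fun s hs => hconst.deriv_vel s (hI hs))
      (hc0 x hxr 0 hzero)
      (fun s hs => hlip' _ (hmem x hxr 0 hzero s (hI hs)).1 _ hxa _ _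
        (hmem x hxr 0 hzero s (hI hs)).2 (by rw [norm_zero]; positivity))
    rw [hv0 x hxr 0 hzero] at h
    simpa [sub_eq_zero] using h
  let inv : ((ContinuousLinearEquiv.refl ℝ E : E ≃L[ℝ] E) : E →L[ℝ] E).NonlinearRightInverse :=
    { toFun := id, nnnorm := 1, bound' := by simp, right_inv' := by simp }
  have hsurj := happ.surjOn_closedBall_of_nonlinearRightInverse inv (ε := τ * r) (b := 0)
    (by positivity) subset_rfl
  obtain ⟨u, hu, huy⟩ := hsurj (a := y) (by
    rw [h0]
    refine Metric.closedBall_subset_closedBall ((min_le_right _ _).trans (le_of_eq ?_)) hy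
    simp only [inv, NNReal.coe_one]
    push_cast
    ring)
  exact ⟨c x u, v x u, hsol x hxr u hu, hc0 x hxr u hu, huy, fun s hs =>
    ⟨(hmem x hxr u hu s hs).1, (hmem x hxr u hu s hs).2.trans hτβ⟩⟩

end LocalMetric

/-! ### Local minimality of geodesics by convexity of the energy -/

namespace LocalMetric

variable {E : Type*} [NormedAddCommGroup E] [NormedSpace ℝ E] [FiniteDimensional ℝ E]
  {G : LocalMetric E}

/-- The square of an average is at most the average of the square. -/
lemma sq_integral_mul_le {p f : ℝ → ℝ} (hp : ContinuousOn p (Set.Icc 0 1))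
    (hf : ContinuousOn f (Set.Icc 0 1)) (hp0 : ∀ s ∈ Set.Icc (0 : ℝ) 1, 0 ≤ p s)
    (hp1 : ∫ s in (0 : ℝ)..1, p s = 1) :
    (∫ s in (0 : ℝ)..1, p s * f s) ^ 2 ≤ ∫ s in (0 : ℝ)..1, p s * f s ^ 2 := by
  set m := ∫ s in (0 : ℝ)..1, p s * f s with hm
  have hI : ∀ {g : ℝ → ℝ}, ContinuousOn g (Set.Icc 0 1) →
      IntervalIntegrable g MeasureTheory.volume 0 1 := fun h =>
    ContinuousOn.intervalIntegrable (by rwa [Set.uIcc_of_le zero_le_one])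
  have h0 : 0 ≤ ∫ s in (0 : ℝ)..1, p s * (f s - m) ^ 2 :=
    intervalIntegral.integral_nonneg zero_le_one fun s hs =>
      mul_nonneg (hp0 s hs) (sq_nonneg _)
  have e : ∀ s, p s * (f s - m) ^ 2 = (p s * f s ^ 2 - (2 * m) * (p s * f s)) + m ^ 2 * p s :=
    fun s => by ring
  simp only [e] at h0
  rw [intervalIntegral.integral_add (hI (by fun_prop)) (hI (by fun_prop)),
    intervalIntegral.integral_sub (hI (by fun_prop)) (hI (by fun_prop)),
    intervalIntegral.integral_const_mul, intervalIntegral.integral_const_mul, hp1, ← hm] at h0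
  linarith

/-- A short geodesic minimizes the energy among curves with the same end points, with a
quantitative gain. The competitor `b` is compared with the geodesic at the time `θ`. -/
lemma energy_le_of_reparam {B : Set E} {l C β : ℝ} (hB : B ⊆ G.dom) (hl : 0 < l)
    (hβ : C * β ^ 2 ≤ l / 2)
    (hconv : ∀ y ∈ B, ∀ y' ∈ B, ∀ u ν : E,
        G.form y u u + fderiv ℝ G.form y (y' - y) u u + 2 * G.form y u ν + l * ‖ν‖ ^ 2
          - C * ‖y' - y‖ ^ 2 * ‖u‖ ^ 2 ≤ G.form y' (u + ν) (u + ν))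
    {c v : ℝ → E} (hsol : G.IsSolutionOn c v (Set.Icc 0 1))
    (hc : ∀ s ∈ Set.Icc (0 : ℝ) 1, c s ∈ B ∧ ‖v s‖ ≤ β)
    {b b' : ℝ → E} (hb : ContinuousOn b (Set.Icc 0 1)) (hb' : ContinuousOn b' (Set.Icc 0 1))
    (hbd : ∀ s ∈ Set.Ioo (0 : ℝ) 1, HasDerivAt b (b' s) s)
    (hbB : ∀ s ∈ Set.Icc (0 : ℝ) 1, b s ∈ B) (h0 : b 0 = c 0) (h1 : b 1 = c 1)
    {θ θ' : ℝ → ℝ} (hθ : ContinuousOn θ (Set.Icc 0 1)) (hθ' : ContinuousOn θ' (Set.Icc 0 1))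
    (hθd : ∀ s ∈ Set.Ioo (0 : ℝ) 1, HasDerivAt θ (θ' s) s)
    (hθpos : ∀ s ∈ Set.Icc (0 : ℝ) 1, 0 < θ' s) (hθ0 : θ 0 = 0) (hθ1 : θ 1 = 1)
    {s₀ : ℝ} (hs₀ : s₀ ∈ Set.Icc (0 : ℝ) 1) :
    G.form (c 0) (v 0) (v 0) + l / 2 * ‖b s₀ - c (θ s₀)‖ ^ 2
      ≤ ∫ s in (0 : ℝ)..1, G.form (b s) (b' s) (b' s) / θ' s := by
  have hIoo : Set.Ioo (0 : ℝ) 1 ⊆ Set.Icc 0 1 := Set.Ioo_subset_Icc_self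
  have hI : ∀ {g : ℝ → ℝ}, ContinuousOn g (Set.Icc 0 1) →
      IntervalIntegrable g MeasureTheory.volume 0 1 := fun h =>
    ContinuousOn.intervalIntegrable (by rwa [Set.uIcc_of_le zero_le_one])
  have hmono : MonotoneOn θ (Set.Icc 0 1) :=
    monotoneOn_of_deriv_nonneg (convex_Icc 0 1) hθ
      (by rw [interior_Icc]; exact fun s hs => (hθd s hs).differentiableAt.differentiableWithinAt)
      (by
        rw [interior_Icc]
        intro s hs
        rw [(hθd s hs).deriv]
        exact (hθpos s (hIoo hs)).le)
  have hθI : Set.MapsTo θ (Set.Icc 0 1) (Set.Icc 0 1) := fun s hs =>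
    ⟨hθ0 ▸ hmono (Set.left_mem_Icc.2 zero_le_one) hs hs.1,
      hθ1 ▸ hmono hs (Set.right_mem_Icc.2 zero_le_one) hs.2⟩
  have hcc : ContinuousOn (fun s => c (θ s)) (Set.Icc 0 1) :=
    (show ContinuousOn c (Set.Icc 0 1) from fun s hs =>
      (hsol.deriv_pos s hs).continuousAt.continuousWithinAt).comp hθ hθI
  have hvc : ContinuousOn (fun s => v (θ s)) (Set.Icc 0 1) :=
    (show ContinuousOn v (Set.Icc 0 1) from fun s hs =>
      (hsol.deriv_vel s hs).continuousAt.continuousWithinAt).comp hθ hθI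
  have hform {f : ℝ → E} (hf : ContinuousOn f (Set.Icc 0 1))
      (hfB : ∀ s ∈ Set.Icc (0 : ℝ) 1, f s ∈ B) :
      ContinuousOn (fun s => G.form (f s)) (Set.Icc 0 1) :=
    G.contDiffOn_form.continuousOn.comp hf fun s hs => hB (hfB s hs)
  have hθB : ∀ s ∈ Set.Icc (0 : ℝ) 1, c (θ s) ∈ B := fun s hs => (hc _ (hθI hs)).1
  set η : ℝ → E := fun s => b s - c (θ s) with hη
  -- Chosen so that b'/θ' = v∘θ + ν and η' = θ'ν: it is the velocity defect of the competitor
  -- measured in the time of the geodesic.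
  set ν : ℝ → E := fun s => (θ' s)⁻¹ • b' s - v (θ s) with hν
  have hηc : ContinuousOn η (Set.Icc 0 1) := hb.sub hcc
  have hνc : ContinuousOn ν (Set.Icc 0 1) :=
    ((hθ'.inv₀ fun s hs => (hθpos s hs).ne').smul hb').sub hvc
  have hηd : ∀ s ∈ Set.Ioo (0 : ℝ) 1, HasDerivAt η (θ' s • ν s) s := by
    intro s hs
    have h := (hbd s hs).sub ((hsol.deriv_pos _ (hθI (hIoo hs))).scomp s (hθd s hs))
    refine h.congr_deriv ?_
    simp only [hν, smul_sub, smul_smul, mul_inv_cancel₀ (hθpos s (hIoo hs)).ne', one_smul]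
  have hθint : ∫ s in (0 : ℝ)..1, θ' s = 1 := by
    rw [intervalIntegral.integral_eq_sub_of_hasDerivAt_of_le zero_le_one hθ hθd (hI hθ'), hθ0, hθ1,
      sub_zero]
  set P := ∫ s in (0 : ℝ)..1, θ' s * ‖ν s‖ ^ 2 with hP
  -- A Poincaré inequality: η vanishes at 0, so ‖η‖ is at most the mean of ‖ν‖ for the probability
  -- density θ', and Jensen bounds its square by P.
  have hηP : ∀ s ∈ Set.Icc (0 : ℝ) 1, ‖η s‖ ^ 2 ≤ P := by
    intro s hs
    refine le_trans ?_ (sq_integral_mul_le hθ' hνc.norm (fun s hs => (hθpos s hs).le) hθint)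
    have hη0 : η 0 = 0 := by simp [hη, hθ0, h0]
    have hsub : Set.Icc 0 s ⊆ Set.Icc (0 : ℝ) 1 := Set.Icc_subset_Icc le_rfl hs.2
    have hcn : ContinuousOn (fun s => θ' s • ν s) (Set.Icc 0 1) := hθ'.smul hνc
    have hint : IntervalIntegrable (fun s => θ' s • ν s) MeasureTheory.volume 0 s :=
      ContinuousOn.intervalIntegrable (by rw [Set.uIcc_of_le hs.1]; exact hcn.mono hsub)
    have hFTC := intervalIntegral.integral_eq_sub_of_hasDerivAt_of_le hs.1 (hηc.mono hsub)
      (fun r hr => hηd r ⟨hr.1, hr.2.trans_le hs.2⟩) hint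
    rw [hη0, sub_zero] at hFTC
    rw [← hFTC]
    gcongr
    refine (intervalIntegral.norm_integral_le_integral_norm hs.1).trans ?_
    have hle : ∫ r in (0 : ℝ)..s, ‖θ' r • ν r‖ ≤ ∫ r in (0 : ℝ)..1, ‖θ' r • ν r‖ :=
      intervalIntegral.integral_mono_interval le_rfl hs.1 hs.2
        (.of_forall fun r => norm_nonneg _) (hI hcn.norm)
    refine hle.trans (le_of_eq (intervalIntegral.integral_congr fun r hr => ?_))
    rw [Set.uIcc_of_le zero_le_one] at hr
    simp only [norm_smul, Real.norm_of_nonneg (hθpos r hr).le]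
  -- the first variation is a total derivative
  set φ : ℝ → ℝ := fun s => G.form (c (θ s)) (v (θ s)) (η s) with hφ
  set φ' : ℝ → ℝ := fun s => θ' s * ((1 / 2 : ℝ) * fderiv ℝ G.form (c (θ s)) (η s) (v (θ s)) (v (θ s))
    + G.form (c (θ s)) (v (θ s)) (ν s)) with hφ'
  have hφc : ContinuousOn φ (Set.Icc 0 1) := ((hform hcc hθB).clm_apply hvc).clm_apply hηc
  have hφ'c : ContinuousOn φ' (Set.Icc 0 1) := by
    have h2 : ContinuousOn (fun s => fderiv ℝ G.form (c (θ s))) (Set.Icc 0 1) :=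
      contDiffOn_fderiv_form.continuousOn.comp hcc fun s hs => hB (hθB s hs)
    exact hθ'.mul ((continuousOn_const.mul
      (((h2.clm_apply hηc).clm_apply hvc).clm_apply hvc)).add
        (((hform hcc hθB).clm_apply hvc).clm_apply hνc))
  have hφd : ∀ s ∈ Set.Ioo (0 : ℝ) 1, HasDerivAt φ (φ' s) s := by
    intro s hs
    have hθs := hθI (hIoo hs)
    have hd := hB (hθB s (hIoo hs))
    have h := hasDerivAt_form_apply (G := G) (c := fun r => c (θ r)) (v := fun r => v (θ r)) hd
      ((hsol.deriv_pos _ hθs).scomp s (hθd s hs))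
      ((hsol.deriv_vel _ hθs).scomp s (hθd s hs)) (hηd s hs)
    refine h.congr_deriv ?_
    simp only [hφ', map_smul, smul_apply, smul_eq_mul,
      form_spray hd, lowerChristoffel_apply]
    ring
  have hφint : ∫ s in (0 : ℝ)..1, φ' s = 0 := by
    rw [intervalIntegral.integral_eq_sub_of_hasDerivAt_of_le zero_le_one hφc hφd (hI hφ'c)]
    simp [hφ, hη, hθ0, hθ1, h0, h1]
  have henergy : ∀ s ∈ Set.Icc (0 : ℝ) 1, G.form (c s) (v s) (v s) = G.form (c 0) (v 0) (v 0) := by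
    intro s hs
    refine constant_of_has_deriv_right_zero (a := 0) (b := 1)
      (f := fun r => G.form (c r) (v r) (v r))
      (fun r hr => (hsol.hasDerivAt_energy hr).continuousAt.continuousWithinAt)
      (fun r hr => (hsol.hasDerivAt_energy ⟨hr.1, hr.2.le⟩).hasDerivWithinAt) s hs
  set Q := G.form (c 0) (v 0) (v 0) with hQ
  -- The convexity inequality at `c (θ s)` and `b s`, multiplied by θ'. Its first-order terms add up
  -- to 2φ', which integrates to zero. The error is at most (l/2)P, so half of the gain lP remains.
  have hpt : ∀ s ∈ Set.Icc (0 : ℝ) 1,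
      ((Q - l / 2 * P) * θ' s + 2 * φ' s) + l * (θ' s * ‖ν s‖ ^ 2)
        ≤ G.form (b s) (b' s) (b' s) / θ' s := by
    intro s hs
    have hpos := hθpos s hs
    have h := hconv _ (hθB s hs) _ (hbB s hs) (v (θ s)) (ν s)
    rw [henergy _ (hθI hs)] at h
    have hv : v (θ s) + ν s = (θ' s)⁻¹ • b' s := by simp [hν]
    rw [hv] at h
    simp only [map_smul, smul_apply, smul_eq_mul] at h
    have hCη : C * ‖b s - c (θ s)‖ ^ 2 * ‖v (θ s)‖ ^ 2 ≤ l / 2 * P := by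
      have hvβ : ‖v (θ s)‖ ^ 2 ≤ β ^ 2 := by gcongr; exact (hc _ (hθI hs)).2
      rcases le_total C 0 with hC | hC
      · have : C * ‖b s - c (θ s)‖ ^ 2 * ‖v (θ s)‖ ^ 2 ≤ 0 :=
          mul_nonpos_of_nonpos_of_nonneg
            (mul_nonpos_of_nonpos_of_nonneg hC (sq_nonneg _)) (sq_nonneg _)
        have hP0 : 0 ≤ P := (sq_nonneg _).trans (hηP s hs)
        exact this.trans (by positivity)
      · calc C * ‖b s - c (θ s)‖ ^ 2 * ‖v (θ s)‖ ^ 2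
            ≤ C * ‖b s - c (θ s)‖ ^ 2 * β ^ 2 := by gcongr
          _ = (C * β ^ 2) * ‖η s‖ ^ 2 := by simp only [hη]; ring
          _ ≤ l / 2 * P := mul_le_mul hβ (hηP s hs) (sq_nonneg _) (by positivity)
    have e : G.form (b s) (b' s) (b' s) / θ' s
        = θ' s * ((θ' s)⁻¹ * ((θ' s)⁻¹ * G.form (b s) (b' s) (b' s))) := by
      field_simp
    rw [e]
    simp only [hφ']
    nlinarith [mul_le_mul_of_nonneg_left h hpos.le, mul_le_mul_of_nonneg_left hCη hpos.le]
  have hfb : ContinuousOn (fun s => G.form (b s) (b' s) (b' s) / θ' s) (Set.Icc 0 1) :=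
    (((hform hb hbB).clm_apply hb').clm_apply hb').div hθ' fun s hs => (hθpos s hs).ne'
  have hlast := intervalIntegral.integral_mono_on (μ := MeasureTheory.volume) zero_le_one
    (hI (by fun_prop)) (hI hfb) hpt
  rw [intervalIntegral.integral_add (hI (by fun_prop)) (hI (by fun_prop)),
    intervalIntegral.integral_add (hI (by fun_prop)) (hI (by fun_prop)),
    intervalIntegral.integral_const_mul, intervalIntegral.integral_const_mul,
    intervalIntegral.integral_const_mul, hφint, hθint, ← hP] at hlast
  have := hηP s₀ hs₀
  simp only [hη] at this
  nlinarith

/-- Short geodesics minimize length, and curves of almost the same length stay close. -/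
lemma energy_le_sq_length {B : Set E} {l C β : ℝ} (hB : B ⊆ G.dom) (hl : 0 < l)
    (hβ : C * β ^ 2 ≤ l / 2)
    (hconv : ∀ y ∈ B, ∀ y' ∈ B, ∀ u ν : E,
        G.form y u u + fderiv ℝ G.form y (y' - y) u u + 2 * G.form y u ν + l * ‖ν‖ ^ 2
          - C * ‖y' - y‖ ^ 2 * ‖u‖ ^ 2 ≤ G.form y' (u + ν) (u + ν))
    {c v : ℝ → E} (hsol : G.IsSolutionOn c v (Set.Icc 0 1))
    (hc : ∀ s ∈ Set.Icc (0 : ℝ) 1, c s ∈ B ∧ ‖v s‖ ≤ β)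
    {b b' : ℝ → E} (hb : ContinuousOn b (Set.Icc 0 1)) (hb' : ContinuousOn b' (Set.Icc 0 1))
    (hbd : ∀ s ∈ Set.Ioo (0 : ℝ) 1, HasDerivAt b (b' s) s)
    (hbB : ∀ s ∈ Set.Icc (0 : ℝ) 1, b s ∈ B) (h0 : b 0 = c 0) (h1 : b 1 = c 1)
    {s₀ : ℝ} (hs₀ : s₀ ∈ Set.Icc (0 : ℝ) 1) :
    G.form (c 0) (v 0) (v 0) + l / 2 * Metric.infDist (b s₀) (c '' Set.Icc 0 1) ^ 2
      ≤ (∫ s in (0 : ℝ)..1, √(G.form (b s) (b' s) (b' s))) ^ 2 := by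
  have hI : ∀ {g : ℝ → ℝ}, ContinuousOn g (Set.Icc 0 1) →
      IntervalIntegrable g MeasureTheory.volume 0 1 := fun h =>
    ContinuousOn.intervalIntegrable (by rwa [Set.uIcc_of_le zero_le_one])
  have hform : ContinuousOn (fun s => G.form (b s)) (Set.Icc 0 1) :=
    G.contDiffOn_form.continuousOn.comp hb fun s hs => hB (hbB s hs)
  have hq2 : ContinuousOn (fun s => G.form (b s) (b' s) (b' s)) (Set.Icc 0 1) :=
    (hform.clm_apply hb').clm_apply hb'
  set q : ℝ → ℝ := fun s => √(G.form (b s) (b' s) (b' s)) with hq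
  have hqc : ContinuousOn q (Set.Icc 0 1) := hq2.sqrt
  have hq0 : ∀ s, 0 ≤ q s := fun s => Real.sqrt_nonneg _
  set L := ∫ s in (0 : ℝ)..1, q s with hL
  have hL0 : 0 ≤ L := intervalIntegral.integral_nonneg zero_le_one fun s _ => hq0 s
  have key : ∀ ε > (0 : ℝ), G.form (c 0) (v 0) (v 0)
      + l / 2 * Metric.infDist (b s₀) (c '' Set.Icc 0 1) ^ 2 ≤ (L + ε) * L := by
    intro ε hε
    -- Almost arc length, normalized to total mass 1. The shift by ε keeps θ' positive where `b` is
    -- stationary, and q²/θ' ≤ (L + ε)q makes the reparametrized energy at most (L + ε)L.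
    set θ' : ℝ → ℝ := fun s => (L + ε)⁻¹ * (q s + ε) with hθ'
    have hLε : 0 < L + ε := by linarith
    have hθ'pos : ∀ s, 0 < θ' s := fun s => by
      have := hq0 s
      positivity
    have hθ'c : ContinuousOn θ' (Set.Icc 0 1) := by fun_prop
    set θ : ℝ → ℝ := fun s => ∫ r in (0 : ℝ)..s, θ' r with hθ
    have hθ1 : θ 1 = 1 := by
      simp only [hθ, hθ']
      rw [intervalIntegral.integral_const_mul, intervalIntegral.integral_add (hI hqc) (by simp),
        intervalIntegral.integral_const, ← hL]
      simp only [sub_zero, one_smul]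
      field_simp
    have hθc : ContinuousOn θ (Set.Icc 0 1) := by
      have := intervalIntegral.continuousOn_primitive_interval (μ := MeasureTheory.volume)
        (f := θ') (a := 0) (b := 1) (by
          rw [Set.uIcc_of_le zero_le_one]
          exact hθ'c.integrableOn_Icc)
      rwa [Set.uIcc_of_le zero_le_one] at this
    have hθd : ∀ s ∈ Set.Ioo (0 : ℝ) 1, HasDerivAt θ (θ' s) s := by
      intro s hs
      have hn : Set.Icc (0 : ℝ) 1 ∈ 𝓝 s := Icc_mem_nhds hs.1 hs.2
      refine intervalIntegral.integral_hasDerivAt_right ?_ ?_ (hθ'c.continuousAt hn)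
      · exact ContinuousOn.intervalIntegrable (by
          rw [Set.uIcc_of_le hs.1.le]
          exact hθ'c.mono (Set.Icc_subset_Icc le_rfl hs.2.le))
      · exact hθ'c.stronglyMeasurableAtFilter_nhdsWithin measurableSet_Icc s |>.filter_mono
          (by rw [nhdsWithin_eq_nhds.2 hn])
    have hθs₀ : θ s₀ ∈ Set.Icc (0 : ℝ) 1 := by
      refine ⟨intervalIntegral.integral_nonneg hs₀.1 fun r _ => (hθ'pos r).le, ?_⟩
      rw [← hθ1]
      exact intervalIntegral.integral_mono_interval le_rfl hs₀.1 hs₀.2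
        (.of_forall fun r => (hθ'pos r).le) (hI hθ'c)
    have h := energy_le_of_reparam hB hl hβ hconv hsol hc hb hb' hbd hbB h0 h1 hθc hθ'c hθd
      (fun s _ => hθ'pos s) (by simp [hθ]) hθ1 hs₀
    -- The time θ s₀ depends on ε; the distance to the whole geodesic does not, so it survives the
    -- limit ε → 0.
    have hdist : Metric.infDist (b s₀) (c '' Set.Icc 0 1) ≤ ‖b s₀ - c (θ s₀)‖ := by
      rw [← dist_eq_norm]
      exact Metric.infDist_le_dist_of_mem (Set.mem_image_of_mem c hθs₀)
    have hdist' : Metric.infDist (b s₀) (c '' Set.Icc 0 1) ^ 2 ≤ ‖b s₀ - c (θ s₀)‖ ^ 2 := by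
      gcongr
      exact Metric.infDist_nonneg
    have hupper : ∫ s in (0 : ℝ)..1, G.form (b s) (b' s) (b' s) / θ' s ≤ (L + ε) * L := by
      rw [hL, ← intervalIntegral.integral_const_mul]
      refine intervalIntegral.integral_mono_on zero_le_one
        (hI (hq2.div hθ'c fun s _ => (hθ'pos s).ne')) (hI (by fun_prop)) fun s hs => ?_
      have hs2 : G.form (b s) (b' s) (b' s) = q s ^ 2 :=
        (Real.sq_sqrt (G.nonneg (hB (hbB s hs)) _)).symm
      rw [hs2, ← hL, div_le_iff₀ (hθ'pos s)]
      have e : (L + ε) * q s * θ' s = q s * (q s + ε) := by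
        simp only [hθ']
        field_simp
      rw [e]
      nlinarith [hq0 s]
    nlinarith
  have hlim : Filter.Tendsto (fun ε : ℝ => (L + ε) * L) (𝓝[>] 0) (𝓝 (L ^ 2)) := by
    have : ContinuousAt (fun ε : ℝ => (L + ε) * L) 0 := by fun_prop
    have h2 := this.tendsto.mono_left (nhdsWithin_le_nhds (s := Set.Ioi 0))
    simpa [pow_two] using h2
  exact ge_of_tendsto hlim (by filter_upwards [self_mem_nhdsWithin] with ε hε using key ε hε)

/-- Every point has a neighbourhood in which nearby points are joined by a minimizing geodesic,
with control on the curves of almost minimal length. -/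
lemma exists_minimizing_solution {y₀ : E} (hy₀ : y₀ ∈ G.dom) :
    ∃ a > (0 : ℝ), ∃ l > (0 : ℝ), ∃ r > (0 : ℝ), Metric.closedBall y₀ a ⊆ G.dom ∧
      ∀ x ∈ Metric.closedBall y₀ r, ∀ y ∈ Metric.closedBall x r,
      ∃ c v : ℝ → E, G.IsSolutionOn c v (Set.Ioo (-1) 2) ∧ c 0 = x ∧ c 1 = y ∧
        ∀ b b' : ℝ → E, ContinuousOn b (Set.Icc 0 1) → ContinuousOn b' (Set.Icc 0 1) →
          (∀ s ∈ Set.Ioo (0 : ℝ) 1, HasDerivAt b (b' s) s) →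
          (∀ s ∈ Set.Icc (0 : ℝ) 1, b s ∈ Metric.closedBall y₀ a) → b 0 = x → b 1 = y →
          ∀ s₀ ∈ Set.Icc (0 : ℝ) 1,
            G.form x (v 0) (v 0) + l / 2 * Metric.infDist (b s₀) (c '' Set.Icc 0 1) ^ 2
              ≤ (∫ s in (0 : ℝ)..1, √(G.form (b s) (b' s) (b' s))) ^ 2 := by
  obtain ⟨a, ha, l, hl, C, K, hK, hdom, hconv, hlip⟩ := exists_bounds hy₀
  -- Since β ≤ 1, Cβ² ≤ |C|β ≤ l/2: geodesics of speed at most β are slow enough for the convexity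
  -- gain to beat the error.
  set β := min 1 (l / (2 * (|C| + 1))) with hβ
  have hC : 0 ≤ |C| := abs_nonneg C
  have hβ0 : 0 < β := by positivity
  have hβ2 : C * β ^ 2 ≤ l / 2 := by
    have h1 : β ≤ 1 := min_le_left _ _
    have h2 : (|C| + 1) * β ≤ l / 2 := by
      calc (|C| + 1) * β ≤ (|C| + 1) * (l / (2 * (|C| + 1))) := by
            gcongr
            exact min_le_right _ _
        _ = l / 2 := by field_simp
    nlinarith [le_abs_self C, sq_nonneg β]
  obtain ⟨r, hr, hjoin⟩ := exists_solution_joining ha hK hdom hlip hβ0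
  refine ⟨a, ha, l, hl, r, hr, hdom, fun x hx y hy => ?_⟩
  obtain ⟨c, v, hsol, h0, h1, hc⟩ := hjoin x hx y hy
  have hI : Set.Icc (0 : ℝ) 1 ⊆ Set.Ioo (-1) 2 := fun s hs =>
    ⟨by linarith [hs.1], by linarith [hs.2]⟩
  refine ⟨c, v, hsol, h0, h1, fun b b' hb hb' hbd hbB hb0 hb1 s₀ hs₀ => ?_⟩
  rw [← h0]
  exact energy_le_sq_length hdom hl hβ2 hconv (hsol.mono hI) (fun s hs => hc s (hI hs)) hb hb' hbd
    hbB (hb0.trans h0.symm) (hb1.trans h1.symm) hs₀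

end LocalMetric

/-! ### Chart coordinates on the tangent bundle and velocities of curves -/

section Coordinates

variable {E : Type*} [NormedAddCommGroup E] [NormedSpace ℝ E]
  {S : Type*} [TopologicalSpace S] [ChartedSpace E S]

/-- The coordinates on the tangent bundle induced by the chart around `x₀`. -/
def toCoord (x₀ : S) (z : TangentBundle 𝓘(ℝ, E) S) : E × E :=
  (extChartAt 𝓘(ℝ, E) x₀ z.proj, mfderiv 𝓘(ℝ, E) 𝓘(ℝ, E) (extChartAt 𝓘(ℝ, E) x₀) z.proj z.2)

/-- The inverse of `toCoord`. -/
def ofCoord (x₀ : S) (w : E × E) : TangentBundle 𝓘(ℝ, E) S :=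
  ⟨(extChartAt 𝓘(ℝ, E) x₀).symm w.1,
    mfderiv 𝓘(ℝ, E) 𝓘(ℝ, E) (extChartAt 𝓘(ℝ, E) x₀).symm w.1 w.2⟩

variable (E) in
/-- The velocity of a curve, as a point of the tangent bundle. -/
def velocity (γ : ℝ → S) (s : ℝ) : TangentBundle 𝓘(ℝ, E) S :=
  ⟨γ s, mfderiv 𝓘(ℝ, ℝ) 𝓘(ℝ, E) γ s (1 : ℝ)⟩

variable [IsManifold 𝓘(ℝ, E) ∞ S]

lemma mdifferentiableAt_chart {x₀ x : S} (hx : x ∈ (extChartAt 𝓘(ℝ, E) x₀).source) :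
    MDifferentiableAt 𝓘(ℝ, E) 𝓘(ℝ, E) (extChartAt 𝓘(ℝ, E) x₀) x :=
  mdifferentiableAt_extChartAt (by rwa [extChartAt_source] at hx)

lemma contMDiffAt_chart_symm {x₀ : S} {y : E} (hy : y ∈ (extChartAt 𝓘(ℝ, E) x₀).target) :
    ContMDiffAt 𝓘(ℝ, E) 𝓘(ℝ, E) ∞ (extChartAt 𝓘(ℝ, E) x₀).symm y :=
  (contMDiffOn_extChartAt_symm x₀).contMDiffAt ((isOpen_extChartAt_target x₀).mem_nhds hy)

lemma mdifferentiableAt_chart_symm {x₀ : S} {y : E} (hy : y ∈ (extChartAt 𝓘(ℝ, E) x₀).target) :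
    MDifferentiableAt 𝓘(ℝ, E) 𝓘(ℝ, E) (extChartAt 𝓘(ℝ, E) x₀).symm y :=
  (contMDiffAt_chart_symm hy).mdifferentiableAt (by simp)

lemma mfderiv_chart_symm_apply {x₀ : S} {y : E} (hy : y ∈ (extChartAt 𝓘(ℝ, E) x₀).target) (u : E) :
    mfderiv 𝓘(ℝ, E) 𝓘(ℝ, E) (extChartAt 𝓘(ℝ, E) x₀) ((extChartAt 𝓘(ℝ, E) x₀).symm y)
      (mfderiv 𝓘(ℝ, E) 𝓘(ℝ, E) (extChartAt 𝓘(ℝ, E) x₀).symm y u) = u := by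
  have h := mfderiv_extChartAt_comp_mfderivWithin_extChartAt_symm (I := 𝓘(ℝ, E)) hy
  rw [ModelWithCorners.range_eq_univ, mfderivWithin_univ] at h
  exact congr($h u)

lemma mfderiv_symm_chart_apply {x₀ x : S} (hx : x ∈ (extChartAt 𝓘(ℝ, E) x₀).source)
    (u : TangentSpace 𝓘(ℝ, E) x) :
    mfderiv 𝓘(ℝ, E) 𝓘(ℝ, E) (extChartAt 𝓘(ℝ, E) x₀).symm (extChartAt 𝓘(ℝ, E) x₀ x)
      (mfderiv 𝓘(ℝ, E) 𝓘(ℝ, E) (extChartAt 𝓘(ℝ, E) x₀) x u) = u := by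
  have h := mfderivWithin_extChartAt_symm_comp_mfderiv_extChartAt' (I := 𝓘(ℝ, E)) hx
  rw [ModelWithCorners.range_eq_univ, mfderivWithin_univ] at h
  exact congr($h u)

lemma ofCoord_toCoord {x₀ : S} {z : TangentBundle 𝓘(ℝ, E) S}
    (hz : z.proj ∈ (extChartAt 𝓘(ℝ, E) x₀).source) : ofCoord x₀ (toCoord x₀ z) = z := by
  obtain ⟨x, v⟩ := z
  have h1 : (extChartAt 𝓘(ℝ, E) x₀).symm (extChartAt 𝓘(ℝ, E) x₀ x) = x :=
    (extChartAt 𝓘(ℝ, E) x₀).left_inv hz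
  have h2 := mfderiv_symm_chart_apply hz v
  refine TotalSpace.ext h1 ?_
  exact heq_of_eq h2

lemma continuousOn_toCoord (x₀ : S) :
    ContinuousOn (toCoord x₀) (TotalSpace.proj ⁻¹' (extChartAt 𝓘(ℝ, E) x₀).source :
      Set (TangentBundle 𝓘(ℝ, E) S)) := by
  have hopen := isOpen_extChartAt_source (I := 𝓘(ℝ, E)) x₀
  have hsm : ContMDiffOn 𝓘(ℝ, E) 𝓘(ℝ, E) ∞ (extChartAt 𝓘(ℝ, E) x₀)
      (extChartAt 𝓘(ℝ, E) x₀).source := by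
    rw [extChartAt_source]
    exact contMDiffOn_extChartAt
  have h := hsm.continuousOn_tangentMapWithin (by simp) hopen.uniqueMDiffOn
  have h2 := ((tangentBundleModelSpaceHomeomorph 𝓘(ℝ, E)).continuous).comp_continuousOn h
  refine h2.congr fun z hz => ?_
  have e : mfderivWithin 𝓘(ℝ, E) 𝓘(ℝ, E) (extChartAt 𝓘(ℝ, E) x₀)
      (extChartAt 𝓘(ℝ, E) x₀).source z.proj = mfderiv 𝓘(ℝ, E) 𝓘(ℝ, E) (extChartAt 𝓘(ℝ, E) x₀) z.proj :=
    mfderivWithin_of_isOpen hopen hz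
  simp only [toCoord, Function.comp_apply, tangentMapWithin, e]
  rfl

omit [IsManifold 𝓘(ℝ, E) ∞ S] in
-- Lets `ofCoord` inherit continuity and smoothness from the tangent map of the inverse chart.
lemma ofCoord_eq_tangentMapWithin {x₀ : S} {w : E × E}
    (hw : w.1 ∈ (extChartAt 𝓘(ℝ, E) x₀).target) :
    ofCoord x₀ w = tangentMapWithin 𝓘(ℝ, E) 𝓘(ℝ, E) (extChartAt 𝓘(ℝ, E) x₀).symm
      (extChartAt 𝓘(ℝ, E) x₀).target ⟨w.1, w.2⟩ := by
  have e : mfderivWithin 𝓘(ℝ, E) 𝓘(ℝ, E) (extChartAt 𝓘(ℝ, E) x₀).symm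
      (extChartAt 𝓘(ℝ, E) x₀).target w.1
        = mfderiv 𝓘(ℝ, E) 𝓘(ℝ, E) (extChartAt 𝓘(ℝ, E) x₀).symm w.1 :=
    mfderivWithin_of_isOpen (isOpen_extChartAt_target (I := 𝓘(ℝ, E)) x₀) hw
  simp only [ofCoord, tangentMapWithin, e]

lemma continuousOn_ofCoord (x₀ : S) :
    ContinuousOn (ofCoord x₀ : E × E → TangentBundle 𝓘(ℝ, E) S)
      ((extChartAt 𝓘(ℝ, E) x₀).target ×ˢ Set.univ) := by
  have hopen := isOpen_extChartAt_target (I := 𝓘(ℝ, E)) x₀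
  have h := (contMDiffOn_extChartAt_symm (I := 𝓘(ℝ, E)) (n := ∞) x₀).continuousOn_tangentMapWithin
    (by simp) hopen.uniqueMDiffOn
  refine (h.comp ((tangentBundleModelSpaceHomeomorph 𝓘(ℝ, E)).symm.continuous).continuousOn
    (fun w hw => hw.1)).congr fun w hw => ofCoord_eq_tangentMapWithin hw.1

lemma contMDiffOn_ofCoord_const (x₀ : S) (u : E) :
    ContMDiffOn 𝓘(ℝ, E) 𝓘(ℝ, E).tangent ∞
      (fun y => (ofCoord x₀ (y, u) : TangentBundle 𝓘(ℝ, E) S))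
      (extChartAt 𝓘(ℝ, E) x₀).target := by
  have hopen := isOpen_extChartAt_target (I := 𝓘(ℝ, E)) x₀
  have h := (contMDiffOn_extChartAt_symm (I := 𝓘(ℝ, E)) (n := ∞) x₀).contMDiffOn_tangentMapWithin
    (m := ∞) (by simp) hopen.uniqueMDiffOn
  have hu : ContMDiffOn 𝓘(ℝ, E) 𝓘(ℝ, E).tangent ∞
      (fun y : E => (⟨y, u⟩ : TangentBundle 𝓘(ℝ, E) E)) (extChartAt 𝓘(ℝ, E) x₀).target :=
    contMDiffOn_vectorSpace_iff_contDiffOn.2 contDiffOn_const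
  exact (h.comp hu fun y hy => hy).congr fun y hy => ofCoord_eq_tangentMapWithin hy

lemma toCoord_velocity {x₀ : S} {γ : ℝ → S} {s : ℝ}
    (hγ : MDifferentiableAt 𝓘(ℝ, ℝ) 𝓘(ℝ, E) γ s)
    (hs : γ s ∈ (extChartAt 𝓘(ℝ, E) x₀).source) :
    toCoord x₀ (velocity E γ s) = (extChartAt 𝓘(ℝ, E) x₀ (γ s),
      deriv (fun r => extChartAt 𝓘(ℝ, E) x₀ (γ r)) s) := by
  refine Prod.ext rfl ?_
  have h := mfderiv_comp s (mdifferentiableAt_chart hs) hγ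
  rw [mfderiv_eq_fderiv] at h
  have h2 := congr($h (1 : ℝ))
  rw [← fderiv_apply_one_eq_deriv]
  exact h2.symm

lemma velocity_chart_symm {x₀ : S} {c : ℝ → E} {v : E} {s : ℝ} (hc : HasDerivAt c v s)
    (hs : c s ∈ (extChartAt 𝓘(ℝ, E) x₀).target) :
    velocity E (fun r => (extChartAt 𝓘(ℝ, E) x₀).symm (c r)) s = ofCoord x₀ (c s, v) := by
  have h := mfderiv_comp s (mdifferentiableAt_chart_symm hs)
    hc.differentiableAt.mdifferentiableAt
  rw [mfderiv_eq_fderiv] at h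
  have h2 := congr($h (1 : ℝ))
  have e : fderiv ℝ c s 1 = v := by rw [fderiv_apply_one_eq_deriv, hc.deriv]
  refine TotalSpace.ext rfl (heq_of_eq (h2.trans ?_))
  change mfderiv 𝓘(ℝ, E) 𝓘(ℝ, E) (extChartAt 𝓘(ℝ, E) x₀).symm (c s) (fderiv ℝ c s 1) = _
  rw [e]
  rfl

end Coordinates

/-! ### The Riemannian metric read in a chart -/

section Metric

variable {E : Type*} [NormedAddCommGroup E] [NormedSpace ℝ E] [FiniteDimensional ℝ E]
  {S : Type*} [TopologicalSpace S] [ChartedSpace E S]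
  [RiemannianBundle (fun x : S => TangentSpace 𝓘(ℝ, E) x)]

/-- The metric in a chart, as a family of continuous bilinear forms. -/
def gram (x₀ : S) (y : E) : E →L[ℝ] E →L[ℝ] ℝ :=
  let D := mfderiv 𝓘(ℝ, E) 𝓘(ℝ, E) (extChartAt 𝓘(ℝ, E) x₀).symm y
  LinearMap.toContinuousLinearMap
    ((LinearMap.toContinuousLinearMap : (E →ₗ[ℝ] ℝ) ≃ₗ[ℝ] (E →L[ℝ] ℝ)).toLinearMap ∘ₗ
      LinearMap.mk₂ ℝ (chartMetric x₀ y)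
        (fun u u' v => (congrArg (inner ℝ · (D v)) (D.map_add u u')).trans (inner_add_left _ _ _))
        (fun a u v => (congrArg (inner ℝ · (D v)) (D.map_smul a u)).trans
          (real_inner_smul_left _ _ _))
        (fun u v v' => (congrArg (inner ℝ (D u) ·) (D.map_add v v')).trans (inner_add_right _ _ _))
        (fun a u v => (congrArg (inner ℝ (D u) ·) (D.map_smul a v)).trans
          (real_inner_smul_right _ _ _)))

@[simp] lemma gram_apply (x₀ : S) (y u v : E) : gram x₀ y u v = chartMetric x₀ y u v := rfl

omit [FiniteDimensional ℝ E] in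
lemma chartMetric_eq_norm_sq (x₀ : S) (y u : E) :
    chartMetric x₀ y u u = ‖(ofCoord x₀ (y, u)).2‖ ^ 2 :=
  real_inner_self_eq_norm_sq _

variable [IsManifold 𝓘(ℝ, E) ∞ S]
  [IsContMDiffRiemannianBundle 𝓘(ℝ, E) ∞ E (fun x : S => TangentSpace 𝓘(ℝ, E) x)]

omit [FiniteDimensional ℝ E] in
lemma contDiffOn_chartMetric (x₀ : S) (u v : E) :
    ContDiffOn ℝ ∞ (fun y => chartMetric x₀ y u v) (extChartAt 𝓘(ℝ, E) x₀).target := by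
  rw [← contMDiffOn_iff_contDiffOn]
  have h := contMDiffOn_ofCoord_const (E := E) x₀
  exact ContMDiffOn.inner_bundle (h u) (h v)

/-- The metric in the chart around `x₀`. -/
def chartLocalMetric (x₀ : S) : LocalMetric E where
  dom := (extChartAt 𝓘(ℝ, E) x₀).target
  form := gram x₀
  isOpen_dom := isOpen_extChartAt_target x₀
  contDiffOn_form := by
    rw [contDiffOn_clm_apply]
    intro u
    rw [contDiffOn_clm_apply]
    exact contDiffOn_chartMetric x₀ u
  symm y _ u v := by
    simp only [gram_apply, chartMetric]
    exact real_inner_comm _ _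
  pos y hy u hu := by
    rw [gram_apply, chartMetric_eq_norm_sq]
    have : (ofCoord x₀ (y, u)).2 ≠ 0 := by
      intro h
      have h2 := mfderiv_chart_symm_apply hy u
      have h3 : mfderiv 𝓘(ℝ, E) 𝓘(ℝ, E) (extChartAt 𝓘(ℝ, E) x₀).symm y u = 0 := h
      rw [h3, map_zero] at h2
      exact hu h2.symm
    positivity

end Metric

/-! ### Invariance of the geodesic equation under isometric changes of coordinates -/

namespace LocalMetric

variable {E : Type*} [NormedAddCommGroup E] [NormedSpace ℝ E] {G G' : LocalMetric E}

lemma fderiv_form_apply {y : E} (hy : y ∈ G.dom) (k u w : E) :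
    fderiv ℝ (fun z => G.form z u w) y k = fderiv ℝ G.form y k u w := by
  have h := (((hasFDerivAt_form hy).clm_apply (hasFDerivAt_const u y)).clm_apply
    (hasFDerivAt_const w y))
  rw [h.fderiv]
  simp

section Transition

variable {ψ : E → E} {U : Set E} (hU : IsOpen U) (hUG : U ⊆ G.dom) (hψ : ContDiffOn ℝ ∞ ψ U)
  (hmaps : Set.MapsTo ψ U G'.dom)
  (hiso : ∀ y ∈ U, ∀ u, G.form y u u = G'.form (ψ y) (fderiv ℝ ψ y u) (fderiv ℝ ψ y u))

include hU hUG hψ hmaps hiso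

omit hU hψ in
-- Polarization of `hiso`, which is assumed only on the diagonal.
lemma form_eq_of_isometry {y : E} (hy : y ∈ U) (u w : E) :
    G.form y u w = G'.form (ψ y) (fderiv ℝ ψ y u) (fderiv ℝ ψ y w) := by
  have h := hiso y hy (u + w)
  simp only [map_add, add_apply] at h
  rw [hiso y hy u, hiso y hy w, G.symm y (hUG hy) w u, G'.symm _ (hmaps hy) (fderiv ℝ ψ y w) (fderiv ℝ ψ y u)] at h
  linarith

lemma fderiv_form_eq_of_isometry {y : E} (hy : y ∈ U) (k u w : E) :
    fderiv ℝ G.form y k u w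
      = fderiv ℝ G'.form (ψ y) (fderiv ℝ ψ y k) (fderiv ℝ ψ y u) (fderiv ℝ ψ y w)
        + G'.form (ψ y) (fderiv ℝ (fderiv ℝ ψ) y k u) (fderiv ℝ ψ y w)
        + G'.form (ψ y) (fderiv ℝ ψ y u) (fderiv ℝ (fderiv ℝ ψ) y k w) := by
  have hnhds := hU.mem_nhds hy
  have hψ1 : HasFDerivAt ψ (fderiv ℝ ψ y) y :=
    ((hψ.contDiffAt hnhds).differentiableAt (by simp)).hasFDerivAt
  have hψ2 : HasFDerivAt (fderiv ℝ ψ) (fderiv ℝ (fderiv ℝ ψ) y) y :=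
    ((((hψ.fderiv_of_isOpen hU (m := ∞) (by simp))).contDiffAt hnhds).differentiableAt
      (by simp)).hasFDerivAt
  have hline : HasDerivAt (fun r : ℝ => y + r • k) k 0 := by
    simpa using ((hasDerivAt_id (0 : ℝ)).smul_const k).const_add y
  have e0 : y + (0 : ℝ) • k = y := by simp
  have h1 := hasDerivAt_form_apply (G := G) (c := fun r : ℝ => y + r • k) (v := fun _ => u)
    (w := fun _ => w) (s := 0) (by simpa using hUG hy) hline (hasDerivAt_const _ _)
    (hasDerivAt_const _ _)
  have hc : HasDerivAt (fun r : ℝ => ψ (y + r • k)) (fderiv ℝ ψ y k) 0 :=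
    HasFDerivAt.comp_hasDerivAt_of_eq (0 : ℝ) hψ1 hline e0.symm
  have hv (u : E) : HasDerivAt (fun r : ℝ => fderiv ℝ ψ (y + r • k) u)
      (fderiv ℝ (fderiv ℝ ψ) y k u) 0 :=
    (((HasFDerivAt.comp_hasDerivAt_of_eq (0 : ℝ) hψ2 hline e0.symm).clm_apply
      (hasDerivAt_const 0 u))).congr_deriv (by simp)
  have h2 := hasDerivAt_form_apply (G := G') (s := 0) (by simpa using hmaps hy) hc (hv u) (hv w)
  have heq : (fun r : ℝ => G.form (y + r • k) u w) =ᶠ[𝓝 0] fun r =>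
      G'.form (ψ (y + r • k)) (fderiv ℝ ψ (y + r • k) u) (fderiv ℝ ψ (y + r • k) w) := by
    have : ∀ᶠ r in 𝓝 (0 : ℝ), y + r • k ∈ U := by
      refine hline.continuousAt.eventually_mem ?_
      simpa using hnhds
    filter_upwards [this] with r hr
    exact form_eq_of_isometry hUG hmaps hiso hr u w
  have := (h1.congr_of_eventuallyEq heq.symm).unique h2
  simpa using this

/-- In the Koszul combination the terms containing D²ψ(u,w) cancel by symmetry of the second
derivative, leaving only the inhomogeneous term D²ψ(u,u). -/
lemma lowerChristoffel_of_isometry {y : E} (hy : y ∈ U) (u w : E) :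
    G.lowerChristoffel y u w = G'.lowerChristoffel (ψ y) (fderiv ℝ ψ y u) (fderiv ℝ ψ y w)
      + G'.form (ψ y) (fderiv ℝ (fderiv ℝ ψ) y u u) (fderiv ℝ ψ y w) := by
  have hsymm : fderiv ℝ (fderiv ℝ ψ) y w u = fderiv ℝ (fderiv ℝ ψ) y u w :=
    ((hψ.contDiffAt (hU.mem_nhds hy)).isSymmSndFDerivAt
      (by rw [minSmoothness_of_isRCLikeNormedField]; exact WithTop.coe_le_coe.2 le_top)) w u
  rw [lowerChristoffel_apply, lowerChristoffel_apply,
    fderiv_form_eq_of_isometry hU hUG hψ hmaps hiso hy,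
    fderiv_form_eq_of_isometry hU hUG hψ hmaps hiso hy, hsymm,
    G'.symm _ (hmaps hy) (fderiv ℝ (fderiv ℝ ψ) y u w)]
  ring

variable [FiniteDimensional ℝ E]

/-- The geodesic equation is preserved by isometries. -/
lemma IsSolutionOn.map {c v : ℝ → E} {J : Set ℝ} (h : G.IsSolutionOn c v J) (hJ : IsOpen J)
    {s : ℝ} (hs : s ∈ J) (hcs : c s ∈ U)
    (hsurj : Function.Surjective (fderiv ℝ ψ (c s))) (w : E) :
    G'.form (ψ (c s)) (deriv (deriv fun r => ψ (c r)) s) w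
      + G'.lowerChristoffel (ψ (c s)) (deriv (fun r => ψ (c r)) s) w = 0 := by
  have hd : ∀ᶠ r in 𝓝 s, HasDerivAt (fun r => ψ (c r)) (fderiv ℝ ψ (c r) (v r)) r := by
    filter_upwards [hJ.mem_nhds hs, (h.deriv_pos s hs).continuousAt (hU.mem_nhds hcs)] with r hr hrU
    exact ((hψ.contDiffAt (hU.mem_nhds hrU)).differentiableAt (by simp)).hasFDerivAt.comp_hasDerivAt
      r (h.deriv_pos r hr)
  have hψ2 : HasFDerivAt (fderiv ℝ ψ) (fderiv ℝ (fderiv ℝ ψ) (c s)) (c s) :=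
    ((((hψ.fderiv_of_isOpen hU (m := ∞) (by simp))).contDiffAt (hU.mem_nhds hcs)).differentiableAt
      (by simp)).hasFDerivAt
  have hdd := (hψ2.comp_hasDerivAt s (h.deriv_pos s hs)).clm_apply (h.deriv_vel s hs)
  have e1 : deriv (fun r => ψ (c r)) =ᶠ[𝓝 s] fun r => fderiv ℝ ψ (c r) (v r) :=
    hd.mono fun r hr => hr.deriv
  rw [e1.deriv_eq, e1.eq_of_nhds]
  have e2 : deriv (fun r => fderiv ℝ ψ (c r) (v r)) s
      = fderiv ℝ (fderiv ℝ ψ) (c s) (v s) (v s) + fderiv ℝ ψ (c s) (G.spray (c s) (v s)) := hdd.deriv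
  -- The test vector must be of the form Dψ(w) to apply the transformation rules. The D²ψ(v,v) in
  -- the acceleration of ψ∘c then cancels the inhomogeneous Christoffel term.
  obtain ⟨w, rfl⟩ := hsurj w
  have h1 := lowerChristoffel_of_isometry hU hUG hψ hmaps hiso hcs (v s) w
  have h2 := form_eq_of_isometry hUG hmaps hiso hcs (G.spray (c s) (v s)) w
  rw [form_spray (h.mem s hs)] at h2
  rw [e2, map_add, add_apply]
  linarith

end Transition

end LocalMetric

/-! ### Equivalence of manifold geodesics and solutions in charts -/

section Geodesic

variable {E : Type*} [NormedAddCommGroup E] [NormedSpace ℝ E] [FiniteDimensional ℝ E]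
  {S : Type*} [TopologicalSpace S] [ChartedSpace E S]
  [RiemannianBundle (fun x : S => TangentSpace 𝓘(ℝ, E) x)]
  [IsManifold 𝓘(ℝ, E) ∞ S]
  [IsContMDiffRiemannianBundle 𝓘(ℝ, E) ∞ E (fun x : S => TangentSpace 𝓘(ℝ, E) x)]

lemma christoffel_eq (x₀ : S) {y : E} (hy : y ∈ (extChartAt 𝓘(ℝ, E) x₀).target) (u w : E) :
    christoffel x₀ y u u w = (chartLocalMetric x₀).lowerChristoffel y u w := by
  have h (k a b : E) : fderiv ℝ (fun z => chartMetric x₀ z a b) y k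
      = fderiv ℝ (chartLocalMetric x₀).form y k a b :=
    LocalMetric.fderiv_form_apply (G := chartLocalMetric x₀) hy k a b
  rw [LocalMetric.lowerChristoffel_apply, christoffel, h, h]
  ring

lemma norm_sq_eq_chartMetric {x₀ : S} {z : TangentBundle 𝓘(ℝ, E) S}
    (hz : z.proj ∈ (extChartAt 𝓘(ℝ, E) x₀).source) :
    ‖z.2‖ ^ 2 = (chartLocalMetric x₀).form (toCoord x₀ z).1 (toCoord x₀ z).2 (toCoord x₀ z).2 := by
  have h := chartMetric_eq_norm_sq x₀ (toCoord x₀ z).1 (toCoord x₀ z).2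
  rw [Prod.mk.eta, ofCoord_toCoord hz] at h
  exact h.symm

omit [FiniteDimensional ℝ E] [RiemannianBundle (fun x : S => TangentSpace 𝓘(ℝ, E) x)]
  [IsManifold 𝓘(ℝ, E) ∞ S]
  [IsContMDiffRiemannianBundle 𝓘(ℝ, E) ∞ E (fun x : S => TangentSpace 𝓘(ℝ, E) x)] in
lemma mdifferentiableAt_of_contMDiffOn {γ : ℝ → S} {J : Set ℝ} (hJ : IsOpen J)
    (h : ContMDiffOn 𝓘(ℝ, ℝ) 𝓘(ℝ, E) ∞ γ J) {s : ℝ} (hs : s ∈ J) :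
    MDifferentiableAt 𝓘(ℝ, ℝ) 𝓘(ℝ, E) γ s :=
  (h.contMDiffAt (hJ.mem_nhds hs)).mdifferentiableAt (by simp)

/-- A geodesic, read in a chart, solves the geodesic equation. -/
lemma IsGeodesicOn.isSolutionOn {γ : ℝ → S} {J : Set ℝ} (h : IsGeodesicOn (E := E) γ J)
    (hJ : IsOpen J) (x₀ : S) :
    (chartLocalMetric x₀).IsSolutionOn (fun s => (toCoord x₀ (velocity E γ s)).1)
      (fun s => (toCoord x₀ (velocity E γ s)).2) (J ∩ γ ⁻¹' (extChartAt 𝓘(ℝ, E) x₀).source) := by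
  have hJ' : IsOpen (J ∩ γ ⁻¹' (extChartAt 𝓘(ℝ, E) x₀).source) :=
    h.1.continuousOn.isOpen_inter_preimage hJ (isOpen_extChartAt_source x₀)
  set J' := J ∩ γ ⁻¹' (extChartAt 𝓘(ℝ, E) x₀).source with hJ'def
  have hsm : ContDiffOn ℝ ∞ (fun r => extChartAt 𝓘(ℝ, E) x₀ (γ r)) J' := by
    rw [← contMDiffOn_iff_contDiffOn]
    have hch : ContMDiffOn 𝓘(ℝ, E) 𝓘(ℝ, E) ∞ (extChartAt 𝓘(ℝ, E) x₀)
        (extChartAt 𝓘(ℝ, E) x₀).source := by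
      rw [extChartAt_source]
      exact contMDiffOn_extChartAt
    exact hch.comp (h.1.mono Set.inter_subset_left) fun r hr => hr.2
  have hcoord : ∀ r ∈ J', toCoord x₀ (velocity E γ r)
      = (extChartAt 𝓘(ℝ, E) x₀ (γ r), deriv (fun r => extChartAt 𝓘(ℝ, E) x₀ (γ r)) r) :=
    fun r hr => toCoord_velocity (mdifferentiableAt_of_contMDiffOn hJ h.1 hr.1) hr.2
  have hmem : ∀ r ∈ J', extChartAt 𝓘(ℝ, E) x₀ (γ r) ∈ (extChartAt 𝓘(ℝ, E) x₀).target :=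
    fun r hr => (extChartAt 𝓘(ℝ, E) x₀).map_source hr.2
  have hd1 : ∀ r ∈ J', HasDerivAt (fun r => extChartAt 𝓘(ℝ, E) x₀ (γ r))
      (deriv (fun r => extChartAt 𝓘(ℝ, E) x₀ (γ r)) r) r := fun r hr =>
    ((hsm.contDiffAt (hJ'.mem_nhds hr)).differentiableAt (by simp)).hasDerivAt
  have hd2 : ∀ r ∈ J', HasDerivAt (deriv fun r => extChartAt 𝓘(ℝ, E) x₀ (γ r))
      (deriv (deriv fun r => extChartAt 𝓘(ℝ, E) x₀ (γ r)) r) r := fun r hr =>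
    (((hsm.deriv_of_isOpen hJ' (m := ∞) (by simp)).contDiffAt (hJ'.mem_nhds hr)).differentiableAt
      (by simp)).hasDerivAt
  refine ⟨fun s hs => ?_, fun s hs => ?_, fun s hs => ?_⟩
  · rw [hcoord s hs]
    exact hmem s hs
  · rw [hcoord s hs]
    exact (hd1 s hs).congr_of_eventuallyEq
      (by filter_upwards [hJ'.mem_nhds hs] with r hr; rw [hcoord r hr])
  · rw [hcoord s hs]
    have heq : (fun s => (toCoord x₀ (velocity E γ s)).2) =ᶠ[𝓝 s]
        deriv fun r => extChartAt 𝓘(ℝ, E) x₀ (γ r) := by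
      filter_upwards [hJ'.mem_nhds hs] with r hr
      rw [hcoord r hr]
    have := (hd2 s hs).congr_of_eventuallyEq heq
    refine this.congr_deriv (LocalMetric.eq_spray (G := chartLocalMetric x₀) (hmem s hs)
      fun w => ?_)
    have h2 := h.2 x₀ s hs.1 hs.2 w
    rw [christoffel_eq x₀ (hmem s hs)] at h2
    exact h2

/-- A solution of the geodesic equation in a chart is a geodesic. -/
lemma LocalMetric.IsSolutionOn.isGeodesicOn {x₀ : S} {c v : ℝ → E} {J : Set ℝ}
    (h : (chartLocalMetric x₀).IsSolutionOn c v J) (hJ : IsOpen J) :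
    IsGeodesicOn (E := E) (fun s => (extChartAt 𝓘(ℝ, E) x₀).symm (c s)) J := by
  have hc : ContDiffOn ℝ ∞ c J := contDiff_fst.comp_contDiffOn (h.contDiffOn hJ)
  refine ⟨(contMDiffOn_extChartAt_symm x₀).comp (contMDiffOn_iff_contDiffOn.2 hc) h.mem,
    fun x₁ s hs hsrc w => ?_⟩
  set φ₀ := extChartAt 𝓘(ℝ, E) x₀ with hφ₀
  set φ₁ := extChartAt 𝓘(ℝ, E) x₁ with hφ₁
  set U : Set E := φ₀.target ∩ φ₀.symm ⁻¹' φ₁.source with hU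
  have hUo : IsOpen U := (continuousOn_extChartAt_symm x₀).isOpen_inter_preimage
    (isOpen_extChartAt_target x₀) (isOpen_extChartAt_source x₁)
  -- Being a geodesic is tested in every chart, while the equation is known only in the chart at
  -- `x₀`; the transition map ψ is an isometry between the two chart metrics and carries it over.
  set ψ : E → E := fun y => φ₁ (φ₀.symm y) with hψdef
  have hψ : ContDiffOn ℝ ∞ ψ U := by
    rw [← contMDiffOn_iff_contDiffOn]
    have hch : ContMDiffOn 𝓘(ℝ, E) 𝓘(ℝ, E) ∞ φ₁ φ₁.source := by
      rw [hφ₁, extChartAt_source]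
      exact contMDiffOn_extChartAt
    exact hch.comp ((contMDiffOn_extChartAt_symm x₀).mono Set.inter_subset_left) fun y hy => hy.2
  have hfd : ∀ y ∈ U, ∀ u, toCoord x₁ (ofCoord x₀ (y, u)) = (ψ y, fderiv ℝ ψ y u) := by
    intro y hy u
    refine Prod.ext rfl ?_
    have h1 := mfderiv_comp y (mdifferentiableAt_chart hy.2) (mdifferentiableAt_chart_symm hy.1)
    rw [mfderiv_eq_fderiv] at h1
    exact congr($h1 u).symm
  have hmaps : Set.MapsTo ψ U (chartLocalMetric x₁).dom := fun y hy => φ₁.map_source hy.2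
  have hiso : ∀ y ∈ U, ∀ u, (chartLocalMetric x₀).form y u u
      = (chartLocalMetric x₁).form (ψ y) (fderiv ℝ ψ y u) (fderiv ℝ ψ y u) := by
    intro y hy u
    have h1 := norm_sq_eq_chartMetric (x₀ := x₁) (z := ofCoord x₀ (y, u)) hy.2
    rw [hfd y hy u] at h1
    exact (chartMetric_eq_norm_sq x₀ y u).trans h1
  have hcs : c s ∈ U := ⟨h.mem s hs, hsrc⟩
  have hsurj : Function.Surjective (fderiv ℝ ψ (c s)) := by
    suffices h : Function.Injective (fderiv ℝ ψ (c s) : E →ₗ[ℝ] E) from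
      LinearMap.injective_iff_surjective.1 h
    rw [← LinearMap.ker_eq_bot, LinearMap.ker_eq_bot']
    intro u hu
    by_contra hne
    have h1 := (chartLocalMetric x₀).pos _ hcs.1 u hne
    rw [hiso _ hcs u] at h1
    have hu' : fderiv ℝ ψ (c s) u = 0 := hu
    simp [hu'] at h1
  have key := h.map hUo Set.inter_subset_left hψ hmaps hiso hJ hs hcs hsurj w
  have hmem : φ₁ (φ₀.symm (c s)) ∈ φ₁.target := φ₁.map_source hsrc
  rw [christoffel_eq x₁ hmem]
  exact key

end Geodesic

lemma LocalMetric.IsSolutionOn.comp_add {E : Type*} [NormedAddCommGroup E] [NormedSpace ℝ E]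
    {G : LocalMetric E} {c v : ℝ → E} {J : Set ℝ} (h : G.IsSolutionOn c v J) (b : ℝ) :
    G.IsSolutionOn (fun s => c (s + b)) (fun s => v (s + b)) ((· + b) ⁻¹' J) :=
  ⟨fun _ hs => h.mem _ hs, fun s hs => (h.deriv_pos _ hs).comp_add_const s b,
    fun s hs => (h.deriv_vel _ hs).comp_add_const s b⟩

section Velocity

variable {E : Type*} [NormedAddCommGroup E] [NormedSpace ℝ E]
  {S : Type*} [TopologicalSpace S] [ChartedSpace E S]

lemma velocity_congr {γ₁ γ₂ : ℝ → S} {s : ℝ} (h : γ₁ =ᶠ[𝓝 s] γ₂) :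
    velocity E γ₁ s = velocity E γ₂ s := by
  refine TotalSpace.ext h.eq_of_nhds (heq_of_eq ?_)
  change (mfderiv 𝓘(ℝ, ℝ) 𝓘(ℝ, E) γ₁ s : ℝ →L[ℝ] E) 1 = (mfderiv 𝓘(ℝ, ℝ) 𝓘(ℝ, E) γ₂ s : ℝ →L[ℝ] E) 1
  rw [h.mfderiv_eq]
  rfl

lemma velocity_comp_mul_add {γ : ℝ → S} {a b s : ℝ}
    (h : MDifferentiableAt 𝓘(ℝ, ℝ) 𝓘(ℝ, E) γ (a * s + b)) :
    velocity E (fun r => γ (a * r + b)) s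
      = ⟨γ (a * s + b), a • (velocity E γ (a * s + b)).2⟩ := by
  have hd : HasDerivAt (fun r : ℝ => a * r + b) a s := by
    simpa using ((hasDerivAt_id s).const_mul a).add_const b
  have h1 := mfderiv_comp (I := 𝓘(ℝ, ℝ)) (I' := 𝓘(ℝ, ℝ)) s h hd.differentiableAt.mdifferentiableAt
  rw [mfderiv_eq_fderiv] at h1
  have h2 := congr($h1 (1 : ℝ))
  have e : fderiv ℝ (fun r : ℝ => a * r + b) s 1 = a • (1 : ℝ) := by
    rw [fderiv_apply_one_eq_deriv, hd.deriv, smul_eq_mul, mul_one]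
  refine TotalSpace.ext rfl (heq_of_eq (h2.trans ?_))
  change (mfderiv 𝓘(ℝ, ℝ) 𝓘(ℝ, E) γ (a * s + b) : ℝ →L[ℝ] E)
    (fderiv ℝ (fun r : ℝ => a * r + b) s 1) = _
  rw [e]
  exact (mfderiv 𝓘(ℝ, ℝ) 𝓘(ℝ, E) γ (a * s + b) : ℝ →L[ℝ] E).map_smul a 1

end Velocity

/-! ### Locality, uniqueness and constant speed of geodesics -/

section Geodesic

variable {E : Type*} [NormedAddCommGroup E] [NormedSpace ℝ E]
  {S : Type*} [TopologicalSpace S] [ChartedSpace E S]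
  [RiemannianBundle (fun x : S => TangentSpace 𝓘(ℝ, E) x)]

lemma IsGeodesicOn.mono {γ : ℝ → S} {J J' : Set ℝ} (h : IsGeodesicOn (E := E) γ J) (hJ : J' ⊆ J) :
    IsGeodesicOn (E := E) γ J' :=
  ⟨h.1.mono hJ, fun x₀ s hs => h.2 x₀ s (hJ hs)⟩

/-- Being a geodesic is a local property. -/
lemma isGeodesicOn_of_forall {γ : ℝ → S} {J : Set ℝ}
    (h : ∀ s ∈ J, ∃ (γ' : ℝ → S) (U : Set ℝ), IsOpen U ∧ s ∈ U ∧ IsGeodesicOn (E := E) γ' U ∧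
      γ =ᶠ[𝓝 s] γ') : IsGeodesicOn (E := E) γ J := by
  constructor
  · intro s hs
    obtain ⟨γ', U, hU, hsU, hγ', heq⟩ := h s hs
    exact ((hγ'.1.contMDiffAt (hU.mem_nhds hsU)).congr_of_eventuallyEq heq).contMDiffWithinAt
  · intro x₀ s hs hsrc w
    obtain ⟨γ', U, hU, hsU, hγ', heq⟩ := h s hs
    have e : (fun r => extChartAt 𝓘(ℝ, E) x₀ (γ r)) =ᶠ[𝓝 s]
        fun r => extChartAt 𝓘(ℝ, E) x₀ (γ' r) := heq.fun_comp _
    rw [e.deriv.deriv_eq, e.deriv_eq, heq.eq_of_nhds]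
    exact hγ'.2 x₀ s hsU (heq.eq_of_nhds ▸ hsrc) w

lemma IsGeodesicOn.isOpen_inter_source {γ : ℝ → S} {J : Set ℝ} (h : IsGeodesicOn (E := E) γ J)
    (hJ : IsOpen J) (x₀ : S) : IsOpen (J ∩ γ ⁻¹' (extChartAt 𝓘(ℝ, E) x₀).source) :=
  h.1.continuousOn.isOpen_inter_preimage hJ (isOpen_extChartAt_source x₀)

variable [IsManifold 𝓘(ℝ, E) ∞ S]

lemma IsGeodesicOn.velocity_eventuallyEq {γ : ℝ → S} {J : Set ℝ}
    (h : IsGeodesicOn (E := E) γ J) (hJ : IsOpen J) {s : ℝ} (hs : s ∈ J) {x₀ : S}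
    (hx₀ : γ s ∈ (extChartAt 𝓘(ℝ, E) x₀).source) :
    velocity E γ =ᶠ[𝓝 s] fun r => ofCoord x₀ (toCoord x₀ (velocity E γ r)) := by
  filter_upwards [(h.isOpen_inter_source hJ x₀).mem_nhds ⟨hs, hx₀⟩] with r hr
  exact (ofCoord_toCoord (z := velocity E γ r) hr.2).symm

variable [FiniteDimensional ℝ E]
  [IsContMDiffRiemannianBundle 𝓘(ℝ, E) ∞ E (fun x : S => TangentSpace 𝓘(ℝ, E) x)]

/-- By locality the statement reduces to one chart, where it is the homogeneity of the spray. -/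
lemma IsGeodesicOn.comp_mul_add {γ : ℝ → S} {J : Set ℝ} (h : IsGeodesicOn (E := E) γ J)
    (hJ : IsOpen J) (a b : ℝ) :
    IsGeodesicOn (E := E) (fun s => γ (a * s + b)) ((fun s => a * s + b) ⁻¹' J) := by
  refine isGeodesicOn_of_forall fun s hs => ?_
  set x₀ := γ (a * s + b) with hx₀
  have hJ' := h.isOpen_inter_source hJ x₀
  have hcont : Continuous fun s : ℝ => a * s + b := by fun_prop
  have hsol := ((h.isSolutionOn hJ x₀).comp_add b).comp_mul a
  have hs' : a * s + b ∈ J ∩ γ ⁻¹' (extChartAt 𝓘(ℝ, E) x₀).source :=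
    ⟨hs, mem_extChartAt_source x₀⟩
  have hopen := hJ'.preimage hcont
  refine ⟨_, _, hopen, hs', hsol.isGeodesicOn hopen, ?_⟩
  filter_upwards [hopen.mem_nhds hs'] with r hr
  exact ((extChartAt 𝓘(ℝ, E) x₀).left_inv hr.2).symm

lemma IsGeodesicOn.continuousAt_toCoord {γ : ℝ → S} {J : Set ℝ}
    (h : IsGeodesicOn (E := E) γ J) (hJ : IsOpen J) {s : ℝ} (hs : s ∈ J) {x₀ : S}
    (hx₀ : γ s ∈ (extChartAt 𝓘(ℝ, E) x₀).source) :
    ContinuousAt (fun r => toCoord x₀ (velocity E γ r)) s :=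
  ((h.isSolutionOn hJ x₀).hasDerivAt ⟨hs, hx₀⟩).continuousAt

lemma IsGeodesicOn.continuousOn_velocity {γ : ℝ → S} {J : Set ℝ}
    (h : IsGeodesicOn (E := E) γ J) (hJ : IsOpen J) : ContinuousOn (velocity E γ) J := by
  intro s hs
  have hx₀ := mem_extChartAt_source (I := 𝓘(ℝ, E)) (γ s)
  refine ContinuousAt.continuousWithinAt ?_
  refine ContinuousAt.congr ?_ (h.velocity_eventuallyEq hJ hs hx₀).symm
  refine ContinuousAt.comp (g := ofCoord (γ s)) ?_ (h.continuousAt_toCoord hJ hs hx₀)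
  exact (continuousOn_ofCoord (γ s)).continuousAt (prod_mem_nhds
    ((isOpen_extChartAt_target (I := 𝓘(ℝ, E)) (γ s)).mem_nhds ((extChartAt 𝓘(ℝ, E) _).map_source hx₀)) Filter.univ_mem)

/-- Geodesics with the same velocity at one time agree near that time. -/
lemma IsGeodesicOn.eventuallyEq {γ₁ γ₂ : ℝ → S} {J : Set ℝ} (h₁ : IsGeodesicOn (E := E) γ₁ J)
    (h₂ : IsGeodesicOn (E := E) γ₂ J) (hJ : IsOpen J) {s : ℝ} (hs : s ∈ J)
    (hv : velocity E γ₁ s = velocity E γ₂ s) : γ₁ =ᶠ[𝓝 s] γ₂ := by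
  set x₀ := γ₁ s with hx₀
  have hs₁ : s ∈ J ∩ γ₁ ⁻¹' (extChartAt 𝓘(ℝ, E) x₀).source := ⟨hs, mem_extChartAt_source x₀⟩
  have hs₂ : s ∈ J ∩ γ₂ ⁻¹' (extChartAt 𝓘(ℝ, E) x₀).source := by
    refine ⟨hs, ?_⟩
    have : γ₁ s = γ₂ s := congrArg TotalSpace.proj hv
    rw [Set.mem_preimage, ← this]
    exact mem_extChartAt_source x₀
  have hU := Filter.inter_mem ((h₁.isOpen_inter_source hJ x₀).mem_nhds hs₁)
    ((h₂.isOpen_inter_source hJ x₀).mem_nhds hs₂)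
  have key := LocalMetric.IsSolutionOn.eventuallyEq hU
    ((h₁.isSolutionOn hJ x₀).mono Set.inter_subset_left)
    ((h₂.isSolutionOn hJ x₀).mono Set.inter_subset_right) (by rw [hv]) (by rw [hv])
  filter_upwards [key, hU] with r hr hrU
  exact (extChartAt 𝓘(ℝ, E) x₀).injOn hrU.1.2 hrU.2.2 congr(($hr).1)

/-- Geodesics are determined by their velocity at one time. -/
lemma IsGeodesicOn.eqOn [T2Space S] {γ₁ γ₂ : ℝ → S} {J : Set ℝ}
    (h₁ : IsGeodesicOn (E := E) γ₁ J) (h₂ : IsGeodesicOn (E := E) γ₂ J) (hJ : IsOpen J)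
    (hJc : J.OrdConnected) {s : ℝ} (hs : s ∈ J) (hv : velocity E γ₁ s = velocity E γ₂ s) :
    Set.EqOn (velocity E γ₁) (velocity E γ₂) J := by
  -- Connectedness applied to the times at which the germs agree. Working with germs makes this set
  -- open at once. At a limit time, positions agree because `S` is Hausdorff and coordinate
  -- velocities agree by continuity, so local uniqueness applies again.
  have key : J ⊆ {r | γ₁ =ᶠ[𝓝 r] γ₂} := by
    refine hJc.isPreconnected.subset_of_closure_inter_subset ?_
      ⟨s, hs, h₁.eventuallyEq h₂ hJ hs hv⟩ ?_
    · rw [isOpen_iff_mem_nhds]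
      intro r hr
      exact hr.eventuallyEq_nhds
    · rintro r ⟨hr, hrJ⟩
      rw [mem_closure_iff_frequently] at hr
      have hγ : γ₁ r = γ₂ r := tendsto_nhds_unique_of_frequently_eq
        (h₁.1.continuousOn.continuousAt (hJ.mem_nhds hrJ))
        (h₂.1.continuousOn.continuousAt (hJ.mem_nhds hrJ)) (hr.mono fun q hq => hq.eq_of_nhds)
      have hs₁ := mem_extChartAt_source (I := 𝓘(ℝ, E)) (γ₁ r)
      have hs₂ : γ₂ r ∈ (extChartAt 𝓘(ℝ, E) (γ₁ r)).source := hγ ▸ hs₁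
      have heq : toCoord (γ₁ r) (velocity E γ₁ r) = toCoord (γ₁ r) (velocity E γ₂ r) :=
        tendsto_nhds_unique_of_frequently_eq (h₁.continuousAt_toCoord hJ hrJ hs₁)
        (h₂.continuousAt_toCoord hJ hrJ hs₂) (hr.mono fun q hq => by rw [velocity_congr hq])
      refine h₁.eventuallyEq h₂ hJ hrJ ?_
      rw [← ofCoord_toCoord (z := velocity E γ₁ r) hs₁, heq,
        ofCoord_toCoord (z := velocity E γ₂ r) hs₂]
  exact fun r hr => velocity_congr (key hr)

/-- Geodesics have constant speed. -/
lemma IsGeodesicOn.norm_velocity_eq {γ : ℝ → S} {J : Set ℝ} (h : IsGeodesicOn (E := E) γ J)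
    (hJ : IsOpen J) (hJc : J.OrdConnected) {s r : ℝ} (hs : s ∈ J) (hr : r ∈ J) :
    ‖(velocity E γ s).2‖ = ‖(velocity E γ r).2‖ := by
  have hd : ∀ q ∈ J, HasDerivAt (fun q => ‖(velocity E γ q).2‖ ^ 2) 0 q := by
    intro q hq
    have hq' : q ∈ J ∩ γ ⁻¹' (extChartAt 𝓘(ℝ, E) (γ q)).source := ⟨hq, mem_extChartAt_source _⟩
    refine ((h.isSolutionOn hJ (γ q)).hasDerivAt_energy hq').congr_of_eventuallyEq ?_
    filter_upwards [(h.isOpen_inter_source hJ (γ q)).mem_nhds hq'] with q' hq'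
    exact norm_sq_eq_chartMetric hq'.2
  have := hJ.is_const_of_deriv_eq_zero hJc.isPreconnected
    (fun q hq => (hd q hq).differentiableAt.differentiableWithinAt)
    (fun q hq => (hd q hq).deriv) hs hr
  exact (sq_eq_sq₀ (norm_nonneg _) (norm_nonneg _)).1 this

/-- The geodesic picked by choice in `expMap` agrees with any other one on the intersection of their
intervals, which contains both 0 and 1. -/
lemma expMap_eq [T2Space S] {p : S} {v : TangentSpace 𝓘(ℝ, E) p} {γ : ℝ → S}
    (h : IsGeodesicFrom p v γ) : expMap p v = γ 1 := by
  have hex : ∃ γ : ℝ → S, IsGeodesicFrom p v γ := ⟨γ, h⟩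
  rw [expMap, dif_pos hex]
  obtain ⟨J₁, hJ₁, hJc₁, h0₁, h1₁, hγ₁, hv₁⟩ := hex.choose_spec
  obtain ⟨J₂, hJ₂, hJc₂, h0₂, h1₂, hγ₂, hv₂⟩ := h
  have := (hγ₁.mono Set.inter_subset_left).eqOn (hγ₂.mono Set.inter_subset_right)
    (hJ₁.inter hJ₂) (hJc₁.inter hJc₂) ⟨h0₁, h0₂⟩ (hv₁.trans hv₂.symm) ⟨h1₁, h1₂⟩
  exact congrArg TotalSpace.proj this

end Geodesic

/-- The convexity bound with y' = y and u = 0. -/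
lemma LocalMetric.exists_coercive_closedBall {E : Type*} [NormedAddCommGroup E] [NormedSpace ℝ E]
    [FiniteDimensional ℝ E] {G : LocalMetric E} {y₀ : E} (hy₀ : y₀ ∈ G.dom) :
    ∃ a > (0 : ℝ), ∃ l > (0 : ℝ), Metric.closedBall y₀ a ⊆ G.dom ∧
      ∀ y ∈ Metric.closedBall y₀ a, ∀ u : E, l * ‖u‖ ^ 2 ≤ G.form y u u := by
  obtain ⟨a, ha, l, hl, C, K, -, hball, h, -⟩ := exists_bounds hy₀
  exact ⟨a, ha, l, hl, hball, fun y hy u => by simpa using h y hy y hy 0 u⟩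

/-! ### Geodesic flow on the tangent bundle, extension of geodesics, continuity of exp -/

section Flow

variable {E : Type*} [NormedAddCommGroup E] [NormedSpace ℝ E]
  {S : Type*} [TopologicalSpace S] [ChartedSpace E S]
  [RiemannianBundle (fun x : S => TangentSpace 𝓘(ℝ, E) x)]

/-- `γ` is a geodesic with initial velocity `z`, defined on the open interval `J ∋ 0`. -/
structure IsGeodesicWith (z : TangentBundle 𝓘(ℝ, E) S) (γ : ℝ → S) (J : Set ℝ) : Prop where
  isOpen : IsOpen J
  ordConnected : J.OrdConnected
  zero_mem : 0 ∈ J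
  isGeodesicOn : IsGeodesicOn (E := E) γ J
  velocity_zero : velocity E γ 0 = z

lemma isGeodesicFrom_iff {p : S} {v : TangentSpace 𝓘(ℝ, E) p} {γ : ℝ → S} :
    IsGeodesicFrom p v γ ↔ ∃ J, IsGeodesicWith ⟨p, v⟩ γ J ∧ 1 ∈ J :=
  ⟨fun ⟨J, h1, h2, h3, h4, h5, h6⟩ => ⟨J, ⟨h1, h2, h3, h5, h6⟩, h4⟩,
    fun ⟨J, ⟨h1, h2, h3, h5, h6⟩, h4⟩ => ⟨J, h1, h2, h3, h4, h5, h6⟩⟩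

variable [FiniteDimensional ℝ E] [IsManifold 𝓘(ℝ, E) ∞ S]
  [IsContMDiffRiemannianBundle 𝓘(ℝ, E) ∞ E (fun x : S => TangentSpace 𝓘(ℝ, E) x)]

/-- The local geodesic flow on the tangent bundle. -/
lemma exists_flow_box (z₀ : TangentBundle 𝓘(ℝ, E) S) :
    ∃ U ∈ 𝓝 z₀, ∃ δ > (0 : ℝ), ∃ Γ : TangentBundle 𝓘(ℝ, E) S → ℝ → S,
      (∀ z ∈ U, IsGeodesicWith z (Γ z) (Set.Ioo (-δ) δ)) ∧
      ContinuousOn (fun q : TangentBundle 𝓘(ℝ, E) S × ℝ => velocity E (Γ q.1) q.2)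
        (U ×ˢ Set.Ioo (-δ) δ) := by
  set x₀ := z₀.proj with hx₀
  have hsrc : z₀.proj ∈ (extChartAt 𝓘(ℝ, E) x₀).source := mem_extChartAt_source x₀
  obtain ⟨r, hr, ε, hε, α, hα, hcont⟩ := LocalMetric.exists_flow (G := chartLocalMetric x₀)
    (z₀ := toCoord x₀ z₀) ((extChartAt 𝓘(ℝ, E) x₀).map_source hsrc) Filter.univ_mem
  have hproj : Continuous (TotalSpace.proj : TangentBundle 𝓘(ℝ, E) S → S) :=
    FiberBundle.continuous_proj E _
  have hsrc_nhds : (TotalSpace.proj ⁻¹' (extChartAt 𝓘(ℝ, E) x₀).source :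
      Set (TangentBundle 𝓘(ℝ, E) S)) ∈ 𝓝 z₀ :=
    ((isOpen_extChartAt_source x₀).preimage hproj).mem_nhds hsrc
  set U : Set (TangentBundle 𝓘(ℝ, E) S) := TotalSpace.proj ⁻¹' (extChartAt 𝓘(ℝ, E) x₀).source ∩
    toCoord x₀ ⁻¹' Metric.closedBall (toCoord x₀ z₀) r with hU
  have hvel : ∀ z ∈ U, ∀ s ∈ Set.Ioo (-ε) ε,
      velocity E (fun s => (extChartAt 𝓘(ℝ, E) x₀).symm (α (toCoord x₀ z, s)).1) s
        = ofCoord x₀ (α (toCoord x₀ z, s)) := fun z hz s hs =>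
    velocity_chart_symm ((hα _ hz.2).2.2.deriv_pos s hs) ((hα _ hz.2).2.2.mem s hs)
  have h0 : (0 : ℝ) ∈ Set.Ioo (-ε) ε := ⟨by linarith, hε⟩
  refine ⟨U, Filter.inter_mem hsrc_nhds (((continuousOn_toCoord x₀).continuousAt hsrc_nhds)
    (Metric.closedBall_mem_nhds _ hr)), ε, hε,
    fun z s => (extChartAt 𝓘(ℝ, E) x₀).symm (α (toCoord x₀ z, s)).1, fun z hz =>
      ⟨isOpen_Ioo, Set.ordConnected_Ioo, h0, (hα _ hz.2).2.2.isGeodesicOn isOpen_Ioo, ?_⟩, ?_⟩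
  · rw [hvel z hz 0 h0, (hα _ hz.2).1, ofCoord_toCoord hz.1]
  · have h1 : ContinuousOn (fun q : TangentBundle 𝓘(ℝ, E) S × ℝ => (toCoord x₀ q.1, q.2))
        (U ×ˢ Set.Ioo (-ε) ε) :=
      (((continuousOn_toCoord x₀).mono Set.inter_subset_left).comp continuousOn_fst
        fun q hq => hq.1).prodMk continuousOn_snd
    refine ((continuousOn_ofCoord x₀).comp (hcont.comp h1 fun q hq => ⟨hq.1.2, hq.2⟩)
      fun q hq => ⟨(hα _ hq.1.2).2.2.mem _ hq.2, trivial⟩).congr fun q hq => hvel q.1 hq.1 q.2 hq.2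

lemma continuous_norm_tangent :
    Continuous fun z : TangentBundle 𝓘(ℝ, E) S => ‖z.2‖ := by
  have h : Continuous fun z : TangentBundle 𝓘(ℝ, E) S => ‖z.2‖ ^ 2 := by
    rw [continuous_iff_continuousAt]
    intro z₀
    have hsrc : z₀.proj ∈ (extChartAt 𝓘(ℝ, E) z₀.proj).source := mem_extChartAt_source _
    have hproj : Continuous (TotalSpace.proj : TangentBundle 𝓘(ℝ, E) S → S) :=
      FiberBundle.continuous_proj E _
    have hnhds : (TotalSpace.proj ⁻¹' (extChartAt 𝓘(ℝ, E) z₀.proj).source :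
        Set (TangentBundle 𝓘(ℝ, E) S)) ∈ 𝓝 z₀ :=
      ((isOpen_extChartAt_source z₀.proj).preimage hproj).mem_nhds hsrc
    have heq : (fun z : TangentBundle 𝓘(ℝ, E) S => ‖z.2‖ ^ 2) =ᶠ[𝓝 z₀] fun z =>
        (chartLocalMetric z₀.proj).form (toCoord z₀.proj z).1 (toCoord z₀.proj z).2
          (toCoord z₀.proj z).2 := by
      filter_upwards [hnhds] with z hz
      exact norm_sq_eq_chartMetric hz
    have hc := (continuousOn_toCoord z₀.proj).continuousAt hnhds
    have hf := (LocalMetric.contDiffAt_form (G := chartLocalMetric z₀.proj)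
      ((extChartAt 𝓘(ℝ, E) z₀.proj).map_source hsrc)).continuousAt
    refine ContinuousAt.congr ?_ heq.symm
    exact ((ContinuousAt.comp (f := fun z => (toCoord z₀.proj z).1) (x := z₀) hf hc.fst).clm_apply
      hc.snd).clm_apply hc.snd
  have := Real.continuous_sqrt.comp h
  refine this.congr fun z => ?_
  simp [Real.sqrt_sq]

/-- Near any point, the tangent vectors of bounded length are contained in a compact set. -/
lemma exists_compact_ball_bundle (x₀ : S) (R : ℝ) :
    ∃ N ∈ 𝓝 x₀, ∃ C : Set (TangentBundle 𝓘(ℝ, E) S), IsCompact C ∧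
      ∀ z : TangentBundle 𝓘(ℝ, E) S, z.proj ∈ N → ‖z.2‖ ≤ R → z ∈ C := by
  set φ := extChartAt 𝓘(ℝ, E) x₀ with hφ
  have hy₀ : φ x₀ ∈ (chartLocalMetric (E := E) x₀).dom :=
    φ.map_source (mem_extChartAt_source x₀)
  obtain ⟨a, ha, l, hl, hball, hco⟩ := LocalMetric.exists_coercive_closedBall hy₀
  refine ⟨φ.source ∩ φ ⁻¹' Metric.closedBall (φ x₀) a,
    Filter.inter_mem (extChartAt_source_mem_nhds x₀)
      ((continuousAt_extChartAt x₀) (Metric.closedBall_mem_nhds _ ha)),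
    ofCoord x₀ '' (Metric.closedBall (φ x₀) a ×ˢ Metric.closedBall 0 (|R| / √l)),
    ((isCompact_closedBall _ _).prod (isCompact_closedBall _ _)).image_of_continuousOn
      ((continuousOn_ofCoord x₀).mono (Set.prod_mono hball (Set.subset_univ _))),
    fun z hz hzR => ⟨toCoord x₀ z, ⟨hz.2, ?_⟩, ofCoord_toCoord hz.1⟩⟩
  have h1 := norm_sq_eq_chartMetric (x₀ := x₀) hz.1
  have h2 := hco _ hz.2 (toCoord x₀ z).2
  rw [mem_closedBall_zero_iff, le_div_iff₀ (by positivity)]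
  have h3 : ‖z.2‖ ^ 2 ≤ R ^ 2 := by gcongr
  refine abs_le_of_sq_le_sq' ?_ (abs_nonneg R) |>.2
  rw [mul_pow, Real.sq_sqrt hl.le, sq_abs]
  have h4 : l * ‖(toCoord x₀ z).2‖ ^ 2 ≤ ‖z.2‖ ^ 2 := h2.trans h1.ge
  linarith

/-- Local compact sets from charts are patched over `K`. This only encloses the ball bundle, which
is then compact as a closed subset. -/
lemma isCompact_ball_bundle [T2Space S] {K : Set S} (hK : IsCompact K) (R : ℝ) :
    IsCompact {z : TangentBundle 𝓘(ℝ, E) S | z.proj ∈ K ∧ ‖z.2‖ ≤ R} := by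
  obtain ⟨C, hC, hsub⟩ : ∃ C : Set (TangentBundle 𝓘(ℝ, E) S), IsCompact C ∧
      ∀ z : TangentBundle 𝓘(ℝ, E) S, z.proj ∈ K → ‖z.2‖ ≤ R → z ∈ C := by
    refine hK.induction_on (p := fun A => ∃ C : Set (TangentBundle 𝓘(ℝ, E) S), IsCompact C ∧
      ∀ z : TangentBundle 𝓘(ℝ, E) S, z.proj ∈ A → ‖z.2‖ ≤ R → z ∈ C) ?_ ?_ ?_ ?_
    · exact ⟨∅, isCompact_empty, fun z hz => hz.elim⟩
    · rintro A B hAB ⟨C, hC, h⟩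
      exact ⟨C, hC, fun z hz => h z (hAB hz)⟩
    · rintro A B ⟨C, hC, h⟩ ⟨C', hC', h'⟩
      exact ⟨C ∪ C', hC.union hC', fun z hz hR => hz.imp (h z · hR) (h' z · hR)⟩
    · intro x _
      obtain ⟨N, hN, C, hC, h⟩ := exists_compact_ball_bundle (E := E) x R
      exact ⟨N, mem_nhdsWithin_of_mem_nhds hN, C, hC, h⟩
  refine hC.of_isClosed_subset (IsClosed.inter ?_ ?_) fun z hz => hsub z hz.1 hz.2
  · exact hK.isClosed.preimage (FiberBundle.continuous_proj E _)
  · exact isClosed_le continuous_norm_tangent continuous_const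

/-- Geodesics with initial velocity in a compact set exist for a uniform time. -/
lemma exists_uniform_time {Z : Set (TangentBundle 𝓘(ℝ, E) S)} (hZ : IsCompact Z) :
    ∃ δ > (0 : ℝ), ∀ z ∈ Z, ∃ γ, IsGeodesicWith z γ (Set.Ioo (-δ) δ) := by
  refine hZ.induction_on (p := fun A => ∃ δ > (0 : ℝ), ∀ z ∈ A, ∃ γ, IsGeodesicWith z γ
    (Set.Ioo (-δ) δ)) ⟨1, one_pos, fun z hz => hz.elim⟩ ?_ ?_ ?_
  · rintro A B hAB ⟨δ, hδ, h⟩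
    exact ⟨δ, hδ, fun z hz => h z (hAB hz)⟩
  · rintro A B ⟨δ, hδ, h⟩ ⟨δ', hδ', h'⟩
    have hshrink : ∀ {ε : ℝ} {z : TangentBundle 𝓘(ℝ, E) S}, min δ δ' ≤ ε →
        (∃ γ, IsGeodesicWith z γ (Set.Ioo (-ε) ε)) →
        ∃ γ, IsGeodesicWith z γ (Set.Ioo (-(min δ δ')) (min δ δ')) := by
      rintro ε z hε ⟨γ, hγ⟩
      have hm : 0 < min δ δ' := lt_min hδ hδ'
      exact ⟨γ, isOpen_Ioo, Set.ordConnected_Ioo, ⟨by linarith, hm⟩,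
        hγ.isGeodesicOn.mono (Set.Ioo_subset_Ioo (by linarith) hε), hγ.velocity_zero⟩
    refine ⟨min δ δ', lt_min hδ hδ', fun z hz => ?_⟩
    rcases hz with hz | hz
    · exact hshrink (min_le_left _ _) (h z hz)
    · exact hshrink (min_le_right _ _) (h' z hz)
  · intro z₀ _
    obtain ⟨U, hU, δ, hδ, Γ, hΓ, -⟩ := exists_flow_box z₀
    exact ⟨U, mem_nhdsWithin_of_mem_nhds hU, δ, hδ, fun z hz => ⟨_, hΓ z hz⟩⟩

variable [T2Space S]

/-- Two geodesics that agree to first order at one time can be glued. -/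
lemma IsGeodesicOn.glue {γ₁ γ₂ : ℝ → S} {J₁ J₂ : Set ℝ} (h₁ : IsGeodesicOn (E := E) γ₁ J₁)
    (h₂ : IsGeodesicOn (E := E) γ₂ J₂) (hJ₁ : IsOpen J₁) (hJ₂ : IsOpen J₂)
    (hc₁ : J₁.OrdConnected) (hc₂ : J₂.OrdConnected) {s : ℝ} (hs₁ : s ∈ J₁) (hs₂ : s ∈ J₂)
    (hv : velocity E γ₁ s = velocity E γ₂ s) :
    ∃ γ : ℝ → S, IsGeodesicOn (E := E) γ (J₁ ∪ J₂) ∧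
      Set.EqOn (velocity E γ) (velocity E γ₁) J₁ ∧ Set.EqOn (velocity E γ) (velocity E γ₂) J₂ := by
  classical
  have heq := (h₁.mono Set.inter_subset_left).eqOn (h₂.mono Set.inter_subset_right)
    (hJ₁.inter hJ₂) (hc₁.inter hc₂) ⟨hs₁, hs₂⟩ hv
  set γ : ℝ → S := fun r => if r ∈ J₁ then γ₁ r else γ₂ r with hγ
  have e₁ : ∀ r ∈ J₁, γ =ᶠ[𝓝 r] γ₁ := by
    intro r hr
    filter_upwards [hJ₁.mem_nhds hr] with q hq
    exact if_pos hq
  have e₂ : ∀ r ∈ J₂, γ =ᶠ[𝓝 r] γ₂ := by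
    intro r hr
    filter_upwards [hJ₂.mem_nhds hr] with q hq
    by_cases hq₁ : q ∈ J₁
    · rw [hγ]
      simp only [if_pos hq₁]
      exact congrArg TotalSpace.proj (heq ⟨hq₁, hq⟩)
    · exact if_neg hq₁
  refine ⟨γ, isGeodesicOn_of_forall ?_, fun r hr => velocity_congr (e₁ r hr),
    fun r hr => velocity_congr (e₂ r hr)⟩
  rintro r (hr | hr)
  · exact ⟨γ₁, J₁, hJ₁, hr, h₁, e₁ r hr⟩
  · exact ⟨γ₂, J₂, hJ₂, hr, h₂, e₂ r hr⟩

/-- A geodesic can be continued along a geodesic starting from one of its velocities. -/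
lemma IsGeodesicWith.extend {z : TangentBundle 𝓘(ℝ, E) S} {γ γ' : ℝ → S} {J : Set ℝ} {s δ : ℝ}
    (h : IsGeodesicWith z γ J) (hs : s ∈ J)
    (h' : IsGeodesicWith (velocity E γ s) γ' (Set.Ioo (-δ) δ)) :
    ∃ η, IsGeodesicWith z η (J ∪ Set.Ioo (s - δ) (s + δ)) ∧
      Set.EqOn (velocity E η) (velocity E γ) J ∧
      ∀ r ∈ Set.Ioo (s - δ) (s + δ), velocity E η r = velocity E γ' (r - s) := by
  have hδ := h'.zero_mem.2
  have hpre : (fun r => 1 * r + -s) ⁻¹' Set.Ioo (-δ) δ = Set.Ioo (s - δ) (s + δ) := by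
    ext r
    simp only [Set.mem_preimage, Set.mem_Ioo]
    constructor <;> rintro ⟨h1, h2⟩ <;> constructor <;> linarith
  have h2 := h'.isGeodesicOn.comp_mul_add isOpen_Ioo 1 (-s)
  rw [hpre] at h2
  have hv : ∀ r ∈ Set.Ioo (s - δ) (s + δ),
      velocity E (fun r => γ' (1 * r + -s)) r = velocity E γ' (r - s) := by
    intro r hr
    rw [← hpre] at hr
    rw [velocity_comp_mul_add (mdifferentiableAt_of_contMDiffOn isOpen_Ioo h'.isGeodesicOn.1 hr),
      one_smul, one_mul, ← sub_eq_add_neg]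
    rfl
  have hs2 : s ∈ Set.Ioo (s - δ) (s + δ) := ⟨by linarith, by linarith⟩
  obtain ⟨η, hη, e₁, e₂⟩ := h.isGeodesicOn.glue h2 h.isOpen isOpen_Ioo h.ordConnected
    Set.ordConnected_Ioo hs hs2 (by rw [hv s hs2, sub_self, h'.velocity_zero])
  refine ⟨η, ⟨h.isOpen.union isOpen_Ioo, ?_, .inl h.zero_mem, hη,
    (e₁ h.zero_mem).trans h.velocity_zero⟩, e₁, fun r hr => (e₂ hr).trans (hv r hr)⟩
  exact (IsPreconnected.union s hs hs2 h.ordConnected.isPreconnected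
    Set.ordConnected_Ioo.isPreconnected).ordConnected

omit [T2Space S] in
lemma IsGeodesicWith.norm_velocity {z : TangentBundle 𝓘(ℝ, E) S} {γ : ℝ → S} {J : Set ℝ}
    (h : IsGeodesicWith z γ J) {s : ℝ} (hs : s ∈ J) : ‖(velocity E γ s).2‖ = ‖z.2‖ := by
  rw [h.isGeodesicOn.norm_velocity_eq h.isOpen h.ordConnected hs h.zero_mem, h.velocity_zero]

/-- A geodesic that stays in a compact set can be extended. -/
lemma mem_expDomain_of_forall_mem {B : Set S} (hB : IsCompact B) {p : S}
    {v : TangentSpace 𝓘(ℝ, E) p}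
    (h : ∀ γ J, IsGeodesicWith ⟨p, v⟩ γ J → ∀ s ∈ J, 0 ≤ s → s ≤ 1 → γ s ∈ B) :
    v ∈ expDomain p := by
  -- Constant speed confines all velocities of the geodesic over `B` to one compact set, so a single
  -- δ serves every restart.
  obtain ⟨δ, hδ, hflow⟩ := exists_uniform_time (isCompact_ball_bundle (E := E) hB ‖v‖)
  have hv : ∀ γ J, IsGeodesicWith ⟨p, v⟩ γ J → ∀ s ∈ J, 0 ≤ s → s ≤ 1 →
      ∃ γ', IsGeodesicWith (velocity E γ s) γ' (Set.Ioo (-δ) δ) := fun γ J hγ s hs h0 h1 =>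
    hflow _ ⟨h γ J hγ s hs h0 h1, (hγ.norm_velocity hs).le⟩
  by_contra hcon
  have hno : ∀ γ J, IsGeodesicWith ⟨p, v⟩ γ J → 1 ∉ J := fun γ J hγ h1 =>
    hcon ⟨γ, isGeodesicFrom_iff.2 ⟨J, hγ, h1⟩⟩
  -- Each restart gains δ/2 while the time is at most 1. Finitely many therefore pass 1, and the
  -- interval, being order-connected, then contains 1.
  have key : ∀ n : ℕ, ∃ γ J, IsGeodesicWith ⟨p, v⟩ γ J ∧ n * (δ / 2) ∈ J := by
    intro n
    induction n with
    | zero =>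
      obtain ⟨U, hU, ε, hε, Γ, hΓ, -⟩ := exists_flow_box (⟨p, v⟩ : TangentBundle 𝓘(ℝ, E) S)
      refine ⟨_, _, hΓ _ (mem_of_mem_nhds hU), ?_⟩
      simpa using hε
    | succ n ih =>
      obtain ⟨γ, J, hγ, hn⟩ := ih
      have hn1 : n * (δ / 2) ≤ 1 := by
        by_contra! hlt
        exact hno γ J hγ (hγ.ordConnected.out hγ.zero_mem hn ⟨zero_le_one, hlt.le⟩)
      obtain ⟨γ', hγ'⟩ := hv γ J hγ _ hn (by positivity) hn1
      obtain ⟨η, hη, -⟩ := hγ.extend hn hγ'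
      refine ⟨η, _, hη, .inr ⟨?_, ?_⟩⟩ <;> push_cast <;> linarith
  obtain ⟨n, hn⟩ := exists_nat_gt (1 / (δ / 2))
  obtain ⟨γ, J, hγ, hnJ⟩ := key n
  refine hno γ J hγ (hγ.ordConnected.out hγ.zero_mem hnJ ⟨zero_le_one, ?_⟩)
  rw [div_lt_iff₀ (by positivity)] at hn
  exact hn.le

/-- Continuous dependence of geodesics on the initial velocity. -/
lemma IsGeodesicWith.eventually {z₀ : TangentBundle 𝓘(ℝ, E) S} {γ₀ : ℝ → S} {J₀ : Set ℝ}
    (h₀ : IsGeodesicWith z₀ γ₀ J₀) {s : ℝ} (hs : s ∈ J₀) :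
    ∀ N ∈ 𝓝 (velocity E γ₀ s), ∀ᶠ z in 𝓝 z₀, ∃ γ J, IsGeodesicWith z γ J ∧ s ∈ J ∧
      velocity E γ s ∈ N := by
  set P : ℝ → Prop := fun s => ∀ N ∈ 𝓝 (velocity E γ₀ s), ∀ᶠ z in 𝓝 z₀, ∃ γ J,
    IsGeodesicWith z γ J ∧ s ∈ J ∧ velocity E γ s ∈ N with hP
  have hcont := h₀.isGeodesicOn.continuousOn_velocity h₀.isOpen
  have hP0 : P 0 := by
    intro N hN
    rw [h₀.velocity_zero] at hN
    obtain ⟨U, hU, δ, hδ, Γ, hΓ, -⟩ := exists_flow_box z₀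
    filter_upwards [hN, hU] with z hz hzU
    exact ⟨_, _, hΓ z hzU, (hΓ z hzU).zero_mem, by rwa [(hΓ z hzU).velocity_zero]⟩
  -- The property spreads along the connected interval `J₀`. The principle requires propagation in
  -- both directions between nearby times, so one flow box around the velocity at `a` must serve for
  -- steps from `a` to `b` and back.
  refine h₀.ordConnected.isPreconnected.induction₂' (fun a b => P a → P b) ?_
    (fun a b c _ _ _ h1 h2 h => h2 (h1 h)) h₀.zero_mem hs hP0
  intro a ha
  obtain ⟨U, hU, δ, hδ, Γ, hΓ, hΓc⟩ := exists_flow_box (velocity E γ₀ a)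
  have step : ∀ r ∈ J₀, ∀ r' ∈ J₀, U ∈ 𝓝 (velocity E γ₀ r) → r' - r ∈ Set.Ioo (-δ) δ →
      P r → P r' := by
    intro r hr r' hr' hUr hrr hPr N hN
    have hbox := hΓ _ (mem_of_mem_nhds hUr)
    obtain ⟨η, hη, e₁, e₂⟩ := h₀.extend hr hbox
    have hr'2 : r' ∈ Set.Ioo (r - δ) (r + δ) := ⟨by linarith [hrr.1], by linarith [hrr.2]⟩
    have hval : velocity E γ₀ r' = velocity E (Γ (velocity E γ₀ r)) (r' - r) :=
      (e₁ hr').symm.trans (e₂ r' hr'2)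
    have hat : ContinuousAt (fun w => velocity E (Γ w) (r' - r)) (velocity E γ₀ r) := by
      have := hΓc.continuousAt (x := (velocity E γ₀ r, r' - r))
        (prod_mem_nhds hUr (isOpen_Ioo.mem_nhds hrr))
      exact ContinuousAt.comp (f := fun w => (w, r' - r)) (x := velocity E γ₀ r) this
        (by fun_prop)
    rw [hval] at hN
    filter_upwards [hPr _ (Filter.inter_mem hUr (hat hN))] with z hz
    obtain ⟨γ, J, hγ, hrJ, hUz, hNz⟩ := hz
    obtain ⟨η, hη, -, e₂⟩ := hγ.extend hrJ (hΓ _ hUz)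
    exact ⟨η, _, hη, .inr hr'2, by rw [e₂ r' hr'2]; exact hNz⟩
  have hUa : ∀ᶠ b in 𝓝[J₀] a, U ∈ 𝓝 (velocity E γ₀ b) :=
    (hcont a ha).eventually (eventually_mem_nhds_iff.2 hU)
  have hδa : ∀ᶠ b in 𝓝[J₀] a, b ∈ Set.Ioo (a - δ) (a + δ) :=
    mem_nhdsWithin_of_mem_nhds (Ioo_mem_nhds (by linarith) (by linarith))
  filter_upwards [hUa, hδa, self_mem_nhdsWithin] with b hUb hb hbJ
  exact ⟨step a ha b hbJ hU ⟨by linarith [hb.1], by linarith [hb.2]⟩,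
    step b hbJ a ha hUb ⟨by linarith [hb.2], by linarith [hb.1]⟩⟩

/-- Chaining flow boxes along the geodesic of `z₀` shows that all nearby initial velocities have
geodesics defined at time 1, ending close by. -/
lemma continuousOn_expMap :
    ContinuousOn (fun z : TangentBundle 𝓘(ℝ, E) S => expMap z.proj z.2)
      {z | z.2 ∈ expDomain z.proj} := by
  rintro z₀ ⟨γ₀, hγ₀⟩
  obtain ⟨J₀, h₀, h1⟩ := isGeodesicFrom_iff.1 hγ₀
  refine ContinuousAt.continuousWithinAt ?_
  intro N hN
  replace hN : N ∈ 𝓝 (γ₀ 1) := expMap_eq hγ₀ ▸ hN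
  have hproj : Continuous (TotalSpace.proj : TangentBundle 𝓘(ℝ, E) S → S) :=
    FiberBundle.continuous_proj E _
  change ∀ᶠ z in 𝓝 z₀, expMap z.proj z.2 ∈ N
  filter_upwards [h₀.eventually h1 _ (hproj.continuousAt (x := velocity E γ₀ 1) hN)] with z hz
  obtain ⟨γ, J, hγ, hJ, hNz⟩ := hz
  rw [expMap_eq (isGeodesicFrom_iff.2 ⟨J, hγ, hJ⟩)]
  exact hNz

end Flow

open Manifold

/-- Regularity, needed to compare the Riemannian distance with the topology, follows from local
compactness and the Hausdorff property. -/
lemma t3Space_of_chartedSpace (E S : Type*) [NormedAddCommGroup E] [NormedSpace ℝ E]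
    [FiniteDimensional ℝ E] [TopologicalSpace S] [T2Space S] [ChartedSpace E S] : T3Space S := by
  have : ProperSpace E := FiniteDimensional.proper ℝ E
  have : LocallyCompactSpace S := ChartedSpace.locallyCompactSpace E S
  infer_instance

/-! ### Riemannian distance and local minimizing geodesics -/

section Distance

variable {E : Type*} [NormedAddCommGroup E] [NormedSpace ℝ E] [FiniteDimensional ℝ E]
  {S : Type*} [TopologicalSpace S] [T2Space S] [ChartedSpace E S]
  [RiemannianBundle (fun x : S => TangentSpace 𝓘(ℝ, E) x)]
  [IsManifold 𝓘(ℝ, E) ∞ S]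
  [IsContMDiffRiemannianBundle 𝓘(ℝ, E) ∞ E (fun x : S => TangentSpace 𝓘(ℝ, E) x)]

omit [FiniteDimensional ℝ E] [T2Space S] in
variable (E S) in
lemma isContinuousRiemannianBundle :
    IsContinuousRiemannianBundle E (fun x : S => TangentSpace 𝓘(ℝ, E) x) := by
  obtain ⟨g, hg, h⟩ := IsContMDiffRiemannianBundle.exists_contMDiff (IB := 𝓘(ℝ, E)) (n := ∞)
    (F := E) (E := fun x : S => TangentSpace 𝓘(ℝ, E) x)
  exact ⟨g, hg.continuous, h⟩

variable (E) in
lemma exists_riemannianEDist_ball_subset {x : S} {N : Set S} (hN : N ∈ 𝓝 x) :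
    ∃ ρ > (0 : ℝ), ∀ y, riemannianEDist 𝓘(ℝ, E) x y < ENNReal.ofReal ρ → y ∈ N := by
  have := isContinuousRiemannianBundle E S
  have := t3Space_of_chartedSpace E S
  obtain ⟨c, hc, h⟩ := setOfPred_riemannianEDist_lt_subset_nhds 𝓘(ℝ, E) hN
  exact ⟨c, hc, fun y hy => h (by simpa using hy)⟩

variable (E) in
lemma continuous_riemannianEDist :
    Continuous fun q : S × S => riemannianEDist 𝓘(ℝ, E) q.1 q.2 := by
  have := isContinuousRiemannianBundle E S
  have := t3Space_of_chartedSpace E S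
  let : PseudoEMetricSpace S := .ofRiemannianMetric 𝓘(ℝ, E) S
  exact continuous_edist

variable (E) in
lemma eq_of_riemannianEDist_eq_zero {x y : S} (h : riemannianEDist 𝓘(ℝ, E) x y = 0) : x = y := by
  have := isContinuousRiemannianBundle E S
  have := t3Space_of_chartedSpace E S
  let : EMetricSpace S := .ofRiemannianMetric 𝓘(ℝ, E) S
  exact eq_of_edist_eq_zero h

omit [FiniteDimensional ℝ E] [T2Space S]
  [RiemannianBundle (fun x : S => TangentSpace 𝓘(ℝ, E) x)]
  [IsContMDiffRiemannianBundle 𝓘(ℝ, E) ∞ E (fun x : S => TangentSpace 𝓘(ℝ, E) x)] in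
lemma continuous_velocity {β : ℝ → S} (hβ : ContMDiff 𝓘(ℝ, ℝ) 𝓘(ℝ, E) 1 β) :
    Continuous (velocity E β) := by
  have h := hβ.continuous_tangentMap le_rfl
  have h2 : Continuous fun s : ℝ => (⟨s, (1 : ℝ)⟩ : TangentBundle 𝓘(ℝ, ℝ) ℝ) :=
    (tangentBundleModelSpaceHomeomorph 𝓘(ℝ, ℝ)).symm.continuous.comp
      (continuous_id.prodMk continuous_const)
  exact h.comp h2

omit [T2Space S] in
-- Passes from extended lengths to the real integrals of the energy estimates.
lemma pathELength_eq_integral {β : ℝ → S} (hβ : ContMDiff 𝓘(ℝ, ℝ) 𝓘(ℝ, E) 1 β) {a b : ℝ}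
    (hab : a ≤ b) :
    pathELength 𝓘(ℝ, E) β a b = ENNReal.ofReal (∫ s in a..b, ‖(velocity E β s).2‖) := by
  have hc : Continuous fun s => ‖(velocity E β s).2‖ :=
    continuous_norm_tangent.comp (continuous_velocity hβ)
  rw [intervalIntegral.integral_of_le hab, ← MeasureTheory.integral_Icc_eq_integral_Ioc,
    MeasureTheory.ofReal_integral_eq_lintegral_ofReal hc.continuousOn.integrableOn_Icc
      (.of_forall fun s => norm_nonneg _), pathELength_eq_lintegral_mfderiv_Icc]
  simp only [ofReal_norm]
  rfl

omit [T2Space S] in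
lemma IsGeodesicWith.riemannianEDist_le {z : TangentBundle 𝓘(ℝ, E) S} {γ : ℝ → S} {J : Set ℝ}
    (h : IsGeodesicWith z γ J) {a b : ℝ} (ha : a ∈ J) (hb : b ∈ J) (hab : a ≤ b) :
    riemannianEDist 𝓘(ℝ, E) (γ a) (γ b) ≤ ENNReal.ofReal ((b - a) * ‖z.2‖) := by
  have hsub : Set.Icc a b ⊆ J := h.ordConnected.out ha hb
  refine (riemannianEDist_le_pathELength
    ((h.isGeodesicOn.1.mono hsub).of_le (by exact_mod_cast le_top)) rfl rfl hab).trans ?_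
  rw [pathELength_eq_lintegral_mfderiv_Icc]
  have e : ∀ s ∈ Set.Icc a b, ‖mfderiv 𝓘(ℝ, ℝ) 𝓘(ℝ, E) γ s (1 : ℝ)‖ₑ = ENNReal.ofReal ‖z.2‖ := by
    intro s hs
    rw [← h.norm_velocity (hsub hs), ofReal_norm]
    rfl
  refine (MeasureTheory.setLIntegral_congr_fun measurableSet_Icc e).trans_le ?_
  simp only [MeasureTheory.lintegral_const, MeasureTheory.Measure.restrict_apply,
    MeasurableSet.univ, Set.univ_inter, Real.volume_Icc]
  rw [ENNReal.ofReal_mul (by linarith), mul_comm]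

omit [FiniteDimensional ℝ E] [T2Space S]
  [IsContMDiffRiemannianBundle 𝓘(ℝ, E) ∞ E (fun x : S => TangentSpace 𝓘(ℝ, E) x)]
  [IsManifold 𝓘(ℝ, E) ∞ S] in
/-- Almost minimizing curves through an intermediate point. -/
lemma exists_path_through {x y z : S} {L : ENNReal}
    (h : riemannianEDist 𝓘(ℝ, E) x y + riemannianEDist 𝓘(ℝ, E) y z < L) :
    ∃ β : ℝ → S, ContMDiff 𝓘(ℝ, ℝ) 𝓘(ℝ, E) 1 β ∧ β 0 = x ∧ β (1 / 2) = y ∧ β 1 = z ∧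
      pathELength 𝓘(ℝ, E) β 0 1 < L := by
  obtain ⟨u, hu, v, hv, huv⟩ := ENNReal.exists_add_lt_of_add_lt h
  -- Curves that are constant near their ends are used so that the concatenation is C¹ at the
  -- junction.
  obtain ⟨β₁, h10, h11, h1s, h1l, -, h1c⟩ :=
    exists_lt_locally_constant_of_riemannianEDist_lt hu (show (0 : ℝ) < 1 / 2 by norm_num)
  obtain ⟨β₂, h20, h21, h2s, h2l, h2c, -⟩ :=
    exists_lt_locally_constant_of_riemannianEDist_lt hv (show (1 / 2 : ℝ) < 1 by norm_num)
  classical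
  refine ⟨Set.piecewise (Set.Iic (1 / 2)) β₁ β₂,
    ContMDiff.piecewise_Iic h1s h2s (h1c.trans h2c.symm), ?_, ?_, ?_, ?_⟩
  · simp [h10]
  · rw [Set.piecewise_eq_of_mem _ _ _ Set.self_mem_Iic, h11]
  · rw [Set.piecewise_eq_of_notMem _ _ _ (by simp; norm_num), h21]
  · refine lt_trans ?_ huv
    rw [← pathELength_add (show (0 : ℝ) ≤ 1 / 2 by norm_num) (show (1 / 2 : ℝ) ≤ 1 by norm_num)]
    refine ENNReal.add_lt_add ?_ ?_
    · refine (pathELength_congr fun s hs => ?_).trans_lt h1l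
      exact Set.piecewise_eq_of_mem _ _ _ hs.2
    · refine (pathELength_congr_Ioo fun s hs => ?_).trans_lt h2l
      exact Set.piecewise_eq_of_notMem _ _ _ (not_le.2 hs.1)

omit [FiniteDimensional ℝ E] [T2Space S]
  [IsContMDiffRiemannianBundle 𝓘(ℝ, E) ∞ E (fun x : S => TangentSpace 𝓘(ℝ, E) x)]
  [IsManifold 𝓘(ℝ, E) ∞ S] in
lemma riemannianEDist_le_of_path {β : ℝ → S} (hβ : ContMDiff 𝓘(ℝ, ℝ) 𝓘(ℝ, E) 1 β) {a b : ℝ}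
    (hab : a ≤ b) :
    riemannianEDist 𝓘(ℝ, E) (β a) (β b) ≤ pathELength 𝓘(ℝ, E) β a b :=
  riemannianEDist_le_pathELength hβ.contMDiffOn rfl rfl hab

/-- Letting L decrease to D. In the application σ is the length of a geodesic, D the distance of its
ends, and m the distance from a point to the geodesic. -/
lemma eq_of_forall_sq_le {σ D l m ρ : ℝ} (hl : 0 < l) (hD : D < ρ) (hD0 : 0 ≤ D) (hDσ : D ≤ σ)
    (h : ∀ L, D < L → L ≤ ρ → σ ^ 2 + l * m ^ 2 ≤ L ^ 2) : σ = D ∧ m = 0 := by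
  have key : σ ^ 2 + l * m ^ 2 ≤ D ^ 2 := by
    have hlim : Filter.Tendsto (fun L : ℝ => L ^ 2) (𝓝[>] D) (𝓝 (D ^ 2)) :=
      ((continuous_pow 2).tendsto D).mono_left nhdsWithin_le_nhds
    refine ge_of_tendsto hlim ?_
    filter_upwards [Ioo_mem_nhdsGT hD] with L hL
    exact h L hL.1 hL.2.le
  have h1 : D ^ 2 ≤ σ ^ 2 := by gcongr
  have h2 : 0 ≤ l * m ^ 2 := by positivity
  constructor
  · refine le_antisymm ?_ hDσ
    nlinarith
  · have : l * m ^ 2 = 0 := by linarith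
    simpa [hl.ne'] using this

/-- Locally, points are joined by minimizing geodesics, which contain all the points that lie
between their end points. -/
lemma exists_local_minimizing (x₀ : S) :
    ∃ ρ > (0 : ℝ), ∀ x z : S, riemannianEDist 𝓘(ℝ, E) x₀ x < ENNReal.ofReal ρ →
      riemannianEDist 𝓘(ℝ, E) x z < ENNReal.ofReal ρ →
      ∃ (c : ℝ → S) (w : TangentBundle 𝓘(ℝ, E) S), IsGeodesicWith w c (Set.Ioo (-1) 2) ∧ c 0 = x ∧ c 1 = z ∧
        ENNReal.ofReal ‖w.2‖ = riemannianEDist 𝓘(ℝ, E) x z ∧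
        ∀ y, riemannianEDist 𝓘(ℝ, E) x y + riemannianEDist 𝓘(ℝ, E) y z
          ≤ riemannianEDist 𝓘(ℝ, E) x z → ∃ s ∈ Set.Icc (0 : ℝ) 1, y = c s := by
  set φ := extChartAt 𝓘(ℝ, E) x₀ with hφ
  have hy₀ : φ x₀ ∈ (chartLocalMetric (E := E) x₀).dom :=
    φ.map_source (mem_extChartAt_source x₀)
  obtain ⟨a, ha, l, hl, r, hr, hball, hmin⟩ := LocalMetric.exists_minimizing_solution hy₀
  have hnear (R : ℝ) (hR : 0 < R) : φ.source ∩ φ ⁻¹' Metric.closedBall (φ x₀) R ∈ 𝓝 x₀ :=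
    Filter.inter_mem (extChartAt_source_mem_nhds x₀)
      ((continuousAt_extChartAt x₀) (Metric.closedBall_mem_nhds _ hR))
  obtain ⟨ρ₁, hρ₁, h₁⟩ := exists_riemannianEDist_ball_subset E (hnear a ha)
  obtain ⟨ρ₂, hρ₂, h₂⟩ := exists_riemannianEDist_ball_subset E (hnear (r / 2) (by positivity))
  obtain ⟨ρ, hρ, hρ1, hρ2⟩ : ∃ ρ > 0, 2 * ρ ≤ ρ₁ ∧ 2 * ρ ≤ ρ₂ :=
    ⟨min ρ₁ ρ₂ / 2, by positivity, by linarith [min_le_left ρ₁ ρ₂],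
      by linarith [min_le_right ρ₁ ρ₂]⟩
  refine ⟨ρ, hρ, fun x z hx hz => ?_⟩
  have htwo : ∀ y, riemannianEDist 𝓘(ℝ, E) x y < ENNReal.ofReal ρ →
      riemannianEDist 𝓘(ℝ, E) x₀ y < ENNReal.ofReal (2 * ρ) := by
    intro y hy
    rw [two_mul, ENNReal.ofReal_add hρ.le hρ.le]
    exact riemannianEDist_triangle.trans_lt (ENNReal.add_lt_add hx hy)
  have hV₁ : ∀ y, riemannianEDist 𝓘(ℝ, E) x y < ENNReal.ofReal ρ →
      y ∈ φ.source ∩ φ ⁻¹' Metric.closedBall (φ x₀) a := fun y hy =>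
    h₁ y ((htwo y hy).trans_le (ENNReal.ofReal_le_ofReal hρ1))
  have hxx : riemannianEDist 𝓘(ℝ, E) x x < ENNReal.ofReal ρ := by
    rw [riemannianEDist_self]
    exact ENNReal.ofReal_pos.2 hρ
  have hxV := h₂ x ((htwo x hxx).trans_le (ENNReal.ofReal_le_ofReal hρ2))
  have hzV := h₂ z ((htwo z hz).trans_le (ENNReal.ofReal_le_ofReal hρ2))
  obtain ⟨c, v, hsol, hc0, hc1, hlen⟩ := hmin (φ x)
    (Metric.closedBall_subset_closedBall (by linarith) hxV.2) (φ z) (by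
      have h1 := Metric.mem_closedBall.1 hxV.2
      have h2 := Metric.mem_closedBall.1 hzV.2
      have := dist_triangle_right (φ z) (φ x) (φ x₀)
      rw [Metric.mem_closedBall]
      linarith)
  have h0 : (0 : ℝ) ∈ Set.Ioo (-1 : ℝ) 2 := by norm_num
  have hvel : velocity E (fun s => φ.symm (c s)) 0 = ofCoord x₀ (c 0, v 0) :=
    velocity_chart_symm (hsol.deriv_pos 0 h0) (hsol.mem 0 h0)
  have hw : IsGeodesicWith (ofCoord x₀ (c 0, v 0)) (fun s => φ.symm (c s)) (Set.Ioo (-1) 2) :=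
    ⟨isOpen_Ioo, Set.ordConnected_Ioo, h0, hsol.isGeodesicOn isOpen_Ioo, hvel⟩
  have he0 : φ.symm (c 0) = x := by rw [hc0, φ.left_inv hxV.1]
  have he1 : φ.symm (c 1) = z := by rw [hc1, φ.left_inv hzV.1]
  have hnorm : ‖(ofCoord x₀ (c 0, v 0)).2‖ ^ 2
      = (chartLocalMetric x₀).form (φ x) (v 0) (v 0) := by
    rw [← hc0]
    exact (chartMetric_eq_norm_sq x₀ (c 0) (v 0)).symm
  set σ := ‖(ofCoord x₀ (c 0, v 0)).2‖ with hσ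
  have hupper : riemannianEDist 𝓘(ℝ, E) x z ≤ ENNReal.ofReal σ := by
    have := hw.riemannianEDist_le h0 (show (1 : ℝ) ∈ Set.Ioo (-1 : ℝ) 2 by norm_num) zero_le_one
    simp only [he0, he1, sub_zero, one_mul] at this
    exact this
  have hD : riemannianEDist 𝓘(ℝ, E) x z ≠ ⊤ := ne_top_of_lt hz
  have hofReal := ENNReal.ofReal_toReal hD
  have hDσ : (riemannianEDist 𝓘(ℝ, E) x z).toReal ≤ σ :=
    ENNReal.toReal_le_of_le_ofReal (norm_nonneg _) hupper
  have hDρ : (riemannianEDist 𝓘(ℝ, E) x z).toReal < ρ := by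
    rwa [← ENNReal.ofReal_lt_ofReal_iff hρ, hofReal]
  -- The energy estimate is applied to an almost minimizing curve through `y`, read off at time 1/2,
  -- where the curve is at `y`.
  have key : ∀ y, riemannianEDist 𝓘(ℝ, E) x y + riemannianEDist 𝓘(ℝ, E) y z
      ≤ riemannianEDist 𝓘(ℝ, E) x z → ∀ L, (riemannianEDist 𝓘(ℝ, E) x z).toReal < L → L ≤ ρ →
      σ ^ 2 + l / 2 * Metric.infDist (φ y) (c '' Set.Icc 0 1) ^ 2 ≤ L ^ 2 := by
    intro y hy L hL hLρ
    have hL0 : 0 < L := ENNReal.toReal_nonneg.trans_lt hL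
    have hlt : riemannianEDist 𝓘(ℝ, E) x y + riemannianEDist 𝓘(ℝ, E) y z < ENNReal.ofReal L := by
      refine hy.trans_lt ?_
      rwa [← hofReal, ENNReal.ofReal_lt_ofReal_iff hL0]
    obtain ⟨β, hβ, hβ0, hβy, hβ1, hβl⟩ := exists_path_through hlt
    -- A curve from `x` of length less than ρ cannot leave the chart ball, so competitors outside
    -- the chart need no separate treatment.
    have hin : ∀ s ∈ Set.Icc (0 : ℝ) 1, β s ∈ φ.source ∩ φ ⁻¹' Metric.closedBall (φ x₀) a := by
      intro s hs
      refine hV₁ _ ?_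
      rw [← hβ0]
      refine (riemannianEDist_le_of_path hβ hs.1).trans_lt (lt_of_le_of_lt
        (pathELength_mono le_rfl hs.2) (hβl.trans_le (ENNReal.ofReal_le_ofReal hLρ)))
    have hcoord : ContinuousOn (fun s => toCoord x₀ (velocity E β s)) (Set.Icc 0 1) :=
      (continuousOn_toCoord x₀).comp (continuous_velocity hβ).continuousOn
        fun s hs => (hin s hs).1
    have hβd (s : ℝ) : MDifferentiableAt 𝓘(ℝ, ℝ) 𝓘(ℝ, E) β s :=
      hβ.mdifferentiable one_ne_zero s
    have hderiv : ∀ s ∈ Set.Ioo (0 : ℝ) 1, HasDerivAt (fun s => φ (β s))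
        (toCoord x₀ (velocity E β s)).2 s := by
      intro s hs
      have hs' := (hin s (Set.Ioo_subset_Icc_self hs)).1
      rw [toCoord_velocity (hβd s) hs']
      exact ((mdifferentiableAt_chart hs').comp s (hβd s)).differentiableAt.hasDerivAt
    have hfin := hlen (fun s => φ (β s)) (fun s => (toCoord x₀ (velocity E β s)).2)
      hcoord.fst hcoord.snd hderiv (fun s hs => (hin s hs).2) (by simp only [hβ0])
      (by simp only [hβ1]) (1 / 2) (by norm_num)
    have hint : ∫ s in (0 : ℝ)..1, √((chartLocalMetric x₀).form (φ (β s))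
        (toCoord x₀ (velocity E β s)).2 (toCoord x₀ (velocity E β s)).2)
        = ∫ s in (0 : ℝ)..1, ‖(velocity E β s).2‖ := by
      refine intervalIntegral.integral_congr fun s hs => ?_
      rw [Set.uIcc_of_le zero_le_one] at hs
      have := norm_sq_eq_chartMetric (z := velocity E β s) (hin s hs).1
      have h2 : √(‖(velocity E β s).2‖ ^ 2) = ‖(velocity E β s).2‖ := Real.sqrt_sq (norm_nonneg _)
      rw [this] at h2
      exact h2
    rw [hint, ← hnorm, hβy] at hfin
    refine hfin.trans ?_
    have hI0 : 0 ≤ ∫ s in (0 : ℝ)..1, ‖(velocity E β s).2‖ :=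
      intervalIntegral.integral_nonneg zero_le_one fun s _ => norm_nonneg _
    rw [pathELength_eq_integral hβ zero_le_one, ENNReal.ofReal_lt_ofReal_iff hL0] at hβl
    gcongr
  -- The choice y = x carries no betweenness constraint and yields that the geodesic has length
  -- equal to the distance.
  have hx := eq_of_forall_sq_le (by positivity) hDρ ENNReal.toReal_nonneg hDσ
    (key x (by rw [riemannianEDist_self, zero_add]))
  refine ⟨_, _, hw, he0, he1, ?_, fun y hy => ?_⟩
  · exact (congrArg ENNReal.ofReal hx.1).trans hofReal
  · have hy2 := (eq_of_forall_sq_le (by positivity) hDρ ENNReal.toReal_nonneg hDσ (key y hy)).2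
    have hcc : ContinuousOn c (Set.Icc 0 1) := fun s hs =>
      (hsol.deriv_pos s ⟨by linarith [hs.1], by linarith [hs.2]⟩).continuousAt.continuousWithinAt
    have hcl : IsClosed (c '' Set.Icc 0 1) := (isCompact_Icc.image_of_continuousOn hcc).isClosed
    have hmem : φ y ∈ c '' Set.Icc 0 1 := by
      rw [hcl.mem_iff_infDist_zero ((Set.nonempty_Icc.2 zero_le_one).image c)]
      exact hy2
    obtain ⟨s, hs, hsy⟩ := hmem
    refine ⟨s, hs, ?_⟩
    have hyV := hV₁ y ((le_self_add.trans hy).trans_lt hz)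
    rw [hsy, φ.left_inv hyV.1]

end Distance

/-! ### Hopf–Rinow at a point: minimizing geodesics of length at most t -/

section HopfRinow

variable {E : Type*} [NormedAddCommGroup E] [NormedSpace ℝ E] [FiniteDimensional ℝ E]
  {S : Type*} [TopologicalSpace S] [T2Space S] [ChartedSpace E S]
  [RiemannianBundle (fun x : S => TangentSpace 𝓘(ℝ, E) x)]
  [IsManifold 𝓘(ℝ, E) ∞ S]
  [IsContMDiffRiemannianBundle 𝓘(ℝ, E) ∞ E (fun x : S => TangentSpace 𝓘(ℝ, E) x)]

lemma IsGeodesicWith.eqOn {z : TangentBundle 𝓘(ℝ, E) S} {γ₁ γ₂ : ℝ → S} {J₁ J₂ : Set ℝ}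
    (h₁ : IsGeodesicWith z γ₁ J₁) (h₂ : IsGeodesicWith z γ₂ J₂) :
    Set.EqOn (velocity E γ₁) (velocity E γ₂) (J₁ ∩ J₂) :=
  (h₁.isGeodesicOn.mono Set.inter_subset_left).eqOn (h₂.isGeodesicOn.mono Set.inter_subset_right)
    (h₁.isOpen.inter h₂.isOpen) (h₁.ordConnected.inter h₂.ordConnected) ⟨h₁.zero_mem, h₂.zero_mem⟩
    (h₁.velocity_zero.trans h₂.velocity_zero.symm)

omit [T2Space S] in
lemma IsGeodesicWith.comp_mul {p : S} {v : TangentSpace 𝓘(ℝ, E) p} {γ : ℝ → S} {J : Set ℝ}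
    (h : IsGeodesicWith ⟨p, v⟩ γ J) {a : ℝ} (ha : 0 ≤ a) :
    IsGeodesicWith ⟨p, a • v⟩ (fun s => γ (a * s)) ((a * ·) ⁻¹' J) := by
  have h1 := h.isGeodesicOn.comp_mul_add h.isOpen a 0
  simp only [add_zero] at h1
  have h0 : (0 : ℝ) ∈ (a * ·) ⁻¹' J := by simpa using h.zero_mem
  have hmono : Monotone fun s : ℝ => a * s := fun x y hxy =>
    mul_le_mul_of_nonneg_left hxy ha
  refine ⟨h.isOpen.preimage (by fun_prop), h.ordConnected.preimage_mono hmono, h0, h1, ?_⟩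
  have h2 := velocity_comp_mul_add (E := E) (γ := γ) (a := a) (b := 0) (s := 0)
    (mdifferentiableAt_of_contMDiffOn h.isOpen h.isGeodesicOn.1 (by simpa using h.zero_mem))
  simp only [add_zero] at h2
  have h3 := h.velocity_zero
  rw [h2]
  have h4 : ∀ z : TangentBundle 𝓘(ℝ, E) S, z = ⟨p, v⟩ →
      (⟨z.proj, a • z.2⟩ : TangentBundle 𝓘(ℝ, E) S) = ⟨p, a • v⟩ := by
    rintro _ rfl
    rfl
  have h5 : ∀ u : ℝ, u = 0 →
      (⟨γ u, a • (velocity E γ u).2⟩ : TangentBundle 𝓘(ℝ, E) S) = ⟨p, a • v⟩ := by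
    rintro _ rfl
    exact h4 _ h3
  exact h5 _ (by simp)

omit [FiniteDimensional ℝ E] [IsContMDiffRiemannianBundle 𝓘(ℝ, E) ∞ E
    (fun x : S => TangentSpace 𝓘(ℝ, E) x)] [IsManifold 𝓘(ℝ, E) ∞ S] [T2Space S] in
lemma IsGeodesicWith.apply_zero {z : TangentBundle 𝓘(ℝ, E) S} {γ : ℝ → S} {J : Set ℝ}
    (h : IsGeodesicWith z γ J) : γ 0 = z.proj :=
  congrArg TotalSpace.proj h.velocity_zero

/-- A curve shorter than δ + e must meet the sphere of radius δ about `x` by the intermediate value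
theorem. It has used length at least δ by then, so less than e is left. -/
lemma exists_crossing {x q : S} {δ e : ENNReal} (hδ : δ ≤ riemannianEDist 𝓘(ℝ, E) x q)
    (h : riemannianEDist 𝓘(ℝ, E) x q < δ + e) :
    ∃ y, riemannianEDist 𝓘(ℝ, E) x y = δ ∧ riemannianEDist 𝓘(ℝ, E) y q < e := by
  have hδt : δ ≠ ⊤ := by
    rintro rfl
    rw [top_add] at h
    exact absurd hδ (not_le.2 h)
  obtain ⟨β, hβ0, hβ1, hβ, hl, -⟩ := exists_lt_locally_constant_of_riemannianEDist_lt h zero_lt_one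
  have hc : Continuous fun s => riemannianEDist 𝓘(ℝ, E) x (β s) :=
    (continuous_riemannianEDist E).comp (continuous_const.prodMk hβ.continuous)
  obtain ⟨s, hs, hsδ⟩ := intermediate_value_Icc zero_le_one hc.continuousOn
    (show δ ∈ Set.Icc _ _ from ⟨by simp [hβ0, riemannianEDist_self], by simpa [hβ1] using hδ⟩)
  refine ⟨β s, hsδ, ?_⟩
  have h1 := riemannianEDist_le_of_path hβ hs.1
  have h2 := riemannianEDist_le_of_path hβ hs.2
  rw [hβ0] at h1
  rw [hβ1] at h2
  have h1' : δ ≤ pathELength 𝓘(ℝ, E) β 0 s := hsδ.symm.le.trans h1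
  rw [← pathELength_add hs.1 hs.2] at hl
  exact (ENNReal.add_lt_add_iff_left hδt).1 ((add_le_add h1' h2).trans_lt hl)

variable (E) in
/-- Small spheres contain points closest to a given point outside. -/
lemma exists_step (x : S) :
    ∃ δ₀ > (0 : ℝ), ∀ δ ≤ δ₀, ∀ q, ENNReal.ofReal δ ≤ riemannianEDist 𝓘(ℝ, E) x q →
      riemannianEDist 𝓘(ℝ, E) x q ≠ ⊤ →
      ∃ x₁, riemannianEDist 𝓘(ℝ, E) x x₁ = ENNReal.ofReal δ ∧
        riemannianEDist 𝓘(ℝ, E) x₁ q + ENNReal.ofReal δ ≤ riemannianEDist 𝓘(ℝ, E) x q := by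
  have : ProperSpace E := FiniteDimensional.proper ℝ E
  have : LocallyCompactSpace S := ChartedSpace.locallyCompactSpace E S
  obtain ⟨C, hC, hCx⟩ := exists_compact_mem_nhds x
  obtain ⟨ρ, hρ, h⟩ := exists_riemannianEDist_ball_subset E hCx
  refine ⟨ρ / 2, by positivity, fun δ hδ q hq hqt => ?_⟩
  have hcomp : IsCompact {y | riemannianEDist 𝓘(ℝ, E) x y = ENNReal.ofReal δ} := by
    refine hC.of_isClosed_subset ?_ fun y hy => h y ?_
    · exact isClosed_eq ((continuous_riemannianEDist E).comp
        (continuous_const.prodMk continuous_id)) continuous_const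
    · rw [show riemannianEDist 𝓘(ℝ, E) x y = ENNReal.ofReal δ from hy]
      exact (ENNReal.ofReal_lt_ofReal_iff hρ).2 (by linarith)
  have hne : {y | riemannianEDist 𝓘(ℝ, E) x y = ENNReal.ofReal δ}.Nonempty := by
    obtain ⟨y, hy, -⟩ := exists_crossing (e := ⊤) hq (by rw [add_top]; exact hqt.lt_top)
    exact ⟨y, hy⟩
  obtain ⟨x₁, hx₁, hmin⟩ := hcomp.exists_isMinOn hne
    (f := fun y => riemannianEDist 𝓘(ℝ, E) y q) ((continuous_riemannianEDist E).comp
      (continuous_id.prodMk continuous_const)).continuousOn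
  refine ⟨x₁, hx₁, ?_⟩
  by_contra! hlt
  rw [add_comm] at hlt
  obtain ⟨y, hy, hyq⟩ := exists_crossing hq hlt
  exact absurd (hmin hy) (not_le.2 hyq)

/-- A minimizing geodesic pointing towards `q` continues to do so. -/
lemma IsGeodesicWith.exists_extend_minimizing {z : TangentBundle 𝓘(ℝ, E) S} {γ : ℝ → S}
    {J : Set ℝ} (h : IsGeodesicWith z γ J) (h1 : 1 ∈ J) {q : S} {r : ℝ} (hr : 0 < r)
    (hz : ‖z.2‖ = r) (hq : riemannianEDist 𝓘(ℝ, E) z.proj q = ENNReal.ofReal r) {s : ℝ}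
    (hs0 : 0 < s) (hs1 : s < 1)
    (hs : riemannianEDist 𝓘(ℝ, E) (γ s) q ≤ ENNReal.ofReal (r * (1 - s))) :
    ∃ s' ≤ 1, s < s' ∧ riemannianEDist 𝓘(ℝ, E) (γ s') q ≤ ENNReal.ofReal (r * (1 - s')) := by
  have hJ : Set.Icc 0 1 ⊆ J := h.ordConnected.out h.zero_mem h1
  have hγd : ∀ a b, 0 ≤ a → a ≤ b → b ≤ 1 →
      riemannianEDist 𝓘(ℝ, E) (γ a) (γ b) ≤ ENNReal.ofReal (r * (b - a)) := by
    intro a b ha hab hb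
    have := h.riemannianEDist_le (hJ ⟨ha, hab.trans hb⟩) (hJ ⟨ha.trans hab, hb⟩) hab
    rwa [hz, mul_comm] at this
  obtain ⟨ρ, hρ, hloc⟩ := exists_local_minimizing (E := E) (γ s)
  obtain ⟨δ₀, hδ₀, hstep⟩ := exists_step E (γ s)
  obtain ⟨ε, hε, hε1, hε2, hε3, hε4⟩ : ∃ ε > 0, ε ≤ ρ / 4 ∧ ε ≤ δ₀ ∧ ε ≤ r * s ∧
      ε ≤ r * (1 - s) := by
    have : 0 < r * (1 - s) := mul_pos hr (by linarith)
    exact ⟨min (min (ρ / 4) δ₀) (min (r * s) (r * (1 - s))), by positivity,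
      (min_le_left _ _).trans (min_le_left _ _), (min_le_left _ _).trans (min_le_right _ _),
      (min_le_right _ _).trans (min_le_left _ _), (min_le_right _ _).trans (min_le_right _ _)⟩
  -- The assumed upper bound on d(γ(s), q) is in fact an equality, since d(p, q) = r and γ has used
  -- at most rs.
  have hsq : ENNReal.ofReal (r * (1 - s)) ≤ riemannianEDist 𝓘(ℝ, E) (γ s) q := by
    have h2 := (riemannianEDist_triangle (I := 𝓘(ℝ, E)) (x := γ 0) (y := γ s) (z := q)).trans
      (add_le_add_left (hγd 0 s le_rfl hs0.le hs1.le) _)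
    rw [h.apply_zero, hq] at h2
    have e : ENNReal.ofReal r = ENNReal.ofReal (r * (s - 0)) + ENNReal.ofReal (r * (1 - s)) := by
      rw [← ENNReal.ofReal_add (by nlinarith) (by nlinarith)]
      congr 1
      ring
    rw [e] at h2
    exact (ENNReal.add_le_add_iff_left ENNReal.ofReal_ne_top).1 h2
  obtain ⟨x₂, hx₂, hx₂q⟩ := hstep ε hε2 q ((ENNReal.ofReal_le_ofReal hε4).trans hsq)
    (ne_top_of_le_ne_top ENNReal.ofReal_ne_top hs)
  have hx₂q' : riemannianEDist 𝓘(ℝ, E) x₂ q ≤ ENNReal.ofReal (r * (1 - s) - ε) := by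
    rw [ENNReal.ofReal_sub _ hε.le]
    exact ENNReal.le_sub_of_add_le_right ENNReal.ofReal_ne_top (hx₂q.trans hs)
  -- The time at which γ is a length ε before γ(s). The short minimizer from γ(u₀) to `x₂` will
  -- straddle γ(s), which excludes a corner there.
  set u₀ := s - ε / r with hu₀
  have hu₀s : r * (s - u₀) = ε := by rw [hu₀]; field_simp; ring
  have hu0 : 0 ≤ u₀ := by
    rw [hu₀, sub_nonneg, div_le_iff₀ hr]
    linarith
  have hu₀lt : u₀ < s := by rw [hu₀]; linarith [div_pos hε hr]
  have hfar : ∀ u, u₀ ≤ u → u ≤ s →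
      riemannianEDist 𝓘(ℝ, E) (γ u) x₂ ≤ ENNReal.ofReal (r * (s - u) + ε) := by
    intro u hu hus
    rw [ENNReal.ofReal_add (by nlinarith) hε.le]
    exact riemannianEDist_triangle.trans
      (add_le_add (hγd u s (hu0.trans hu) hus hs1.le) hx₂.le)
  -- If this distance were less than 2ε, then `q` would be closer to p than r.
  have htot : riemannianEDist 𝓘(ℝ, E) (γ u₀) x₂ = ENNReal.ofReal (2 * ε) := by
    refine le_antisymm ?_ ?_
    · have := hfar u₀ le_rfl hu₀lt.le
      rwa [hu₀s, ← two_mul] at this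
    · have h2 : ENNReal.ofReal r ≤ ENNReal.ofReal (r * (u₀ - 0)) +
          (riemannianEDist 𝓘(ℝ, E) (γ u₀) x₂ + ENNReal.ofReal (r * (1 - s) - ε)) := by
        rw [← hq, ← h.apply_zero]
        refine riemannianEDist_triangle.trans (add_le_add (hγd 0 u₀ le_rfl hu0 (by linarith)) ?_)
        exact riemannianEDist_triangle.trans (add_le_add le_rfl hx₂q')
      have h3 : r = r * (u₀ - 0) + (2 * ε + (r * (1 - s) - ε)) := by linarith
      rw [h3, ENNReal.ofReal_add (by nlinarith) (by nlinarith),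
        ENNReal.ofReal_add (by linarith) (by linarith), ← h3] at h2
      exact (ENNReal.add_le_add_iff_right ENNReal.ofReal_ne_top).1
        ((ENNReal.add_le_add_iff_left ENNReal.ofReal_ne_top).1 h2)
  obtain ⟨c, w, hc, hc0, hc1, hw, hbetween⟩ := hloc (γ u₀) x₂ (by
      rw [riemannianEDist_comm]
      refine (hγd u₀ s hu0 hu₀lt.le hs1.le).trans_lt ?_
      rw [hu₀s]
      exact (ENNReal.ofReal_lt_ofReal_iff hρ).2 (by linarith)) (by
      rw [htot]
      exact (ENNReal.ofReal_lt_ofReal_iff hρ).2 (by linarith))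
  have hwn : ‖w.2‖ = 2 * ε := by
    rw [htot] at hw
    exact (ENNReal.ofReal_eq_ofReal_iff (norm_nonneg _) (by positivity)).1 hw
  have hI : Set.Icc (0 : ℝ) 1 ⊆ Set.Ioo (-1) 2 := fun r hr => ⟨by linarith [hr.1], by linarith [hr.2]⟩
  -- Points of γ before time s lie metrically between γ(u₀) and `x₂`, hence on `c`; their distances
  -- to both ends fix the parameter. The factor `2 * ε / r` is the ratio of the speeds.
  have hagree : ∀ σ ∈ Set.Ioo (0 : ℝ) (1 / 2), γ (2 * ε / r * σ + u₀) = c σ := by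
    intro σ hσ
    set u := 2 * ε / r * σ + u₀ with hu
    have hru : r * (u - u₀) = 2 * ε * σ := by rw [hu]; field_simp; ring
    have hu1 : u₀ ≤ u := by
      have : 0 ≤ 2 * ε / r * σ := mul_nonneg (by positivity) hσ.1.le
      linarith
    have hu2 : u ≤ s := by
      have h3 : r * (u - u₀) ≤ r * (s - u₀) := by rw [hru, hu₀s]; nlinarith [hσ.2]
      linarith [le_of_mul_le_mul_left h3 hr]
    have hA := hγd u₀ u hu0 hu1 (by linarith)
    have hB := hfar u hu1 hu2
    have hsum : r * (u - u₀) + (r * (s - u) + ε) = 2 * ε := by linarith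
    obtain ⟨σ', hσ', hσγ⟩ := hbetween (γ u) (by
      refine (add_le_add hA hB).trans_eq ?_
      rw [htot, ← ENNReal.ofReal_add (by nlinarith) (by nlinarith), hsum])
    have hC := hc.riemannianEDist_le (hI ⟨le_rfl, zero_le_one⟩) (hI hσ') hσ'.1
    have hD := hc.riemannianEDist_le (hI hσ') (hI ⟨zero_le_one, le_rfl⟩) hσ'.2
    rw [hwn, hc0, ← hσγ] at hC
    rw [hwn, hc1, ← hσγ] at hD
    have htri : ∀ {a b : ℝ}, 0 ≤ a → 0 ≤ b →
        riemannianEDist 𝓘(ℝ, E) (γ u₀) (γ u) ≤ ENNReal.ofReal a →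
        riemannianEDist 𝓘(ℝ, E) (γ u) x₂ ≤ ENNReal.ofReal b → 2 * ε ≤ a + b := by
      intro a b ha hb h3 h4
      have h5 := htot.symm.le.trans (riemannianEDist_triangle.trans (add_le_add h3 h4))
      rw [← ENNReal.ofReal_add ha hb] at h5
      exact (ENNReal.ofReal_le_ofReal_iff (by linarith)).1 h5
    have h6 := htri (a := (σ' - 0) * (2 * ε)) (b := r * (s - u) + ε) (by nlinarith [hσ'.1])
      (by nlinarith) hC hB
    have h7 := htri (a := r * (u - u₀)) (b := (1 - σ') * (2 * ε)) (by nlinarith)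
      (by nlinarith [hσ'.2]) hA hD
    have h8 : σ' = σ := by
      have : 2 * ε * σ' = 2 * ε * σ := by linarith
      exact mul_left_cancel₀ (by positivity) this
    rw [hσγ, h8]
  have hmono : Monotone fun σ : ℝ => 2 * ε / r * σ + u₀ := fun a b hab => by
    dsimp only
    gcongr
  have hlast : 2 * ε / r * 1 + u₀ = s + ε / r := by rw [hu₀]; ring
  have hle : s + ε / r ≤ 1 := by
    have : ε / r ≤ 1 - s := by rw [div_le_iff₀ hr]; linarith
    linarith
  have hmem : ∀ σ ∈ Set.Icc (0 : ℝ) 1, 2 * ε / r * σ + u₀ ∈ J := by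
    intro σ hσ
    have h3 := hmono hσ.1
    have h4 := hmono hσ.2
    dsimp only at h3 h4
    refine hJ ⟨?_, ?_⟩ <;> linarith
  have hgeo := (h.isGeodesicOn.comp_mul_add h.isOpen (2 * ε / r) u₀).mono
    (Set.inter_subset_right (s := Set.Ioo (-1 : ℝ) 2))
  -- Agreement near σ = 1/4 extends to all common times by uniqueness, so γ itself passes through
  -- `x₂`.
  have heq := (hc.isGeodesicOn.mono Set.inter_subset_left).eqOn hgeo
    (isOpen_Ioo.inter (h.isOpen.preimage (by fun_prop)))
    (Set.ordConnected_Ioo.inter (h.ordConnected.preimage_mono hmono)) (s := 1 / 4)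
    ⟨by norm_num, hmem _ (by norm_num)⟩ (velocity_congr (by
      filter_upwards [Ioo_mem_nhds (show (0 : ℝ) < 1 / 4 by norm_num)
        (show (1 / 4 : ℝ) < 1 / 2 by norm_num)] with σ hσ
      exact (hagree σ hσ).symm))
  have hend : c 1 = γ (s + ε / r) := by
    rw [← hlast]
    exact congrArg TotalSpace.proj (heq ⟨by norm_num, hmem 1 (by norm_num)⟩)
  refine ⟨s + ε / r, hle, by linarith [div_pos hε hr], ?_⟩
  rw [← hend, hc1]
  refine hx₂q'.trans_eq ?_
  congr 1
  field_simp
  ring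

/-- If all geodesics from `p` exist up to length `t`, then the points at distance at most `t` are
reached by them. -/
lemma exists_expMap_eq {p q : S} {t : ℝ} (ht : 0 ≤ t)
    (hball : Metric.closedBall (0 : TangentSpace 𝓘(ℝ, E) p) t ⊆ expDomain p)
    (hq : riemannianEDist 𝓘(ℝ, E) p q ≤ ENNReal.ofReal t) :
    ∃ v ∈ Metric.closedBall (0 : TangentSpace 𝓘(ℝ, E) p) t, expMap p v = q := by
  obtain ⟨r, hr0, hrt, hr⟩ : ∃ r : ℝ, 0 ≤ r ∧ r ≤ t ∧
      riemannianEDist 𝓘(ℝ, E) p q = ENNReal.ofReal r :=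
    ⟨_, ENNReal.toReal_nonneg, ENNReal.toReal_le_of_le_ofReal ht hq,
      (ENNReal.ofReal_toReal (ne_top_of_le_ne_top ENNReal.ofReal_ne_top hq)).symm⟩
  -- For r = 0 no direction can be chosen; the zero vector works because its geodesic has length
  -- zero.
  rcases hr0.eq_or_lt with rfl | hrpos
  · have h0 : (0 : TangentSpace 𝓘(ℝ, E) p) ∈ Metric.closedBall 0 t := Metric.mem_closedBall_self ht
    obtain ⟨γ, hγ⟩ := hball h0
    refine ⟨0, h0, ?_⟩
    rw [expMap_eq hγ]
    obtain ⟨J, hJ, h1⟩ := isGeodesicFrom_iff.1 hγ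
    have h2 := hJ.riemannianEDist_le hJ.zero_mem h1 zero_le_one
    rw [norm_zero, mul_zero, ENNReal.ofReal_zero, nonpos_iff_eq_zero] at h2
    rw [← eq_of_riemannianEDist_eq_zero E h2, hJ.apply_zero]
    rw [ENNReal.ofReal_zero] at hr
    exact eq_of_riemannianEDist_eq_zero E hr
  · obtain ⟨ρ, hρ, hloc⟩ := exists_local_minimizing (E := E) p
    obtain ⟨δ₀, hδ₀, hstep⟩ := exists_step E p
    obtain ⟨δ, hδ, hδ1, hδ2, hδ3⟩ : ∃ δ > 0, δ ≤ ρ / 2 ∧ δ ≤ δ₀ ∧ δ ≤ r :=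
      ⟨min (min (ρ / 2) δ₀) r, by positivity, (min_le_left _ _).trans (min_le_left _ _),
        (min_le_left _ _).trans (min_le_right _ _), min_le_right _ _⟩
    obtain ⟨x₁, hx₁, hx₁q⟩ := hstep δ hδ2 q (by rw [hr]; exact ENNReal.ofReal_le_ofReal hδ3)
      (by rw [hr]; exact ENNReal.ofReal_ne_top)
    obtain ⟨c, ⟨p', w⟩, hc, hc0, hc1, hw, -⟩ := hloc p x₁
      (by rw [riemannianEDist_self]; exact ENNReal.ofReal_pos.2 hρ)
      (by rw [hx₁]; exact (ENNReal.ofReal_lt_ofReal_iff hρ).2 (by linarith))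
    obtain rfl : p' = p := hc.apply_zero.symm.trans hc0
    have hwn : ‖w‖ = δ := by
      rw [hx₁] at hw
      exact (ENNReal.ofReal_eq_ofReal_iff (norm_nonneg _) hδ.le).1 hw
    -- The initial velocity points towards the best point `x₁` of a small sphere and is stretched
    -- from length δ to the full length r.
    have hvn : ‖(r / δ) • w‖ = r := by
      rw [norm_smul, hwn, Real.norm_of_nonneg (by positivity)]
      field_simp
    have hvt : (r / δ) • w ∈ Metric.closedBall (0 : TangentSpace 𝓘(ℝ, E) p') t := by
      rwa [mem_closedBall_zero_iff, hvn]
    obtain ⟨γ, hγ⟩ := hball hvt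
    refine ⟨_, hvt, ?_⟩
    rw [expMap_eq hγ]
    obtain ⟨J, hJ, h1⟩ := isGeodesicFrom_iff.1 hγ
    have hJI : Set.Icc 0 1 ⊆ J := hJ.ordConnected.out hJ.zero_mem h1
    have hδr : δ / r ∈ Set.Icc (0 : ℝ) 1 := ⟨by positivity, (div_le_one hrpos).2 hδ3⟩
    have hcomp := hJ.comp_mul (a := δ / r) (by positivity)
    rw [smul_smul, show δ / r * (r / δ) = 1 by field_simp, one_smul] at hcomp
    have hstart : c 1 = γ (δ / r * 1) := congrArg TotalSpace.proj
      (hc.eqOn hcomp ⟨by norm_num, by simpa using hJI hδr⟩)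
    rw [mul_one, hc1] at hstart
    have hγc : ContinuousOn γ (Set.Icc 0 1) := hJ.isGeodesicOn.1.continuousOn.mono hJI
    -- The times at which γ has made optimal progress towards `q`. The set is compact and contains
    -- δ/r, and its maximum can only be 1.
    set A := {s ∈ Set.Icc (0 : ℝ) 1 |
      riemannianEDist 𝓘(ℝ, E) (γ s) q ≤ ENNReal.ofReal (r * (1 - s))} with hA
    have hAc : IsCompact A := by
      refine isCompact_Icc.of_isClosed_subset ?_ (Set.sep_subset _ _)
      refine isClosed_Icc.isClosed_le ?_ ?_
      · exact (continuous_riemannianEDist E).comp_continuousOn (hγc.prodMk continuousOn_const)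
      · exact (ENNReal.continuous_ofReal.comp (by fun_prop)).continuousOn
    have hδA : δ / r ∈ A := by
      refine ⟨hδr, ?_⟩
      rw [← hstart, show r * (1 - δ / r) = r - δ by field_simp, ENNReal.ofReal_sub _ hδ.le]
      exact ENNReal.le_sub_of_add_le_right ENNReal.ofReal_ne_top (hx₁q.trans_eq hr)
    obtain ⟨s, hsA, hsmax⟩ := hAc.exists_isGreatest ⟨_, hδA⟩
    have hs1 : s = 1 := by
      by_contra hne
      obtain ⟨s', hs', hss', hs'q⟩ := hJ.exists_extend_minimizing h1 hrpos hvn hr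
        ((div_pos hδ hrpos).trans_le (hsmax hδA)) (lt_of_le_of_ne hsA.1.2 hne) hsA.2
      exact absurd (hsmax ⟨⟨hsA.1.1.trans hss'.le, hs'⟩, hs'q⟩) (not_le.2 hss')
    have := hsA.2
    rw [hs1, sub_self, mul_zero, ENNReal.ofReal_zero, nonpos_iff_eq_zero] at this
    exact eq_of_riemannianEDist_eq_zero E this

end HopfRinow

/-! ### Causal curves of the product spacetime -/

section Causal

variable {E : Type*} [NormedAddCommGroup E] [NormedSpace ℝ E]
  {S : Type*} [TopologicalSpace S] [ChartedSpace E S]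

lemma timePart_mfderivWithin {γ : ℝ → ℝ × S} {A : Set ℝ} {s : ℝ} (hA : UniqueDiffWithinAt ℝ A s)
    (hγ : MDifferentiableWithinAt 𝓘(ℝ, ℝ) (𝓘(ℝ, ℝ).prod 𝓘(ℝ, E)) γ A s) :
    timePart (γ s) (mfderivWithin 𝓘(ℝ, ℝ) (𝓘(ℝ, ℝ).prod 𝓘(ℝ, E)) γ A s (1 : ℝ))
      = derivWithin (fun r => (γ r).1) A s := by
  have h := mfderiv_comp_mfderivWithin s (mdifferentiableAt_fst (I' := 𝓘(ℝ, E))) hγ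
    (uniqueMDiffWithinAt_iff_uniqueDiffWithinAt.2 hA)
  rw [mfderivWithin_eq_fderivWithin] at h
  rw [← fderivWithin_derivWithin]
  exact congr($h (1 : ℝ)).symm

lemma spacePart_mfderivWithin {γ : ℝ → ℝ × S} {A : Set ℝ} {s : ℝ} (hA : UniqueDiffWithinAt ℝ A s)
    (hγ : MDifferentiableWithinAt 𝓘(ℝ, ℝ) (𝓘(ℝ, ℝ).prod 𝓘(ℝ, E)) γ A s) :
    spacePart (γ s) (mfderivWithin 𝓘(ℝ, ℝ) (𝓘(ℝ, ℝ).prod 𝓘(ℝ, E)) γ A s (1 : ℝ))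
      = mfderivWithin 𝓘(ℝ, ℝ) 𝓘(ℝ, E) (fun r => (γ r).2) A s (1 : ℝ) := by
  have h := mfderiv_comp_mfderivWithin s (mdifferentiableAt_snd (I := 𝓘(ℝ, ℝ))) hγ
    (uniqueMDiffWithinAt_iff_uniqueDiffWithinAt.2 hA)
  exact congr($h (1 : ℝ)).symm

lemma mdifferentiableAt_prodMk_const (m : ℝ × S) :
    MDifferentiableAt 𝓘(ℝ, ℝ) (𝓘(ℝ, ℝ).prod 𝓘(ℝ, E)) (fun τ : ℝ => (τ, m.2)) m.1 :=
  mdifferentiableAt_id.prodMk mdifferentiableAt_const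

lemma timePart_timeField (m : ℝ × S) : timePart m (timeField E m) = 1 := by
  have h := mfderiv_comp m.1 (mdifferentiableAt_fst (x := (m.1, m.2)) (I' := 𝓘(ℝ, E)))
    (mdifferentiableAt_prodMk_const m)
  have h2 := congr($h (1 : ℝ)).symm
  refine h2.trans ?_
  change (mfderiv 𝓘(ℝ, ℝ) 𝓘(ℝ, ℝ) (fun τ : ℝ => τ) m.1 : ℝ →L[ℝ] ℝ) 1 = 1
  rw [mfderiv_eq_fderiv, fderiv_fun_id]
  rfl

lemma spacePart_timeField (m : ℝ × S) : spacePart m (timeField E m) = 0 := by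
  have h := mfderiv_comp m.1 (mdifferentiableAt_snd (x := (m.1, m.2)) (I := 𝓘(ℝ, ℝ)))
    (mdifferentiableAt_prodMk_const (E := E) m)
  have h2 := congr($h (1 : ℝ)).symm
  refine h2.trans ?_
  change (mfderiv 𝓘(ℝ, ℝ) 𝓘(ℝ, E) (fun _ : ℝ => m.2) m.1 : ℝ →L[ℝ] E) 1 = 0
  rw [mfderiv_const]
  rfl

variable [RiemannianBundle (fun x : S => TangentSpace 𝓘(ℝ, E) x)]

/-- Since ∂/∂t has time part 1 and no space part, the orientation condition says that the time
derivative is positive; squares can then be removed from the causality condition. -/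
lemma isFutureCausalCurve_iff {γ : ℝ → ℝ × S} {a b : ℝ} :
    IsFutureCausalCurve E γ a b ↔ a < b ∧
      ContMDiffOn 𝓘(ℝ, ℝ) (𝓘(ℝ, ℝ).prod 𝓘(ℝ, E)) ∞ γ (Set.Icc a b) ∧
      ∀ s ∈ Set.Icc a b, 0 < derivWithin (fun r => (γ r).1) (Set.Icc a b) s ∧
        ‖(mfderivWithin 𝓘(ℝ, ℝ) 𝓘(ℝ, E) (fun r => (γ r).2) (Set.Icc a b) s (1 : ℝ) :
          TangentSpace 𝓘(ℝ, E) (γ s).2)‖ ≤ derivWithin (fun r => (γ r).1) (Set.Icc a b) s := by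
  refine and_congr_right fun hab => and_congr_right fun hγ => forall₂_congr fun s hs => ?_
  have hu := uniqueDiffOn_Icc hab s hs
  have hd := (hγ s hs).mdifferentiableWithinAt (n := ∞) (by simp)
  rw [lorentz, lorentz, timePart_timeField, spacePart_timeField, timePart_mfderivWithin hu hd,
    spacePart_mfderivWithin hu hd, inner_zero_right, real_inner_self_eq_norm_sq, mul_one, sub_zero,
    and_comm]
  refine and_congr_right fun hpos => ?_
  rw [sub_nonneg, ← pow_two]
  exact sq_le_sq₀ (norm_nonneg _) hpos.le

/-- Integrate the pointwise bound of spatial speed by the time derivative. -/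
lemma IsFutureCausalCurve.riemannianEDist_le {γ : ℝ → ℝ × S} {a b : ℝ}
    (h : IsFutureCausalCurve E γ a b) :
    riemannianEDist 𝓘(ℝ, E) (γ a).2 (γ b).2 ≤ ENNReal.ofReal ((γ b).1 - (γ a).1) := by
  obtain ⟨hab, hγ, hc⟩ := isFutureCausalCurve_iff.1 h
  have hτ : ContDiffOn ℝ 1 (fun r => (γ r).1) (Set.Icc a b) :=
    (contMDiffOn_iff_contDiffOn.1 (contMDiff_fst.comp_contMDiffOn hγ)).of_le
      (by exact_mod_cast le_top)
  have hσ : ContMDiffOn 𝓘(ℝ, ℝ) 𝓘(ℝ, E) 1 (fun r => (γ r).2) (Set.Icc a b) :=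
    (contMDiff_snd.comp_contMDiffOn hγ).of_le (by exact_mod_cast le_top)
  refine (riemannianEDist_le_pathELength hσ rfl rfl hab.le).trans ?_
  rw [pathELength_eq_lintegral_mfderivWithin_Icc,
    ← intervalIntegral.integral_derivWithin_Icc_of_contDiffOn_Icc hτ hab.le, intervalIntegral.integral_of_le hab.le,
    ← MeasureTheory.integral_Icc_eq_integral_Ioc,
    MeasureTheory.ofReal_integral_eq_lintegral_ofReal]
  · refine MeasureTheory.setLIntegral_mono' measurableSet_Icc fun s hs => ?_
    rw [← ofReal_norm]
    exact ENNReal.ofReal_le_ofReal (hc s hs).2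
  · exact (hτ.continuousOn_derivWithin (uniqueDiffOn_Icc hab) le_rfl).integrableOn_Icc
  · filter_upwards [MeasureTheory.ae_restrict_mem measurableSet_Icc] with s hs
    exact (hc s hs).1.le

end Causal

/-! ### Comparison of the three sets and the equivalence -/

section Main

variable {E : Type*} [NormedAddCommGroup E] [NormedSpace ℝ E] [FiniteDimensional ℝ E]
  {S : Type*} [TopologicalSpace S] [T2Space S] [ChartedSpace E S]
  [RiemannianBundle (fun x : S => TangentSpace 𝓘(ℝ, E) x)]
  [IsManifold 𝓘(ℝ, E) ∞ S]
  [IsContMDiffRiemannianBundle 𝓘(ℝ, E) ∞ E (fun x : S => TangentSpace 𝓘(ℝ, E) x)]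
  {K : Set S} {t : ℝ}

omit [FiniteDimensional ℝ E] [T2Space S] [IsManifold 𝓘(ℝ, E) ∞ S]
  [IsContMDiffRiemannianBundle 𝓘(ℝ, E) ∞ E (fun x : S => TangentSpace 𝓘(ℝ, E) x)] in
lemma mem_closedNeighborhood_of_le {p q : S} (hp : p ∈ K)
    (h : riemannianEDist 𝓘(ℝ, E) p q ≤ ENNReal.ofReal t) :
    q ∈ closedNeighborhood (E := E) K t := by
  have h1 := (iInf₂_le (f := fun p (_ : p ∈ K) => riemannianEDist 𝓘(ℝ, E) q p) p hp).trans
    (riemannianEDist_comm.trans_le h)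
  exact h1

/-- The distance is continuous, so its infimum over the compact `K` is attained; an empty `K` is
excluded because the infimum would be ∞. -/
lemma exists_mem_of_mem_closedNeighborhood (hK : IsCompact K) {q : S}
    (h : q ∈ closedNeighborhood (E := E) K t) :
    ∃ p ∈ K, riemannianEDist 𝓘(ℝ, E) p q ≤ ENNReal.ofReal t := by
  have hne : K.Nonempty := by
    rw [Set.nonempty_iff_ne_empty]
    rintro rfl
    simp [closedNeighborhood] at h
  obtain ⟨p, hp, hmin⟩ := hK.exists_isMinOn hne (f := fun p => riemannianEDist 𝓘(ℝ, E) q p)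
    ((continuous_riemannianEDist E).comp (continuous_const.prodMk continuous_id)).continuousOn
  refine ⟨p, hp, riemannianEDist_comm.trans_le (le_trans ?_ h)⟩
  exact le_iInf₂ fun p' hp' => hmin hp'

omit [FiniteDimensional ℝ E] [T2Space S] [IsManifold 𝓘(ℝ, E) ∞ S]
  [IsContMDiffRiemannianBundle 𝓘(ℝ, E) ∞ E (fun x : S => TangentSpace 𝓘(ℝ, E) x)] in
lemma causalInfluence_inter_timeSlice_subset (ht : 0 ≤ t) :
    causalInfluence E (({0} : Set ℝ) ×ˢ K) ∩ timeSlice S t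
      ⊆ ({t} : Set ℝ) ×ˢ closedNeighborhood (E := E) K t := by
  rintro ⟨τ, q⟩ ⟨hJ, hτ, -⟩
  obtain rfl : τ = t := hτ
  refine ⟨rfl, ?_⟩
  have hself : ((τ, q) : ℝ × S) ∈ ({0} : Set ℝ) ×ˢ K → q ∈ closedNeighborhood (E := E) K τ :=
    fun h => mem_closedNeighborhood_of_le h.2 (by rw [riemannianEDist_self]; exact zero_le)
  rcases hJ with (h | ⟨⟨τ₀, p⟩, ⟨h0, hp⟩, γ, a, b, hγ, ha, hb⟩) |
    (h | ⟨⟨τ₀, p⟩, ⟨h0, hp⟩, γ, a, b, hγ, ha, hb⟩)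
  · exact hself h
  · obtain rfl : τ₀ = 0 := h0
    have h := hγ.riemannianEDist_le
    rw [ha, hb] at h
    exact mem_closedNeighborhood_of_le hp (by simpa using h)
  · exact hself h
  · obtain rfl : τ₀ = 0 := h0
    have h := hγ.riemannianEDist_le
    rw [ha, hb, riemannianEDist_comm] at h
    -- For the causal past the elapsed time is 0 - τ, which is at most τ because τ ≥ 0.
    exact mem_closedNeighborhood_of_le hp
      (h.trans (ENNReal.ofReal_le_ofReal (by simp only; linarith)))

omit [T2Space S] in
lemma IsGeodesicWith.riemannianEDist_zero_le {p : S} {v : TangentSpace 𝓘(ℝ, E) p} {γ : ℝ → S}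
    {J : Set ℝ} (h : IsGeodesicWith ⟨p, v⟩ γ J) (hv : ‖v‖ ≤ t) {s : ℝ} (hs : s ∈ J)
    (hs0 : 0 ≤ s) (hs1 : s ≤ 1) : riemannianEDist 𝓘(ℝ, E) p (γ s) ≤ ENNReal.ofReal t := by
  have h1 := h.riemannianEDist_le h.zero_mem hs hs0
  rw [h.apply_zero, sub_zero] at h1
  refine h1.trans (ENNReal.ofReal_le_ofReal ?_)
  exact (mul_le_of_le_one_left (norm_nonneg _) hs1).trans hv

/-- Any point γ(s), not only the end point, can be placed in the slice at time t: traversing γ more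
slowly keeps the lift causal. This is what confines the whole geodesic in 3 ⇒ 2. -/
lemma IsGeodesicWith.mem_causalInfluence (ht : 0 ≤ t) {p : S} (hp : p ∈ K)
    {v : TangentSpace 𝓘(ℝ, E) p} {γ : ℝ → S} {J : Set ℝ} (h : IsGeodesicWith ⟨p, v⟩ γ J)
    (hv : ‖v‖ ≤ t) {s : ℝ} (hs : s ∈ J) (hs0 : 0 ≤ s) (hs1 : s ≤ 1) :
    (t, γ s) ∈ causalInfluence E (({0} : Set ℝ) ×ˢ K) ∩ timeSlice S t := by
  refine ⟨.inl ?_, rfl, trivial⟩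
  -- For t = 0 the lift has no positive time derivative, but then v = 0 and the convention that J(K)
  -- contains K suffices.
  rcases ht.eq_or_lt with rfl | htpos
  · have h1 := h.riemannianEDist_zero_le hv hs hs0 hs1
    rw [ENNReal.ofReal_zero, nonpos_iff_eq_zero] at h1
    refine .inl ⟨rfl, ?_⟩
    rwa [← eq_of_riemannianEDist_eq_zero E h1]
  · refine .inr ⟨(0, p), ⟨rfl, hp⟩, fun σ => (t * σ, γ (s * σ)), 0, 1, ?_, ?_, ?_⟩
    · have hcomp := h.comp_mul hs0
      have hsub : Set.Icc (0 : ℝ) 1 ⊆ (s * ·) ⁻¹' J :=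
        hcomp.ordConnected.out hcomp.zero_mem (by simpa using hs)
      have hlin : ContMDiff 𝓘(ℝ, ℝ) 𝓘(ℝ, ℝ) ∞ fun σ : ℝ => t * σ := by
        rw [contMDiff_iff_contDiff]
        fun_prop
      refine isFutureCausalCurve_iff.2 ⟨zero_lt_one,
        hlin.contMDiffOn.prodMk (hcomp.isGeodesicOn.1.mono hsub), fun σ hσ => ?_⟩
      have hu := uniqueDiffOn_Icc (zero_lt_one' ℝ) σ hσ
      have hd : derivWithin (fun r : ℝ => t * r) (Set.Icc 0 1) σ = t := by
        have : HasDerivAt (fun r : ℝ => t * r) t σ := by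
          simpa using (hasDerivAt_id σ).const_mul t
        exact this.hasDerivWithinAt.derivWithin hu
      have hm : mfderivWithin 𝓘(ℝ, ℝ) 𝓘(ℝ, E) (fun r => γ (s * r)) (Set.Icc 0 1) σ
          = mfderiv 𝓘(ℝ, ℝ) 𝓘(ℝ, E) (fun r => γ (s * r)) σ :=
        mfderivWithin_eq_mfderiv (uniqueMDiffWithinAt_iff_uniqueDiffWithinAt.2 hu)
          (mdifferentiableAt_of_contMDiffOn hcomp.isOpen hcomp.isGeodesicOn.1 (hsub hσ))
      have hn := hcomp.norm_velocity (hsub hσ)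
      simp only [hd, hm]
      refine ⟨htpos, hn.trans_le ?_⟩
      rw [norm_smul, Real.norm_of_nonneg hs0]
      exact (mul_le_of_le_one_left (norm_nonneg _) hs1).trans hv
    · simp only [mul_zero, h.apply_zero]
    · simp only [mul_one]

lemma closedNeighborhood_eq_iUnion (hK : IsCompact K) (ht : 0 ≤ t)
    (h : ∀ p ∈ K, Metric.closedBall (0 : TangentSpace 𝓘(ℝ, E) p) t ⊆ expDomain p) :
    closedNeighborhood (E := E) K t
      = ⋃ p ∈ K, expMap p '' Metric.closedBall (0 : TangentSpace 𝓘(ℝ, E) p) t := by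
  ext q
  simp only [Set.mem_iUnion, Set.mem_image, exists_prop]
  constructor
  · intro hq
    obtain ⟨p, hp, hpq⟩ := exists_mem_of_mem_closedNeighborhood hK hq
    exact ⟨p, hp, exists_expMap_eq ht (h p hp) hpq⟩
  · rintro ⟨p, hp, v, hv, rfl⟩
    obtain ⟨γ, hγ⟩ := h p hp hv
    obtain ⟨J, hJ, h1⟩ := isGeodesicFrom_iff.1 hγ
    rw [expMap_eq hγ]
    exact mem_closedNeighborhood_of_le hp
      (hJ.riemannianEDist_zero_le (mem_closedBall_zero_iff.1 hv) h1 zero_le_one le_rfl)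

/-- The union of the exponential images is one continuous image of the compact ball bundle over `K`.
-/
lemma isCompact_closedNeighborhood (hK : IsCompact K) (ht : 0 ≤ t)
    (h : ∀ p ∈ K, Metric.closedBall (0 : TangentSpace 𝓘(ℝ, E) p) t ⊆ expDomain p) :
    IsCompact (closedNeighborhood (E := E) K t) := by
  have himage : closedNeighborhood (E := E) K t
      = (fun z : TangentBundle 𝓘(ℝ, E) S => expMap z.proj z.2) '' {z | z.proj ∈ K ∧ ‖z.2‖ ≤ t} := by
    rw [closedNeighborhood_eq_iUnion hK ht h]
    ext q
    simp only [Set.mem_iUnion, Set.mem_image, exists_prop, mem_closedBall_zero_iff]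
    exact ⟨fun ⟨p, hp, v, hv, hq⟩ => ⟨⟨p, v⟩, ⟨hp, hv⟩, hq⟩,
      fun ⟨⟨p, v⟩, ⟨hp, hv⟩, hq⟩ => ⟨p, hp, v, hv, hq⟩⟩
  rw [himage]
  exact (isCompact_ball_bundle hK t).image_of_continuousOn
    (continuousOn_expMap.mono fun z hz => h z.proj hz.1 (mem_closedBall_zero_iff.2 hz.2))

lemma prod_closedNeighborhood_eq (hK : IsCompact K) (ht : 0 ≤ t)
    (h : ∀ p ∈ K, Metric.closedBall (0 : TangentSpace 𝓘(ℝ, E) p) t ⊆ expDomain p) :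
    ({t} : Set ℝ) ×ˢ closedNeighborhood (E := E) K t
      = causalInfluence E (({0} : Set ℝ) ×ˢ K) ∩ timeSlice S t := by
  refine Set.Subset.antisymm ?_ (causalInfluence_inter_timeSlice_subset ht)
  rintro ⟨τ, q⟩ ⟨hτ, hq⟩
  obtain rfl : τ = t := hτ
  obtain ⟨p, hp, hpq⟩ := exists_mem_of_mem_closedNeighborhood hK hq
  obtain ⟨v, hv, rfl⟩ := exists_expMap_eq ht (h p hp) hpq
  obtain ⟨γ, hγ⟩ := h p hp hv
  obtain ⟨J, hJ, h1⟩ := isGeodesicFrom_iff.1 hγ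
  rw [expMap_eq hγ]
  exact hJ.mem_causalInfluence ht hp (mem_closedBall_zero_iff.1 hv) h1 zero_le_one le_rfl

/-- A geodesic of length at most t from `K` never leaves the compact set, so it can be continued to
time 1. -/
lemma subset_expDomain_of_isCompact_closedNeighborhood
    (hC : IsCompact (closedNeighborhood (E := E) K t)) {p : S} (hp : p ∈ K) :
    Metric.closedBall (0 : TangentSpace 𝓘(ℝ, E) p) t ⊆ expDomain p := fun _ hv =>
  mem_expDomain_of_forall_mem hC fun _ _ hγ _ hs hs0 hs1 => mem_closedNeighborhood_of_le hp
    (hγ.riemannianEDist_zero_le (mem_closedBall_zero_iff.1 hv) hs hs0 hs1)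

/-- The compact set that traps the geodesic is here the spatial projection of J(K) ∩ Σ_t. -/
lemma subset_expDomain_of_isCompact_causalInfluence (ht : 0 ≤ t)
    (hC : IsCompact (causalInfluence E (({0} : Set ℝ) ×ˢ K) ∩ timeSlice S t)) {p : S}
    (hp : p ∈ K) :
    Metric.closedBall (0 : TangentSpace 𝓘(ℝ, E) p) t ⊆ expDomain p := fun _ hv =>
  mem_expDomain_of_forall_mem (hC.image continuous_snd) fun _ _ hγ _ hs hs0 hs1 =>
    ⟨_, hγ.mem_causalInfluence ht hp (mem_closedBall_zero_iff.1 hv) hs hs0 hs1, rfl⟩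

end Main

end Ultrastatic

end

theorem mainTheorem10
    {E : Type*} [NormedAddCommGroup E] [NormedSpace ℝ E] [FiniteDimensional ℝ E]
    {S : Type*} [TopologicalSpace S] [T2Space S] [ChartedSpace E S] [IsManifold 𝓘(ℝ, E) ∞ S]
    [RiemannianBundle (fun x : S => TangentSpace 𝓘(ℝ, E) x)]
    [IsContMDiffRiemannianBundle 𝓘(ℝ, E) ∞ E (fun x : S => TangentSpace 𝓘(ℝ, E) x)]
    (K : Set S) (hK : IsCompact K) (t : ℝ) (ht : 0 ≤ t) :
    [IsCompact (Ultrastatic.closedNeighborhood (E := E) K t),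
      ∀ p ∈ K, Metric.closedBall (0 : TangentSpace 𝓘(ℝ, E) p) t ⊆ Ultrastatic.expDomain p,
      IsCompact (Ultrastatic.causalInfluence E (({0} : Set ℝ) ×ˢ K) ∩
        Ultrastatic.timeSlice S t)].TFAE ∧
    (IsCompact (Ultrastatic.closedNeighborhood (E := E) K t) →
      Ultrastatic.closedNeighborhood (E := E) K t =
          ⋃ p ∈ K, Ultrastatic.expMap p '' Metric.closedBall (0 : TangentSpace 𝓘(ℝ, E) p) t ∧
      ({t} : Set ℝ) ×ˢ Ultrastatic.closedNeighborhood (E := E) K t =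
          Ultrastatic.causalInfluence E (({0} : Set ℝ) ×ˢ K) ∩ Ultrastatic.timeSlice S t) := by
  have h12 (hC : IsCompact (Ultrastatic.closedNeighborhood (E := E) K t)) :
      ∀ p ∈ K, Metric.closedBall (0 : TangentSpace 𝓘(ℝ, E) p) t ⊆ Ultrastatic.expDomain p :=
    fun p hp => Ultrastatic.subset_expDomain_of_isCompact_closedNeighborhood hC hp
  refine ⟨?_, fun hC => ⟨Ultrastatic.closedNeighborhood_eq_iUnion hK ht (h12 hC),
    Ultrastatic.prod_closedNeighborhood_eq hK ht (h12 hC)⟩⟩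
  tfae_have 1 → 2 := h12
  tfae_have 2 → 1 := Ultrastatic.isCompact_closedNeighborhood hK ht
  tfae_have 2 → 3 := by
    intro h
    rw [← Ultrastatic.prod_closedNeighborhood_eq hK ht h]
    exact isCompact_singleton.prod (Ultrastatic.isCompact_closedNeighborhood hK ht h)
  tfae_have 3 → 2 := fun hC p hp =>
    Ultrastatic.subset_expDomain_of_isCompact_causalInfluence ht hC hp
  tfae_finish
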